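/- Let $n\ge 4$ and let $\Gamma$ be an admissible graph with $n$ half-edges, i.e. a finite connected acyclic graph in which every vertex is incident to exactly three edges; an edge has either two endpoints (internal edge, the set of these being $E_{\rm int}(\Gamma)$) or only one endpoint (half-edge), and the half-edges are numbered by $1,\dots,n$. Let $\ell_1,\dots,\ell_n$ be positive real numbers with $\ell_j<\frac12(\ell_1+\dots+\ell_n)$ for all $j$. Equip $\mathfrak{su}(2)$ with the scalar product $\langle\xi,\eta\rangle=-\frac12\operatorname{tr}(\xi\eta)$, use it to identify $\mathfrak{su}(2)^*$ with $\mathfrak{su}(2)$, and let $S^2_{r}\subset\mathfrak{su}(2)^*$ be the sphere of radius $r$ with its Kirillov–Kostant–Souriau coadjoint orbit symplectic form (of total volume $2\pi r$). Let $\mathcal M_\ell=\{(x_i)\in S^2_{\ell_1}\times\dots\times S^2_{\ell_n} : x_1+\dots+x_n=0\}/SU(2)$ be the symplectic quotient, and $S_\ell\subset\mathcal M_\ell$ the set of classes of tuples whose vectors all belong to one line; $\mathcal M_\ell\setminus S_\ell$ is a symplectic manifold of dimension $2(n-3)$. Orient the internal edges. For $a\in E_{\rm int}(\Gamma)$ let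 $I(a)$ be the set of half-edges connected to the initial vertex of $a$ by a path which does not contain its terminal vertex, and set $\lambda_a([x_1,\dots,x_n])=\bigl|\sum_{i\in I(a)}x_i\bigr|$ and $\lambda=(\lambda_a)_a:\mathcal M_\ell\to\mathbb R^{E_{\rm int}(\Gamma)}$. Let $\mathcal M^*_{\ell,\Gamma}$ be the open subset of $\mathcal M_\ell\setminus S_\ell$ on which no $\lambda_a$ vanishes. Let $\Delta(\ell,\Gamma)\subset\mathbb R^{E_{\rm int}(\Gamma)}$ be the polyhedron of the non-negative tuples $(d_a)$ such that, with $d_i:=\ell_i$ for the half-edges $i$, the numbers $d_a,d_b,d_c$ satisfy the triangle inequalities $|d_a-d_b|\le d_c\le d_a+d_b$ whenever $a,b,c$ are the three edges incident to a vertex of $\Gamma$; let $\mathcal M^{\rm reg}_{\ell,\Gamma}=\lambda^{-1}(\operatorname{Int}\Delta(\ell,\Gamma))$. Then for every $a\in E_{\rm int}(\Gamma)$ the function $\frac12\lambda_a$ has a unique Hamiltonian flow on $\mathcal M^*_{\ell,\Gamma}$, defined for all times. These flows mutually commute and are $2\pi$-periodic; consequently they define a smooth action of the torus $\mathbb T^{E_{\rm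 int}(\Gamma)}$, $\mathbb T=\mathbb R/2\pi\mathbb Z$, on $\mathcal M^*_{\ell,\Gamma}$, whose $a$-th circle factor acts by the flow of $\frac12\lambda_a$. Moreover $\mathcal M^{\rm reg}_{\ell,\Gamma}\subset\mathcal M^*_{\ell,\Gamma}$, the action is free on $\mathcal M^{\rm reg}_{\ell,\Gamma}$ (the stabilizer of each of its points is trivial), and the fibre of $\lambda$ through any point of $\mathcal M^{\rm reg}_{\ell,\Gamma}$ is exactly the torus orbit of that point. -/

import Mathlib

open scoped Manifold ContDiff Topology

noncomputable section

namespace PolygonSpace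

/-! ### The Lie algebra of SU(2), its invariant scalar product and the adjoint action -/

/-- The group `SU(2)`. -/
abbrev SU2 : Type := Matrix.specialUnitaryGroup (Fin 2) ℂ

/-- Skew-Hermitian trace-free matrices of size two. -/
def lieSubmodule : Submodule ℝ (Matrix (Fin 2) (Fin 2) ℂ) where
  carrier := {A | star A = -A ∧ A.trace = 0}
  add_mem' := by
    rintro A B ⟨h1, h2⟩ ⟨h3, h4⟩
    exact ⟨by rw [star_add, h1, h3, neg_add], by rw [Matrix.trace_add, h2, h4, add_zero]⟩
  zero_mem' := ⟨by simp, by simp⟩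
  smul_mem' := by
    rintro c A ⟨h1, h2⟩
    exact ⟨by rw [star_smul, h1]; simp, by rw [Matrix.trace_smul, h2, smul_zero]⟩

/-- The Lie algebra `su(2)`, as a type of its own: it carries the norm of the invariant
scalar product below. -/
def LieSU2 : Type := lieSubmodule

instance : AddCommGroup LieSU2 := inferInstanceAs (AddCommGroup lieSubmodule)

instance : Module ℝ LieSU2 := inferInstanceAs (Module ℝ lieSubmodule)

/-- The underlying matrix of an element of `su(2)`. -/
def mat : LieSU2 →ₗ[ℝ] Matrix (Fin 2) (Fin 2) ℂ := lieSubmodule.subtype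

theorem mat_injective : Function.Injective mat := Subtype.val_injective

/-- The element of `su(2)` given by a matrix that is skew-Hermitian and trace-free. -/
def ofMat (A : Matrix (Fin 2) (Fin 2) ℂ) (h : star A = -A) (h' : A.trace = 0) : LieSU2 :=
  (⟨A, h, h'⟩ : lieSubmodule)

@[simp] theorem mat_ofMat (A : Matrix (Fin 2) (Fin 2) ℂ) (h : star A = -A) (h' : A.trace = 0) :
    mat (ofMat A h h') = A := rfl

theorem star_mat (A : LieSU2) : star (mat A) = -mat A := A.2.1

theorem trace_mat (A : LieSU2) : (mat A).trace = 0 := A.2.2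

/-- The matrix with real coordinates `a, b, c`. -/
def coordMat (a b c : ℝ) : Matrix (Fin 2) (Fin 2) ℂ := !![⟨0, a⟩, ⟨b, c⟩; ⟨-b, c⟩, ⟨0, -a⟩]

theorem exists_coord (A : LieSU2) : ∃ a b c : ℝ, mat A = coordMat a b c := by
  have h := star_mat A
  have h' := trace_mat A
  rw [Matrix.trace_fin_two] at h'
  have h00 := congrFun (congrFun h 0) 0
  have h01 := congrFun (congrFun h 0) 1
  simp only [Matrix.star_apply, Matrix.neg_apply, Complex.ext_iff, Complex.star_def,
    Complex.conj_re, Complex.conj_im, Complex.neg_re, Complex.neg_im, Complex.add_re,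
    Complex.add_im, Complex.zero_re, Complex.zero_im] at h00 h01 h'
  refine ⟨(mat A 0 0).im, (mat A 0 1).re, (mat A 0 1).im, ?_⟩
  ext i j
  fin_cases i <;> fin_cases j <;> apply Complex.ext <;>
    simp [coordMat] <;> linarith [h00.1, h00.2, h01.1, h01.2, h'.1, h'.2]

theorem coordMat_mem (a b c : ℝ) : star (coordMat a b c) = -coordMat a b c ∧
    (coordMat a b c).trace = 0 := by
  constructor
  · ext i j
    fin_cases i <;> fin_cases j <;> apply Complex.ext <;> simp [coordMat]
  · rw [Matrix.trace_fin_two]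
    apply Complex.ext <;> simp [coordMat]

/-- The invariant scalar product `⟨ξ, η⟩ = -½ tr(ξη)`. -/
abbrev innerCore : InnerProductSpace.Core ℝ LieSU2 where
  inner A B := -(1 / 2) * ((mat A * mat B).trace).re
  conj_inner_symm A B := by rw [Matrix.trace_mul_comm]; simp
  re_inner_nonneg A := by
    obtain ⟨a, b, c, h⟩ := exists_coord A
    rw [h, Matrix.trace_fin_two]
    simp [coordMat, Matrix.mul_apply, Fin.sum_univ_two]
    nlinarith [sq_nonneg a, sq_nonneg b, sq_nonneg c]
  add_left A B C := by
    rw [map_add, add_mul, Matrix.trace_add, Complex.add_re]; ring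
  smul_left A B r := by
    rw [map_smul, smul_mul_assoc, Matrix.trace_smul, Complex.smul_re]; simp; ring
  definite A hA := by
    obtain ⟨a, b, c, h⟩ := exists_coord A
    rw [h, Matrix.trace_fin_two] at hA
    simp [coordMat, Matrix.mul_apply, Fin.sum_univ_two] at hA
    have ha : a = 0 := by nlinarith [sq_nonneg a, sq_nonneg b, sq_nonneg c]
    have hb : b = 0 := by nlinarith [sq_nonneg a, sq_nonneg b, sq_nonneg c]
    have hc : c = 0 := by nlinarith [sq_nonneg a, sq_nonneg b, sq_nonneg c]
    apply mat_injective
    rw [h, ha, hb, hc, map_zero]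
    ext i j
    fin_cases i <;> fin_cases j <;> apply Complex.ext <;> simp [coordMat]

instance : NormedAddCommGroup LieSU2 := innerCore.toNormedAddCommGroup

instance : InnerProductSpace ℝ LieSU2 := InnerProductSpace.ofCore innerCore.toCore

theorem inner_def (A B : LieSU2) :
    inner ℝ A B = -(1 / 2) * ((mat A * mat B).trace).re := rfl

/-- The Lie bracket of `su(2)`: the commutator. -/
def bracket (A B : LieSU2) : LieSU2 :=
  ofMat (mat A * mat B - mat B * mat A)
    (by rw [star_sub, star_mul, star_mul, star_mat, star_mat]; simp)
    (by rw [Matrix.trace_sub, Matrix.trace_mul_comm, sub_self])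

/-- The adjoint action of `SU(2)` on `su(2)`: `g • ξ = g ξ g⁻¹`. -/
instance : MulAction SU2 LieSU2 where
  smul g A := ofMat ((g : Matrix (Fin 2) (Fin 2) ℂ) * mat A * (star g : SU2))
    (by simp [star_mul, star_mat, mul_assoc])
    (by
      rw [Matrix.trace_mul_comm, ← mul_assoc]
      have : ((star g : SU2) : Matrix (Fin 2) (Fin 2) ℂ) * g = 1 :=
        Matrix.mem_unitaryGroup_iff'.1 (Matrix.mem_specialUnitaryGroup_iff.1 g.2).1
      rw [this, one_mul, trace_mat])
  one_smul A := mat_injective (by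
    change ((1 : SU2) : Matrix (Fin 2) (Fin 2) ℂ) * mat A * (star (1 : SU2) : SU2) = mat A
    simp)
  mul_smul g h A := mat_injective (by
    change ((g * h : SU2) : Matrix (Fin 2) (Fin 2) ℂ) * mat A * (star (g * h) : SU2) =
      g * ((h : Matrix (Fin 2) (Fin 2) ℂ) * mat A * (star h : SU2)) * (star g : SU2)
    rw [star_mul]
    simp [mul_assoc])

theorem mat_smul (g : SU2) (A : LieSU2) :
    mat (g • A) = (g : Matrix (Fin 2) (Fin 2) ℂ) * mat A * star (g : Matrix (Fin 2) (Fin 2) ℂ) :=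
  rfl

theorem star_mul_self' (g : SU2) :
    star (g : Matrix (Fin 2) (Fin 2) ℂ) * (g : Matrix (Fin 2) (Fin 2) ℂ) = 1 :=
  Matrix.mem_unitaryGroup_iff'.1 (Matrix.mem_specialUnitaryGroup_iff.1 g.2).1

/-- The adjoint action by a fixed group element as a linear isometry. -/
def adj (g : SU2) : LieSU2 →ₗᵢ[ℝ] LieSU2 where
  toFun A := g • A
  map_add' A B := mat_injective (by simp only [mat_smul, map_add, mul_add, add_mul])
  map_smul' r A := mat_injective (by simp [mat_smul])
  norm_map' A := by
    have h : inner ℝ (g • A) (g • A) = inner ℝ A A := by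
      rw [inner_def, inner_def, mat_smul]
      have : (g : Matrix (Fin 2) (Fin 2) ℂ) * mat A * star (g : Matrix (Fin 2) (Fin 2) ℂ) *
          ((g : Matrix (Fin 2) (Fin 2) ℂ) * mat A * star (g : Matrix (Fin 2) (Fin 2) ℂ)) =
          (g : Matrix (Fin 2) (Fin 2) ℂ) * (mat A * mat A) *
            star (g : Matrix (Fin 2) (Fin 2) ℂ) := by
        calc _ = (g : Matrix (Fin 2) (Fin 2) ℂ) * mat A *
              (star (g : Matrix (Fin 2) (Fin 2) ℂ) * (g : Matrix (Fin 2) (Fin 2) ℂ)) * mat A *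
                star (g : Matrix (Fin 2) (Fin 2) ℂ) := by simp only [mul_assoc]
          _ = _ := by rw [star_mul_self']; simp only [mul_assoc, mul_one]
      rw [this, Matrix.trace_mul_comm, ← mul_assoc, star_mul_self', one_mul]
    rw [real_inner_self_eq_norm_sq, real_inner_self_eq_norm_sq] at h
    exact (sq_eq_sq₀ (norm_nonneg _) (norm_nonneg _)).1 h

@[simp] theorem adj_apply (g : SU2) (A : LieSU2) : adj g A = g • A := rfl

/-- The Kirillov-Kostant-Souriau symplectic form of the (co)adjoint orbit of `x`, i.e. the sphere of
radius `‖x‖`, at the point `x`, on tangent vectors `u, v`; see `kks_bracket` for its usual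
characterization. With it the symplectic volume of the sphere of radius `r` is `2πr`. -/
def kks (x u v : LieSU2) : ℝ := -(inner ℝ x (bracket u v)) / (4 * ‖x‖ ^ 2)

/-- The value of the symplectic form on the infinitesimal generators `[ξ, x]` and `[η, x]` of the
adjoint action. The sign is such that the inclusion of the orbit in `su(2)` is a momentum `μ` of
the adjoint action for the convention `dμ^ξ + ω([ξ, ·], ·) = 0`. -/
theorem kks_bracket (x ξ η : LieSU2) :
    kks x (bracket ξ x) (bracket η x) = -inner ℝ x (bracket ξ η) := by
  by_cases hx : x = 0
  · subst hx; simp [kks]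
  have hx' : 4 * ‖x‖ ^ 2 ≠ 0 := by positivity
  rw [kks, div_eq_iff hx', ← real_inner_self_eq_norm_sq]
  obtain ⟨a, b, c, h⟩ := exists_coord x
  obtain ⟨a', b', c', h'⟩ := exists_coord ξ
  obtain ⟨a'', b'', c'', h''⟩ := exists_coord η
  simp only [inner_def, bracket, mat_ofMat, h, h', h'', Matrix.trace_fin_two]
  simp [coordMat, Matrix.mul_apply, Fin.sum_univ_two]
  ring

theorem anticomm (a w : LieSU2) : mat a * mat w + mat w * mat a =
    (-2 * inner ℝ a w) • (1 : Matrix (Fin 2) (Fin 2) ℂ) := by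
  obtain ⟨a1, b1, c1, h⟩ := exists_coord a
  obtain ⟨a2, b2, c2, h'⟩ := exists_coord w
  rw [inner_def, h, h', Matrix.trace_fin_two]
  ext i j
  fin_cases i <;> fin_cases j <;> apply Complex.ext <;>
    simp [coordMat, Matrix.mul_apply, Fin.sum_univ_two] <;> ring

/-- A unit vector of `su(2)`, seen as an element of `SU(2)`. -/
def unitElt (m : LieSU2) (hm : ‖m‖ = 1) : SU2 := ⟨mat m, by
  have h1 : mat m * mat m = -1 := by
    have := anticomm m m
    rw [real_inner_self_eq_norm_sq, hm, ← two_nsmul] at this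
    have h2 : (2 : ℝ) • (mat m * mat m) = (2 : ℝ) • (-1 : Matrix (Fin 2) (Fin 2) ℂ) := by
      rw [← Nat.cast_smul_eq_nsmul ℝ] at this
      simpa using this
    exact smul_right_injective _ (two_ne_zero) h2
  rw [Matrix.mem_specialUnitaryGroup_iff]
  constructor
  · rw [Matrix.mem_unitaryGroup_iff, star_mat, mul_neg, h1, neg_neg]
  · have h3 : inner ℝ m m = 1 := by rw [real_inner_self_eq_norm_sq, hm]; norm_num
    obtain ⟨a, b, c, h⟩ := exists_coord m
    rw [inner_def, h, Matrix.trace_fin_two] at h3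
    rw [h, Matrix.det_fin_two]
    simp [coordMat, Matrix.mul_apply, Fin.sum_univ_two] at h3
    apply Complex.ext <;> simp [coordMat] <;> linarith⟩

/-- Unit vectors act by half-turns. -/
theorem unitElt_smul (m : LieSU2) (hm : ‖m‖ = 1) (w : LieSU2) :
    unitElt m hm • w = (2 * inner ℝ m w) • m - w := by
  apply mat_injective
  rw [mat_smul, map_sub, map_smul]
  change mat m * mat w * star (mat m) = _
  have h := anticomm m w
  have h1 : mat m * mat m = -1 := by
    have := (Matrix.mem_unitaryGroup_iff.1
      (Matrix.mem_specialUnitaryGroup_iff.1 (unitElt m hm).2).1)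
    change mat m * star (mat m) = 1 at this
    rw [star_mat, mul_neg] at this
    rw [← this, neg_neg]
  rw [star_mat, mul_neg, eq_sub_of_add_eq h, sub_mul, mul_assoc, h1]
  simp
  abel

/-- The half-turn with axis `a`. -/
def halfTurn (a w : LieSU2) : LieSU2 := (2 * inner ℝ a w / inner ℝ a a) • a - w

theorem exists_halfTurn {a : LieSU2} (ha : a ≠ 0) : ∃ g : SU2, ∀ w, g • w = halfTurn a w := by
  have hn : ‖a‖ ≠ 0 := norm_ne_zero_iff.2 ha
  refine ⟨unitElt (‖a‖⁻¹ • a) (by rw [norm_smul, norm_inv, norm_norm, inv_mul_cancel₀ hn]), ?_⟩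
  intro w
  rw [unitElt_smul, halfTurn, smul_smul, real_inner_smul_left, real_inner_self_eq_norm_sq]
  congr 2
  field_simp

theorem finrank_lieSU2 : Module.finrank ℝ LieSU2 = 3 := by
  let f : (Fin 3 → ℝ) →ₗ[ℝ] LieSU2 :=
    { toFun := fun v => ofMat (coordMat (v 0) (v 1) (v 2)) (coordMat_mem _ _ _).1
        (coordMat_mem _ _ _).2
      map_add' := fun v w => mat_injective (by
        ext i j
        fin_cases i <;> fin_cases j <;> apply Complex.ext <;> simp [coordMat] <;> ring)
      map_smul' := fun r w => mat_injective (by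
        ext i j
        fin_cases i <;> fin_cases j <;> apply Complex.ext <;> simp [coordMat]) }
  have hf : Function.Bijective f := by
    constructor
    · rw [injective_iff_map_eq_zero]
      intro v hv
      have h := congrArg mat hv
      have h00 := congrFun (congrFun h 0) 0
      have h01 := congrFun (congrFun h 0) 1
      simp [f, coordMat, Complex.ext_iff] at h00 h01
      ext i
      fin_cases i <;> simp [h00, h01]
    · intro A
      obtain ⟨a, b, c, h⟩ := exists_coord A
      exact ⟨![a, b, c], mat_injective (by simp [f, h])⟩
  rw [← (LinearEquiv.ofBijective f hf).finrank_eq]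
  simp

instance : FiniteDimensional ℝ LieSU2 := FiniteDimensional.of_finrank_pos (by
  rw [finrank_lieSU2]; norm_num)

theorem inner_bracket_left (u v : LieSU2) : inner ℝ u (bracket u v) = 0 := by
  obtain ⟨a, b, c, h⟩ := exists_coord u
  obtain ⟨a', b', c', h'⟩ := exists_coord v
  simp only [inner_def, bracket, mat_ofMat, h, h', Matrix.trace_fin_two]
  simp [coordMat, Matrix.mul_apply, Fin.sum_univ_two]
  ring

theorem inner_bracket_right (u v : LieSU2) : inner ℝ v (bracket u v) = 0 := by
  obtain ⟨a, b, c, h⟩ := exists_coord u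
  obtain ⟨a', b', c', h'⟩ := exists_coord v
  simp only [inner_def, bracket, mat_ofMat, h, h', Matrix.trace_fin_two]
  simp [coordMat, Matrix.mul_apply, Fin.sum_univ_two]
  ring

theorem inner_bracket_self (u v : LieSU2) : inner ℝ (bracket u v) (bracket u v) =
    4 * (inner ℝ u u * inner ℝ v v - inner ℝ u v ^ 2) := by
  obtain ⟨a, b, c, h⟩ := exists_coord u
  obtain ⟨a', b', c', h'⟩ := exists_coord v
  simp only [inner_def, bracket, mat_ofMat, h, h', Matrix.trace_fin_two]
  simp [coordMat, Matrix.mul_apply, Fin.sum_univ_two]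
  ring

theorem smul_bracket (g : SU2) (u v : LieSU2) : g • bracket u v = bracket (g • u) (g • v) := by
  apply mat_injective
  have key : ∀ X Y : Matrix (Fin 2) (Fin 2) ℂ, (g : Matrix (Fin 2) (Fin 2) ℂ) * (X * Y) *
      star (g : Matrix (Fin 2) (Fin 2) ℂ) = (g : Matrix (Fin 2) (Fin 2) ℂ) * X *
      star (g : Matrix (Fin 2) (Fin 2) ℂ) * ((g : Matrix (Fin 2) (Fin 2) ℂ) * Y *
      star (g : Matrix (Fin 2) (Fin 2) ℂ)) := by
    intro X Y
    calc _ = (g : Matrix (Fin 2) (Fin 2) ℂ) * X * 1 * Y *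
              star (g : Matrix (Fin 2) (Fin 2) ℂ) := by simp only [mul_assoc, mul_one]
      _ = _ := by rw [← star_mul_self' g]; simp only [mul_assoc]
  rw [mat_smul, bracket, bracket, mat_ofMat, mat_ofMat, mat_smul, mat_smul, mul_sub, sub_mul,
    key, key]

/-! ### The symplectic quotient -/

variable {n : ℕ}

theorem continuous_smulSU2 (g : SU2) : Continuous (fun A : LieSU2 => g • A) :=
  (adj g).continuous

/-- `P_ℓ`: tuples in the product of the spheres of radii `ℓ i` with vanishing sum. -/
def polygonSet (ℓ : Fin n → Set.Ioi (0 : ℝ)) : Set (Fin n → LieSU2) :=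
  {x | (∀ i, ‖x i‖ = ℓ i) ∧ ∑ i, x i = 0}

theorem smul_mem_polygonSet {ℓ : Fin n → Set.Ioi (0 : ℝ)} (g : SU2) {x : Fin n → LieSU2}
    (hx : x ∈ polygonSet ℓ) : g • x ∈ polygonSet ℓ := by
  refine ⟨fun i => ((adj g).norm_map (x i)).trans (hx.1 i), ?_⟩
  have h : ∑ i, (g • x) i = adj g (∑ i, x i) := by rw [map_sum]; rfl
  rw [h, hx.2, map_zero]

/-- The diagonal action of `SU(2)` on `P_ℓ`. -/
instance (ℓ : Fin n → Set.Ioi (0 : ℝ)) : MulAction SU2 (polygonSet ℓ) where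
  smul g x := ⟨g • x.1, smul_mem_polygonSet g x.2⟩
  one_smul x := Subtype.ext (one_smul SU2 x.1)
  mul_smul g h x := Subtype.ext (mul_smul g h x.1)

instance (ℓ : Fin n → Set.Ioi (0 : ℝ)) : ContinuousConstSMul SU2 (polygonSet ℓ) where
  continuous_const_smul g := Continuous.subtype_mk
    (continuous_pi fun i => (continuous_smulSU2 g).comp
      ((continuous_apply i).comp continuous_subtype_val)) _

/-- The polygon space `M_ℓ = P_ℓ / SU(2)`, with the quotient topology. -/
abbrev Moduli (ℓ : Fin n → Set.Ioi (0 : ℝ)) : Type :=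
  MulAction.orbitRel.Quotient SU2 (polygonSet ℓ)

/-- The class of an element of `P_ℓ`. -/
def toModuli (ℓ : Fin n → Set.Ioi (0 : ℝ)) (x : polygonSet ℓ) : Moduli ℓ := Quotient.mk _ x

/-- All the vectors of the tuple belong to the same line. -/
def IsCollinear (x : Fin n → LieSU2) : Prop :=
  ∃ v : LieSU2, ∀ i, x i ∈ Submodule.span ℝ {v}

/-- The singular set `S_ℓ` of `M_ℓ`. -/
def singularSet (ℓ : Fin n → Set.Ioi (0 : ℝ)) : Set (Moduli ℓ) :=
  {p | ∃ x : polygonSet ℓ, IsCollinear x.1 ∧ toModuli ℓ x = p}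

/-- The regular part `M_ℓ ∖ S_ℓ`. -/
def RegularModuli (ℓ : Fin n → Set.Ioi (0 : ℝ)) : Type := {p : Moduli ℓ // p ∉ singularSet ℓ}

instance (ℓ : Fin n → Set.Ioi (0 : ℝ)) : TopologicalSpace (RegularModuli ℓ) :=
  inferInstanceAs (TopologicalSpace {p : Moduli ℓ // p ∉ singularSet ℓ})

/-- The non-collinear tuples of `P_ℓ`. -/
def regPolygonSet (ℓ : Fin n → Set.Ioi (0 : ℝ)) : Set (Fin n → LieSU2) :=
  {x | x ∈ polygonSet ℓ ∧ ¬ IsCollinear x}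

theorem IsCollinear.smul {x : Fin n → LieSU2} (g : SU2) (hx : IsCollinear x) :
    IsCollinear (g • x) := by
  obtain ⟨v, hv⟩ := hx
  refine ⟨g • v, fun i => ?_⟩
  obtain ⟨c, hc⟩ := Submodule.mem_span_singleton.1 (hv i)
  refine Submodule.mem_span_singleton.2 ⟨c, ?_⟩
  change c • adj g v = adj g (x i)
  rw [← hc, map_smul]

theorem toModuli_eq_iff {ℓ : Fin n → Set.Ioi (0 : ℝ)} {x y : polygonSet ℓ} :
    toModuli ℓ x = toModuli ℓ y ↔ ∃ g : SU2, g • y.1 = x.1 := by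
  rw [toModuli, toModuli, Quotient.eq]
  constructor
  · rintro ⟨g, hg⟩
    exact ⟨g, congrArg Subtype.val hg⟩
  · rintro ⟨g, hg⟩
    exact ⟨g, Subtype.ext hg⟩

theorem toModuli_notMem {ℓ : Fin n → Set.Ioi (0 : ℝ)} (x : polygonSet ℓ)
    (hx : ¬ IsCollinear x.1) : toModuli ℓ x ∉ singularSet ℓ := by
  rintro ⟨y, hy, hxy⟩
  obtain ⟨g, hg⟩ := toModuli_eq_iff.1 hxy.symm
  exact hx (hg ▸ hy.smul g)

/-- The projection from the non-collinear tuples of `P_ℓ` onto `M_ℓ ∖ S_ℓ`. -/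
def proj (ℓ : Fin n → Set.Ioi (0 : ℝ)) (x : regPolygonSet ℓ) : RegularModuli ℓ :=
  ⟨toModuli ℓ ⟨x.1, x.2.1⟩, toModuli_notMem _ x.2.2⟩

theorem proj_eq_iff {ℓ : Fin n → Set.Ioi (0 : ℝ)} {x y : regPolygonSet ℓ} :
    proj ℓ x = proj ℓ y ↔ ∃ g : SU2, g • y.1 = x.1 := by
  rw [← toModuli_eq_iff (x := ⟨x.1, x.2.1⟩) (y := ⟨y.1, y.2.1⟩)]
  exact Subtype.ext_iff

theorem proj_surjective (ℓ : Fin n → Set.Ioi (0 : ℝ)) : Function.Surjective (proj ℓ) := by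
  rintro ⟨p, hp⟩
  obtain ⟨x, rfl⟩ := Quotient.exists_rep p
  exact ⟨⟨x.1, x.2, fun h => hp ⟨x, h, rfl⟩⟩, rfl⟩

theorem continuous_proj (ℓ : Fin n → Set.Ioi (0 : ℝ)) : Continuous (proj ℓ) := by
  refine Continuous.subtype_mk (p := fun p => p ∉ singularSet ℓ) ?_ _
  exact continuous_quotient_mk'.comp (Continuous.subtype_mk continuous_subtype_val _)

theorem mem_nhds_proj {ℓ : Fin n → Set.Ioi (0 : ℝ)} (x : regPolygonSet ℓ)
    {S : Set (RegularModuli ℓ)} {U : Set (Fin n → LieSU2)} (hU : IsOpen U) (hxU : x.1 ∈ U)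
    (hS : ∀ y : regPolygonSet ℓ, y.1 ∈ U → proj ℓ y ∈ S) : S ∈ 𝓝 (proj ℓ x) := by
  have h1 : IsOpen (toModuli ℓ '' (Subtype.val ⁻¹' U)) :=
    isOpenMap_quotient_mk'_mul (Γ := SU2) _ (hU.preimage continuous_subtype_val)
  have h2 : IsOpen ((Subtype.val : {p : Moduli ℓ // p ∉ singularSet ℓ} → Moduli ℓ) ⁻¹'
      (toModuli ℓ '' (Subtype.val ⁻¹' U))) := h1.preimage continuous_subtype_val
  refine Filter.mem_of_superset (h2.mem_nhds ⟨⟨x.1, x.2.1⟩, hxU, rfl⟩) ?_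
  rintro ⟨q, hq⟩ ⟨y, hyU, rfl⟩
  exact hS ⟨y.1, y.2, fun h => hq ⟨y, h, rfl⟩⟩ hyU

/-! ### The smooth structure of the regular part -/

/-- The model space of `M_ℓ ∖ S_ℓ`, of dimension `2(n - 3)`. -/
abbrev ModelSpace (n : ℕ) : Type := EuclideanSpace ℝ (Fin (2 * (n - 3)))

/-- The charts of the quotient smooth structure: the homeomorphisms `φ` from open subsets of
`M_ℓ ∖ S_ℓ` to open subsets of the model space such that `φ ∘ proj` is smooth (it extends locally
to a smooth function of the ambient vector space) and such that `φ⁻¹` lifts locally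
to smooth maps with values in `P_ℓ`. -/
structure IsQuotientChart (ℓ : Fin n → Set.Ioi (0 : ℝ))
    (φ : OpenPartialHomeomorph (RegularModuli ℓ) (ModelSpace n)) : Prop where
  smooth : ∀ x : regPolygonSet ℓ, proj ℓ x ∈ φ.source →
    ∃ U : Set (Fin n → LieSU2), IsOpen U ∧ x.1 ∈ U ∧
      ∃ F : (Fin n → LieSU2) → ModelSpace n, ContDiffOn ℝ ∞ F U ∧
        ∀ y : regPolygonSet ℓ, y.1 ∈ U → proj ℓ y ∈ φ.source ∧ F y.1 = φ (proj ℓ y)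
  lift : ∀ z ∈ φ.target, ∃ U : Set (ModelSpace n), IsOpen U ∧ z ∈ U ∧
    ∃ σ : ModelSpace n → (Fin n → LieSU2), ContDiffOn ℝ ∞ σ U ∧
      ∀ w ∈ U, w ∈ φ.target ∧ ∃ h : σ w ∈ regPolygonSet ℓ, proj ℓ ⟨σ w, h⟩ = φ.symm w

theorem IsQuotientChart.contDiffOn_transition {ℓ : Fin n → Set.Ioi (0 : ℝ)}
    {φ ψ : OpenPartialHomeomorph (RegularModuli ℓ) (ModelSpace n)}
    (hφ : IsQuotientChart ℓ φ) (hψ : IsQuotientChart ℓ ψ) :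
    ContDiffOn ℝ ∞ (ψ ∘ φ.symm) (φ.symm.trans ψ).source := by
  intro z hz
  rw [OpenPartialHomeomorph.trans_source] at hz
  obtain ⟨U, hU, hzU, σ, hσ, h⟩ := hφ.lift z hz.1
  obtain ⟨-, hm, he⟩ := h z hzU
  obtain ⟨V, hV, hxV, F, hF, h'⟩ := hψ.smooth ⟨σ z, hm⟩ (by rw [he]; exact hz.2)
  have hσz : ContDiffAt ℝ ∞ σ z := hσ.contDiffAt (hU.mem_nhds hzU)
  have hFz : ContDiffAt ℝ ∞ F (σ z) := hF.contDiffAt (hV.mem_nhds hxV)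
  refine ((hFz.comp z hσz).congr_of_eventuallyEq ?_).contDiffWithinAt
  filter_upwards [hU.mem_nhds hzU, hσz.continuousAt.preimage_mem_nhds (hV.mem_nhds hxV)]
    with w hw hw'
  obtain ⟨-, hm', he'⟩ := h w hw
  have := (h' ⟨σ w, hm'⟩ hw').2
  simp only [Function.comp_apply]
  rw [← he', ← this]

/-! ### Existence of charts: local slices -/

/-- Oriented orthonormal frames of `su(2)`. -/
structure IsFrame (e₀ e₁ e₂ : LieSU2) : Prop where
  h00 : inner ℝ e₀ e₀ = 1
  h11 : inner ℝ e₁ e₁ = 1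
  h22 : inner ℝ e₂ e₂ = 1
  h01 : inner ℝ e₀ e₁ = 0
  h02 : inner ℝ e₀ e₂ = 0
  h12 : inner ℝ e₁ e₂ = 0
  br : e₂ = (1 / 2 : ℝ) • bracket e₀ e₁

theorem IsFrame.h10 {e₀ e₁ e₂ : LieSU2} (h : IsFrame e₀ e₁ e₂) : inner ℝ e₁ e₀ = 0 := by
  rw [real_inner_comm, h.h01]

theorem IsFrame.h20 {e₀ e₁ e₂ : LieSU2} (h : IsFrame e₀ e₁ e₂) : inner ℝ e₂ e₀ = 0 := by
  rw [real_inner_comm, h.h02]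

theorem IsFrame.h21 {e₀ e₁ e₂ : LieSU2} (h : IsFrame e₀ e₁ e₂) : inner ℝ e₂ e₁ = 0 := by
  rw [real_inner_comm, h.h12]

theorem norm_eq_one_of_inner {e : LieSU2} (h : inner ℝ e e = 1) : ‖e‖ = 1 := by
  rw [real_inner_self_eq_norm_sq] at h
  nlinarith [norm_nonneg e]

theorem IsFrame.sum_repr {e₀ e₁ e₂ : LieSU2} (h : IsFrame e₀ e₁ e₂) (w : LieSU2) :
    inner ℝ e₀ w • e₀ + inner ℝ e₁ w • e₁ + inner ℝ e₂ w • e₂ = w := by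
  have ho : Orthonormal ℝ ![e₀, e₁, e₂] := by
    rw [orthonormal_iff_ite]
    intro i j
    fin_cases i <;> fin_cases j <;>
      simp [norm_eq_one_of_inner h.h00, norm_eq_one_of_inner h.h11, norm_eq_one_of_inner h.h22,
        h.h01, h.h02, h.h12, h.h10, h.h20, h.h21]
  have hc : Fintype.card (Fin 3) = Module.finrank ℝ LieSU2 := by simp [finrank_lieSU2]
  have hb := ((basisOfOrthonormalOfCardEqFinrank ho hc).toOrthonormalBasis
    (by rw [coe_basisOfOrthonormalOfCardEqFinrank]; exact ho)).sum_repr' w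
  rw [Module.Basis.coe_toOrthonormalBasis, coe_basisOfOrthonormalOfCardEqFinrank,
    Fin.sum_univ_three] at hb
  simpa using hb

theorem IsFrame.eq_of_inner {e₀ e₁ e₂ : LieSU2} (h : IsFrame e₀ e₁ e₂) {v w : LieSU2}
    (h0 : inner ℝ e₀ v = inner ℝ e₀ w) (h1 : inner ℝ e₁ v = inner ℝ e₁ w)
    (h2 : inner ℝ e₂ v = inner ℝ e₂ w) : v = w := by
  rw [← h.sum_repr v, ← h.sum_repr w, h0, h1, h2]

theorem IsFrame.norm_sq {e₀ e₁ e₂ : LieSU2} (h : IsFrame e₀ e₁ e₂) (w : LieSU2) :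
    ‖w‖ ^ 2 = inner ℝ e₀ w ^ 2 + inner ℝ e₁ w ^ 2 + inner ℝ e₂ w ^ 2 := by
  rw [← real_inner_self_eq_norm_sq]
  conv_lhs => rw [← h.sum_repr w]
  rw [inner_add_left, inner_add_left, real_inner_smul_left, real_inner_smul_left,
    real_inner_smul_left, h.sum_repr]
  ring

theorem exists_frame {u v : LieSU2} (hu : u ≠ 0) (hv : v ∉ Submodule.span ℝ {u}) :
    ∃ e₀ e₁ e₂, IsFrame e₀ e₁ e₂ ∧ u = ‖u‖ • e₀ ∧ inner ℝ e₂ v = 0 ∧ 0 < inner ℝ e₁ v := by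
  have hn : ‖u‖ ≠ 0 := norm_ne_zero_iff.2 hu
  obtain ⟨e₀, he₀⟩ : ∃ e₀ : LieSU2, e₀ = ‖u‖⁻¹ • u := ⟨_, rfl⟩
  have hue : u = ‖u‖ • e₀ := by rw [he₀, smul_smul, mul_inv_cancel₀ hn, one_smul]
  have h00 : inner ℝ e₀ e₀ = 1 := by
    rw [real_inner_self_eq_norm_sq, he₀, norm_smul, norm_inv, norm_norm, inv_mul_cancel₀ hn,
      one_pow]
  obtain ⟨b, hb⟩ : ∃ b : LieSU2, b = v - inner ℝ e₀ v • e₀ := ⟨_, rfl⟩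
  have hb0 : b ≠ 0 := by
    intro h
    apply hv
    rw [hb, sub_eq_zero] at h
    rw [h, he₀, smul_smul]
    exact Submodule.smul_mem _ _ (Submodule.mem_span_singleton_self u)
  have hbn : ‖b‖ ≠ 0 := norm_ne_zero_iff.2 hb0
  have hbe : inner ℝ e₀ b = 0 := by rw [hb, inner_sub_right, real_inner_smul_right, h00]; ring
  obtain ⟨e₁, he₁⟩ : ∃ e₁ : LieSU2, e₁ = ‖b‖⁻¹ • b := ⟨_, rfl⟩
  have h11 : inner ℝ e₁ e₁ = 1 := by
    rw [real_inner_self_eq_norm_sq, he₁, norm_smul, norm_inv, norm_norm, inv_mul_cancel₀ hbn,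
      one_pow]
  have h01 : inner ℝ e₀ e₁ = 0 := by rw [he₁, real_inner_smul_right, hbe, mul_zero]
  have hve : v = inner ℝ e₀ v • e₀ + ‖b‖ • e₁ := by
    rw [he₁, smul_smul, mul_inv_cancel₀ hbn, one_smul, hb]; abel
  have h02 : inner ℝ e₀ ((1 / 2 : ℝ) • bracket e₀ e₁) = 0 := by
    rw [real_inner_smul_right, inner_bracket_left, mul_zero]
  have h12 : inner ℝ e₁ ((1 / 2 : ℝ) • bracket e₀ e₁) = 0 := by
    rw [real_inner_smul_right, inner_bracket_right, mul_zero]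
  refine ⟨e₀, e₁, (1 / 2 : ℝ) • bracket e₀ e₁, ⟨h00, h11, ?_, h01, h02, h12, rfl⟩, hue, ?_, ?_⟩
  · rw [real_inner_smul_left, real_inner_smul_right, inner_bracket_self, h00, h11, h01]
    norm_num
  · rw [hve, inner_add_right, real_inner_smul_right, real_inner_smul_right,
      real_inner_comm e₀ ((1 / 2 : ℝ) • bracket e₀ e₁), h02,
      real_inner_comm e₁ ((1 / 2 : ℝ) • bracket e₀ e₁), h12]
    ring
  · rw [hve, inner_add_right, real_inner_smul_right, real_inner_smul_right, h11,
      real_inner_comm e₀ e₁, h01]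
    have : 0 < ‖b‖ := norm_pos_iff.2 hb0
    simpa using this

theorem IsFrame.smul_eq {e₀ e₁ e₂ : LieSU2} (h : IsFrame e₀ e₁ e₂) {g : SU2}
    (h0 : g • e₀ = e₀) (h1 : g • e₁ = e₁) (w : LieSU2) : g • w = w := by
  have h2 : g • e₂ = e₂ := by
    rw [h.br]
    have : g • ((1 / 2 : ℝ) • bracket e₀ e₁) = (1 / 2 : ℝ) • (g • bracket e₀ e₁) :=
      (adj g).map_smul _ _
    rw [this, smul_bracket, h0, h1]
  rw [← h.sum_repr w, ← adj_apply]
  simp only [map_add, map_smul, adj_apply, h0, h1, h2]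

/-- The slice of `P_ℓ` attached to a frame and to two indices. -/
structure IsSlice (ℓ : Fin n → Set.Ioi (0 : ℝ)) (i j : Fin n) (e₀ e₁ e₂ : LieSU2)
    (z : Fin n → LieSU2) : Prop where
  mem : z ∈ polygonSet ℓ
  zi : z i = (ℓ i : ℝ) • e₀
  zj : inner ℝ e₂ (z j) = 0
  pos : 0 < inner ℝ e₁ (z j)

theorem IsSlice.ne {ℓ : Fin n → Set.Ioi (0 : ℝ)} {i j : Fin n} {e₀ e₁ e₂ : LieSU2}
    {z : Fin n → LieSU2} (h : IsFrame e₀ e₁ e₂) (hz : IsSlice ℓ i j e₀ e₁ e₂ z) : i ≠ j := by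
  rintro rfl
  have := hz.pos
  rw [hz.zi, real_inner_smul_right, h.h10, mul_zero] at this
  exact lt_irrefl _ this

theorem IsSlice.not_isCollinear {ℓ : Fin n → Set.Ioi (0 : ℝ)} {i j : Fin n} {e₀ e₁ e₂ : LieSU2}
    {z : Fin n → LieSU2} (h : IsFrame e₀ e₁ e₂) (hz : IsSlice ℓ i j e₀ e₁ e₂ z) :
    ¬ IsCollinear z := by
  rintro ⟨v, hv⟩
  obtain ⟨c, hc⟩ := Submodule.mem_span_singleton.1 (hv i)
  obtain ⟨d, hd⟩ := Submodule.mem_span_singleton.1 (hv j)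
  have hℓ : (0 : ℝ) < ℓ i := (ℓ i).2
  have h1 : c * inner ℝ e₁ v = 0 := by
    rw [← real_inner_smul_right, hc, hz.zi, real_inner_smul_right, h.h10,
      mul_zero]
  have h2 : 0 < d * inner ℝ e₁ v := by rw [← real_inner_smul_right, hd]; exact hz.pos
  have h3 : c * inner ℝ e₀ v = ℓ i := by
    rw [← real_inner_smul_right, hc, hz.zi, real_inner_smul_right, h.h00, mul_one]
  rcases mul_eq_zero.1 h1 with h4 | h4
  · rw [h4, zero_mul] at h3; exact hℓ.ne h3
  · rw [h4, mul_zero] at h2; exact lt_irrefl _ h2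

theorem IsSlice.mem_reg {ℓ : Fin n → Set.Ioi (0 : ℝ)} {i j : Fin n} {e₀ e₁ e₂ : LieSU2}
    {z : Fin n → LieSU2} (h : IsFrame e₀ e₁ e₂) (hz : IsSlice ℓ i j e₀ e₁ e₂ z) :
    z ∈ regPolygonSet ℓ := ⟨hz.mem, hz.not_isCollinear h⟩

/-- A slice meets each orbit at most once. -/
theorem IsSlice.eq_of_smul {ℓ : Fin n → Set.Ioi (0 : ℝ)} {i j : Fin n} {e₀ e₁ e₂ : LieSU2}
    {z z' : Fin n → LieSU2} (h : IsFrame e₀ e₁ e₂) (hz : IsSlice ℓ i j e₀ e₁ e₂ z)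
    (hz' : IsSlice ℓ i j e₀ e₁ e₂ z') {g : SU2} (hg : g • z = z') : z = z' := by
  have hℓ : (ℓ i : ℝ) ≠ 0 := (ℓ i).2.ne'
  have hgi : g • z i = z' i := congrFun hg i
  have hgj : g • z j = z' j := congrFun hg j
  have h0 : g • e₀ = e₀ := by
    rw [hz.zi, hz'.zi, ← adj_apply, map_smul] at hgi
    exact smul_right_injective _ hℓ hgi
  have hj0 : inner ℝ e₀ (z j) = inner ℝ e₀ (z' j) := by
    rw [← hgj]
    conv_rhs => rw [← h0]
    exact ((adj g).inner_map_map _ _).symm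
  have hj1 : inner ℝ e₁ (z j) = inner ℝ e₁ (z' j) := by
    have h1 := h.norm_sq (z j)
    have h2 := h.norm_sq (z' j)
    rw [hz.mem.1, hz.zj] at h1
    rw [hz'.mem.1, hz'.zj, ← hj0] at h2
    have h3 : inner ℝ e₁ (z j) ^ 2 = inner ℝ e₁ (z' j) ^ 2 := by linarith
    exact (sq_eq_sq₀ hz.pos.le hz'.pos.le).1 h3
  have hj : z j = z' j := h.eq_of_inner hj0 hj1 (by rw [hz.zj, hz'.zj])
  have h1 : g • e₁ = e₁ := by
    have hr := h.sum_repr (z j)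
    rw [hz.zj, zero_smul, add_zero] at hr
    have h2 := hgj
    rw [← hj, ← hr, ← adj_apply, map_add, map_smul, map_smul, adj_apply, h0] at h2
    exact smul_right_injective _ hz.pos.ne' (add_left_cancel h2)
  rw [← hg]
  funext k
  exact (h.smul_eq h0 h1 (z k)).symm

theorem halfTurn_add (a v w : LieSU2) : halfTurn a (v + w) = halfTurn a v + halfTurn a w := by
  simp only [halfTurn, inner_add_right, mul_add, add_div, add_smul]; abel

theorem halfTurn_smul (a : LieSU2) (c : ℝ) (w : LieSU2) :
    halfTurn a (c • w) = c • halfTurn a w := by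
  simp only [halfTurn, real_inner_smul_right, smul_sub, smul_smul]
  congr 2
  ring

theorem halfTurn_of_orth {a w : LieSU2} (h : inner ℝ a w = 0) : halfTurn a w = -w := by
  simp [halfTurn, h]

theorem halfTurn_self {a : LieSU2} (h : a ≠ 0) : halfTurn a a = a := by
  have : inner ℝ a a ≠ 0 := inner_self_ne_zero.2 h
  rw [halfTurn, mul_div_assoc, div_self this, mul_one, two_smul, add_sub_cancel_right]

/-- The half-turn around `u + v` exchanges the vectors `u` and `v` of the same length. -/
theorem halfTurn_add_apply {u v : LieSU2} (hn : inner ℝ u u = inner ℝ v v) (h : u + v ≠ 0) :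
    halfTurn (u + v) u = v := by
  have h0 : inner ℝ (u + v) (u + v) ≠ 0 := inner_self_ne_zero.2 h
  have h1 : 2 * inner ℝ (u + v) u = inner ℝ (u + v) (u + v) := by
    rw [inner_add_left, inner_add_left, inner_add_right, inner_add_right, real_inner_comm u v, hn]
    ring
  rw [halfTurn, h1, div_self h0, one_smul, add_sub_cancel_left]

/-- Gauge fixing: the axis of the first half-turn. -/
def gaugeA (r : ℝ) (i : Fin n) (e₀ : LieSU2) (y : Fin n → LieSU2) : LieSU2 := y i + r • e₀

/-- Gauge fixing: an auxiliary vector. -/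
def gaugeB (r : ℝ) (i j : Fin n) (e₀ : LieSU2) (y : Fin n → LieSU2) : LieSU2 :=
  halfTurn (gaugeA r i e₀ y) (y j) -
    inner ℝ e₀ (halfTurn (gaugeA r i e₀ y) (y j)) • e₀

/-- Gauge fixing: the axis of the second half-turn. -/
def gaugeC (r : ℝ) (i j : Fin n) (e₀ e₁ : LieSU2) (y : Fin n → LieSU2) : LieSU2 :=
  gaugeB r i j e₀ y + -(‖gaugeB r i j e₀ y‖ • e₁)

/-- Gauge fixing: a map from tuples to the slice along the orbits. -/
def gauge (r : ℝ) (i j : Fin n) (e₀ e₁ e₂ : LieSU2) (y : Fin n → LieSU2) : Fin n → LieSU2 :=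
  fun k => halfTurn e₂ (halfTurn (gaugeC r i j e₀ e₁ y) (halfTurn (gaugeA r i e₀ y) (y k)))

/-- The points where the gauge fixing is well-defined. -/
structure GaugeOK (r : ℝ) (i j : Fin n) (e₀ e₁ : LieSU2) (y : Fin n → LieSU2) : Prop where
  a : gaugeA r i e₀ y ≠ 0
  b : gaugeB r i j e₀ y ≠ 0
  c : gaugeC r i j e₀ e₁ y ≠ 0

theorem GaugeOK.exists_smul {r : ℝ} {i j : Fin n} {e₀ e₁ e₂ : LieSU2} (h : IsFrame e₀ e₁ e₂)
    {y : Fin n → LieSU2} (hy : GaugeOK r i j e₀ e₁ y) :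
    ∃ g : SU2, gauge r i j e₀ e₁ e₂ y = g • y := by
  obtain ⟨g₁, h₁⟩ := exists_halfTurn hy.a
  obtain ⟨g₂, h₂⟩ := exists_halfTurn hy.c
  obtain ⟨g₃, h₃⟩ := exists_halfTurn (a := e₂) (by
    rintro rfl
    have := h.h22
    simp at this)
  refine ⟨g₃ * g₂ * g₁, ?_⟩
  funext k
  rw [Pi.smul_apply, mul_smul, mul_smul, h₁, h₂, h₃, gauge]

theorem GaugeOK.isSlice {ℓ : Fin n → Set.Ioi (0 : ℝ)} {i j : Fin n} {e₀ e₁ e₂ : LieSU2}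
    (h : IsFrame e₀ e₁ e₂) {y : Fin n → LieSU2} (hy : GaugeOK (ℓ i) i j e₀ e₁ y)
    (hp : y ∈ polygonSet ℓ) : IsSlice ℓ i j e₀ e₁ e₂ (gauge (ℓ i) i j e₀ e₁ e₂ y) := by
  have hA : halfTurn (gaugeA (ℓ i) i e₀ y) (y i) = (ℓ i : ℝ) • e₀ := by
    apply halfTurn_add_apply
    · rw [real_inner_self_eq_norm_sq, hp.1, real_inner_smul_left, real_inner_smul_right, h.h00]
      ring
    · exact hy.a
  have hB0 : inner ℝ (gaugeB (ℓ i) i j e₀ y) e₀ = 0 := by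
    rw [gaugeB, inner_sub_left, real_inner_smul_left, h.h00, real_inner_comm]; ring
  have hC0 : inner ℝ (gaugeC (ℓ i) i j e₀ e₁ y) e₀ = 0 := by
    rw [gaugeC, inner_add_left, hB0, inner_neg_left, real_inner_smul_left, h.h10]
    ring
  have hCB : halfTurn (gaugeC (ℓ i) i j e₀ e₁ y) (gaugeB (ℓ i) i j e₀ y) =
      -(‖gaugeB (ℓ i) i j e₀ y‖ • e₁) := by
    apply halfTurn_add_apply
    · rw [inner_neg_neg, real_inner_smul_left, real_inner_smul_right, h.h11,
        real_inner_self_eq_norm_sq]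
      ring
    · exact hy.c
  have h20 := h.h20
  have h21 := h.h21
  have hE0 : halfTurn e₂ (halfTurn (gaugeC (ℓ i) i j e₀ e₁ y) e₀) = e₀ := by
    rw [halfTurn_of_orth hC0, ← neg_one_smul ℝ, halfTurn_smul, halfTurn_of_orth h20]
    simp
  have hj : gauge (ℓ i) i j e₀ e₁ e₂ y j =
      inner ℝ e₀ (halfTurn (gaugeA (ℓ i) i e₀ y) (y j)) • e₀ + ‖gaugeB (ℓ i) i j e₀ y‖ • e₁ := by
    have hd : halfTurn (gaugeA (ℓ i) i e₀ y) (y j) =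
        inner ℝ e₀ (halfTurn (gaugeA (ℓ i) i e₀ y) (y j)) • e₀ + gaugeB (ℓ i) i j e₀ y := by
      rw [gaugeB]; abel
    rw [gauge]
    conv_lhs => rw [hd]
    rw [halfTurn_add, halfTurn_add, halfTurn_smul, halfTurn_smul, hE0, hCB, ← neg_smul,
      halfTurn_smul, halfTurn_of_orth h21]
    simp
  obtain ⟨g, hg⟩ := hy.exists_smul h
  refine ⟨hg ▸ smul_mem_polygonSet g hp, ?_, ?_, ?_⟩
  · rw [gauge, hA, halfTurn_smul, halfTurn_smul, hE0]
  · rw [hj, inner_add_right, real_inner_smul_right, real_inner_smul_right, h20, h21]; ring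
  · rw [hj, inner_add_right, real_inner_smul_right, real_inner_smul_right, h.h11, h.h10]
    have := norm_pos_iff.2 hy.b
    simpa using this

theorem IsSlice.gaugeOK {ℓ : Fin n → Set.Ioi (0 : ℝ)} {i j : Fin n} {e₀ e₁ e₂ : LieSU2}
    {z : Fin n → LieSU2} (h : IsFrame e₀ e₁ e₂) (hz : IsSlice ℓ i j e₀ e₁ e₂ z) :
    GaugeOK (ℓ i) i j e₀ e₁ z := by
  have hℓ : (0 : ℝ) < ℓ i := (ℓ i).2
  have he₀ : e₀ ≠ 0 := by
    rintro rfl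
    have := h.h00
    simp at this
  have he₁ : e₁ ≠ 0 := by
    rintro rfl
    have := h.h11
    simp at this
  have ha : gaugeA (ℓ i) i e₀ z = (2 * (ℓ i : ℝ)) • e₀ := by
    rw [gaugeA, hz.zi, two_mul, add_smul]
  have ht : ∀ w, halfTurn ((2 * (ℓ i : ℝ)) • e₀) w = (2 * inner ℝ e₀ w) • e₀ - w := by
    intro w
    rw [halfTurn, real_inner_smul_left, real_inner_smul_left, real_inner_smul_right, h.h00,
      smul_smul]
    congr 2
    field_simp
  have hb : gaugeB (ℓ i) i j e₀ z = -(inner ℝ e₁ (z j) • e₁) := by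
    rw [gaugeB, ha, ht, inner_sub_right, real_inner_smul_right, h.h00]
    have hr := h.sum_repr (z j)
    rw [hz.zj, zero_smul, add_zero] at hr
    have : z j - inner ℝ e₀ (z j) • e₀ = inner ℝ e₁ (z j) • e₁ := by
      rw [sub_eq_iff_eq_add']; exact hr.symm
    rw [← this]
    module
  have hbn : ‖gaugeB (ℓ i) i j e₀ z‖ = inner ℝ e₁ (z j) := by
    have : ‖e₁‖ = 1 := norm_eq_one_of_inner h.h11
    rw [hb, norm_neg, norm_smul, this, mul_one, Real.norm_of_nonneg hz.pos.le]
  refine ⟨?_, ?_, ?_⟩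
  · rw [ha]
    exact smul_ne_zero (by positivity) he₀
  · rw [hb]
    exact neg_ne_zero.2 (smul_ne_zero hz.pos.ne' he₁)
  · have hc : gaugeC (ℓ i) i j e₀ e₁ z = (-(2 * inner ℝ e₁ (z j))) • e₁ := by
      rw [gaugeC, hbn, hb]; module
    rw [hc]
    exact smul_ne_zero (neg_ne_zero.2 (by have := hz.pos; positivity)) he₁

theorem IsSlice.gauge_eq {ℓ : Fin n → Set.Ioi (0 : ℝ)} {i j : Fin n} {e₀ e₁ e₂ : LieSU2}
    {z : Fin n → LieSU2} (h : IsFrame e₀ e₁ e₂) (hz : IsSlice ℓ i j e₀ e₁ e₂ z) :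
    gauge (ℓ i) i j e₀ e₁ e₂ z = z := by
  obtain ⟨g, hg⟩ := (hz.gaugeOK h).exists_smul h
  exact (hz.eq_of_smul h ((hz.gaugeOK h).isSlice h hz.mem) hg.symm).symm

theorem contDiffAt_halfTurn {a w : (Fin n → LieSU2) → LieSU2} {y : Fin n → LieSU2}
    (ha : ContDiffAt ℝ ∞ a y) (hw : ContDiffAt ℝ ∞ w y) (h0 : a y ≠ 0) :
    ContDiffAt ℝ ∞ (fun x => halfTurn (a x) (w x)) y := by
  unfold halfTurn
  exact ((((contDiffAt_const.mul (ha.inner ℝ hw)).div (ha.inner ℝ ha)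
    (inner_self_ne_zero.2 h0)).smul ha).sub hw)

theorem contDiffAt_gaugeA (r : ℝ) (i : Fin n) (e₀ : LieSU2) (y : Fin n → LieSU2) :
    ContDiffAt ℝ ∞ (gaugeA r i e₀) y :=
  (contDiff_apply ℝ LieSU2 i).contDiffAt.add contDiffAt_const

theorem contDiffAt_gaugeB {r : ℝ} {i j : Fin n} {e₀ : LieSU2} {y : Fin n → LieSU2}
    (h : gaugeA r i e₀ y ≠ 0) : ContDiffAt ℝ ∞ (gaugeB r i j e₀) y := by
  have h1 := contDiffAt_halfTurn (contDiffAt_gaugeA r i e₀ y)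
    (contDiff_apply ℝ LieSU2 j).contDiffAt h
  exact h1.sub ((contDiffAt_const.inner ℝ h1).smul contDiffAt_const)

theorem contDiffAt_gaugeC {r : ℝ} {i j : Fin n} {e₀ e₁ : LieSU2} {y : Fin n → LieSU2}
    (h : gaugeA r i e₀ y ≠ 0) (h' : gaugeB r i j e₀ y ≠ 0) :
    ContDiffAt ℝ ∞ (gaugeC r i j e₀ e₁) y := by
  have h1 := contDiffAt_gaugeB (j := j) h
  exact h1.add ((h1.norm ℝ h').smul contDiffAt_const).neg

theorem GaugeOK.contDiffAt {r : ℝ} {i j : Fin n} {e₀ e₁ e₂ : LieSU2} {y : Fin n → LieSU2}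
    (h : IsFrame e₀ e₁ e₂) (hy : GaugeOK r i j e₀ e₁ y) :
    ContDiffAt ℝ ∞ (gauge r i j e₀ e₁ e₂) y := by
  have he₂ : e₂ ≠ 0 := by
    rintro rfl
    have := h.h22
    simp at this
  refine contDiffAt_pi.2 fun k => ?_
  exact contDiffAt_halfTurn contDiffAt_const (contDiffAt_halfTurn (contDiffAt_gaugeC hy.a hy.b)
    (contDiffAt_halfTurn (contDiffAt_gaugeA r i e₀ y)
      (contDiff_apply ℝ LieSU2 k).contDiffAt hy.a) hy.c) he₂

theorem GaugeOK.eventually {r : ℝ} {i j : Fin n} {e₀ e₁ : LieSU2} {y : Fin n → LieSU2}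
    (hy : GaugeOK r i j e₀ e₁ y) : ∀ᶠ x in 𝓝 y, GaugeOK r i j e₀ e₁ x := by
  filter_upwards [(contDiffAt_gaugeA r i e₀ y).continuousAt.eventually_ne hy.a,
    (contDiffAt_gaugeB hy.a).continuousAt.eventually_ne hy.b,
    (contDiffAt_gaugeC hy.a hy.b).continuousAt.eventually_ne hy.c] with x h1 h2 h3
  exact ⟨h1, h2, h3⟩

/-- The equations of a slice. -/
def sliceMap (i j : Fin n) (e₁ e₂ : LieSU2) (x : Fin n → LieSU2) :
    (Fin n → ℝ) × LieSU2 × ℝ × ℝ × ℝ :=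
  (fun k => inner ℝ (x k) (x k), ∑ k, x k, inner ℝ e₁ (x i), inner ℝ e₂ (x i), inner ℝ e₂ (x j))

theorem contDiff_sliceMap {m : ℕ∞ω} (i j : Fin n) (e₁ e₂ : LieSU2) :
    ContDiff ℝ m (sliceMap i j e₁ e₂) := by
  have hk : ∀ k : Fin n, ContDiff ℝ m (fun x : Fin n → LieSU2 => x k) := fun k =>
    contDiff_apply ℝ LieSU2 k
  exact (contDiff_pi.2 fun k => (hk k).inner ℝ (hk k)).prodMk
    ((ContDiff.sum fun k _ => hk k).prodMk ((contDiff_const.inner ℝ (hk i)).prodMk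
      ((contDiff_const.inner ℝ (hk i)).prodMk (contDiff_const.inner ℝ (hk j)))))

/-- The derivative of the equations of a slice. -/
def sliceDeriv (i j : Fin n) (e₁ e₂ : LieSU2) (z : Fin n → LieSU2) :
    (Fin n → LieSU2) →L[ℝ] (Fin n → ℝ) × LieSU2 × ℝ × ℝ × ℝ :=
  (ContinuousLinearMap.pi fun k => (2 : ℝ) • (innerSL ℝ (z k)).comp
      (ContinuousLinearMap.proj (R := ℝ) (φ := fun _ : Fin n => LieSU2) k)).prod
    ((∑ k, ContinuousLinearMap.proj (R := ℝ) (φ := fun _ : Fin n => LieSU2) k).prod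
      (((innerSL ℝ e₁).comp (ContinuousLinearMap.proj i)).prod
        (((innerSL ℝ e₂).comp (ContinuousLinearMap.proj i)).prod
          ((innerSL ℝ e₂).comp (ContinuousLinearMap.proj j)))))

theorem hasStrictFDerivAt_sliceMap (i j : Fin n) (e₁ e₂ : LieSU2) (z : Fin n → LieSU2) :
    HasStrictFDerivAt (sliceMap i j e₁ e₂) (sliceDeriv i j e₁ e₂ z) z := by
  have hp : ∀ k : Fin n, HasStrictFDerivAt (fun x : Fin n → LieSU2 => x k)
      (ContinuousLinearMap.proj (R := ℝ) (φ := fun _ : Fin n => LieSU2) k) z := fun k =>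
    (ContinuousLinearMap.proj (R := ℝ) (φ := fun _ : Fin n => LieSU2) k).hasStrictFDerivAt
  refine HasStrictFDerivAt.prodMk ?_ (HasStrictFDerivAt.prodMk ?_ (HasStrictFDerivAt.prodMk ?_
    (HasStrictFDerivAt.prodMk ?_ ?_)))
  · refine hasStrictFDerivAt_pi.2 fun k => ?_
    have hc : ContDiffAt ℝ 1 (fun x : Fin n → LieSU2 => inner ℝ (x k) (x k)) z :=
      ((contDiff_apply ℝ LieSU2 k).inner ℝ (contDiff_apply ℝ LieSU2 k)).contDiffAt
    refine hc.hasStrictFDerivAt' ((hp k).hasFDerivAt.inner ℝ (hp k).hasFDerivAt |>.congr_fderiv ?_)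
      one_ne_zero
    ext v
    simp [real_inner_comm (z k)]
    ring
  · exact (∑ k, ContinuousLinearMap.proj (R := ℝ) (φ := fun _ : Fin n => LieSU2)
      k).hasStrictFDerivAt.congr_of_eventuallyEq (Filter.Eventually.of_forall fun x => by simp)
  · exact (innerSL ℝ e₁).hasStrictFDerivAt.comp z (hp i)
  · exact (innerSL ℝ e₂).hasStrictFDerivAt.comp z (hp i)
  · exact (innerSL ℝ e₂).hasStrictFDerivAt.comp z (hp j)

theorem IsSlice.of_sliceMap {ℓ : Fin n → Set.Ioi (0 : ℝ)} {i j : Fin n} {e₀ e₁ e₂ : LieSU2}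
    {z x : Fin n → LieSU2} (h : IsFrame e₀ e₁ e₂) (hz : IsSlice ℓ i j e₀ e₁ e₂ z)
    (hx : sliceMap i j e₁ e₂ x = sliceMap i j e₁ e₂ z) (h0 : 0 < inner ℝ e₀ (x i))
    (h1 : 0 < inner ℝ e₁ (x j)) : IsSlice ℓ i j e₀ e₁ e₂ x := by
  simp only [sliceMap, Prod.mk.injEq] at hx
  obtain ⟨hx1, hx2, hx3, hx4, hx5⟩ := hx
  have hℓ : (0 : ℝ) < ℓ i := (ℓ i).2
  have hn : ∀ k, ‖x k‖ = ℓ k := by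
    intro k
    have := congrFun hx1 k
    rw [real_inner_self_eq_norm_sq, real_inner_self_eq_norm_sq, hz.mem.1] at this
    exact (sq_eq_sq₀ (norm_nonneg _) (ℓ k).2.le).1 this
  rw [hz.zi, real_inner_smul_right, h.h10, mul_zero] at hx3
  rw [hz.zi, real_inner_smul_right, h.h20, mul_zero] at hx4
  refine ⟨⟨hn, hx2.trans hz.mem.2⟩, ?_, hx5.trans hz.zj, h1⟩
  have h2 := h.norm_sq (x i)
  rw [hx3, hx4, hn] at h2
  have h3 : inner ℝ e₀ (x i) = ℓ i := (sq_eq_sq₀ h0.le hℓ.le).1 (by linarith)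
  have h4 := h.sum_repr (x i)
  rw [hx3, hx4, h3, zero_smul, zero_smul, add_zero, add_zero] at h4
  exact h4.symm

theorem sliceDeriv_single (i j : Fin n) (e₁ e₂ : LieSU2) (z : Fin n → LieSU2) (k : Fin n)
    (w : LieSU2) : sliceDeriv i j e₁ e₂ z (Pi.single k w) =
      (Pi.single k (2 * inner ℝ (z k) w), w, if i = k then inner ℝ e₁ w else 0,
        if i = k then inner ℝ e₂ w else 0, if j = k then inner ℝ e₂ w else 0) := by
  refine Prod.ext ?_ (Prod.ext ?_ (Prod.ext ?_ (Prod.ext ?_ ?_)))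
  · funext m
    by_cases hm : m = k
    · subst hm; simp [sliceDeriv]
    · simp [sliceDeriv, hm]
  · simp [sliceDeriv, Finset.sum_pi_single']
  · by_cases hm : i = k
    · subst hm; simp [sliceDeriv]
    · simp [sliceDeriv, hm]
  · by_cases hm : i = k
    · subst hm; simp [sliceDeriv]
    · simp [sliceDeriv, hm]
  · by_cases hm : j = k
    · subst hm; simp [sliceDeriv]
    · simp [sliceDeriv, hm]

theorem IsSlice.range_sliceDeriv {ℓ : Fin n → Set.Ioi (0 : ℝ)} {i j : Fin n}
    {e₀ e₁ e₂ : LieSU2} {z : Fin n → LieSU2} (h : IsFrame e₀ e₁ e₂)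
    (hz : IsSlice ℓ i j e₀ e₁ e₂ z) : (sliceDeriv i j e₁ e₂ z).range = ⊤ := by
  by_contra hne
  obtain ⟨f, hf0, hf⟩ := Submodule.exists_le_ker_of_lt_top _ (lt_top_iff_ne_top.2 hne)
  have hij := hz.ne h
  have hℓ : (0 : ℝ) < ℓ i := (ℓ i).2
  obtain ⟨ρ, hρ⟩ : ∃ ρ : Fin n → ℝ, ∀ k, ρ k = f (Pi.single k 1, 0, 0, 0, 0) := ⟨_, fun _ => rfl⟩
  obtain ⟨g, hg⟩ : ∃ g : LieSU2 →ₗ[ℝ] ℝ, ∀ w, g w = f (0, w, 0, 0, 0) :=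
    ⟨f ∘ₗ LinearMap.inr ℝ _ _ ∘ₗ LinearMap.inl ℝ _ _, fun _ => rfl⟩
  obtain ⟨τ, hτ⟩ : ∃ τ : LieSU2, ∀ w, inner ℝ τ w = g w :=
    ⟨(InnerProductSpace.toDual ℝ LieSU2).symm (LinearMap.toContinuousLinearMap g), fun w => by
      simp⟩
  obtain ⟨a, ha⟩ : ∃ a : ℝ, a = f (0, 0, 1, 0, 0) := ⟨_, rfl⟩
  obtain ⟨b, hb⟩ : ∃ b : ℝ, b = f (0, 0, 0, 1, 0) := ⟨_, rfl⟩
  obtain ⟨c, hc⟩ : ∃ c : ℝ, c = f (0, 0, 0, 0, 1) := ⟨_, rfl⟩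
  have hexp : ∀ (r : Fin n → ℝ) (s : LieSU2) (α β γ : ℝ), f (r, s, α, β, γ) =
      ∑ k, r k * ρ k + inner ℝ τ s + α * a + β * b + γ * c := by
    intro r s α β γ
    have h1 : (r, s, α, β, γ) = ((∑ k, r k • (Pi.single k (1 : ℝ) : Fin n → ℝ), 0, 0, 0, 0) :
        (Fin n → ℝ) × LieSU2 × ℝ × ℝ × ℝ) + (0, s, 0, 0, 0) + α • (0, 0, 1, 0, 0) +
        β • (0, 0, 0, 1, 0) + γ • (0, 0, 0, 0, 1) := by
      have : ∑ k, r k • (Pi.single k (1 : ℝ) : Fin n → ℝ) = r := by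
        funext m
        simp [Finset.sum_apply, Pi.single_apply]
      rw [this]
      simp
    have h2 : f (∑ k, r k • (Pi.single k (1 : ℝ) : Fin n → ℝ), 0, 0, 0, 0) = ∑ k, r k * ρ k := by
      obtain ⟨L, hL⟩ : ∃ L : (Fin n → ℝ) →ₗ[ℝ] (Fin n → ℝ) × LieSU2 × ℝ × ℝ × ℝ,
          ∀ v, L v = (v, 0, 0, 0, 0) := ⟨LinearMap.inl ℝ _ _, fun _ => rfl⟩
      rw [← hL, map_sum, map_sum]
      exact Finset.sum_congr rfl fun k _ => by rw [map_smul, map_smul, hL, hρ, smul_eq_mul]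
    rw [h1, map_add, map_add, map_add, map_add, map_smul, map_smul, map_smul, h2, hτ, hg, ← ha,
      ← hb, ← hc]
    simp
  have heq : ∀ (k : Fin n) (w : LieSU2), 2 * inner ℝ (z k) w * ρ k + inner ℝ τ w +
      (if i = k then inner ℝ e₁ w else 0) * a + (if i = k then inner ℝ e₂ w else 0) * b +
      (if j = k then inner ℝ e₂ w else 0) * c = 0 := by
    intro k w
    have h1 : f (sliceDeriv i j e₁ e₂ z (Pi.single k w)) = 0 :=
      hf (LinearMap.mem_range_self _ _)
    rw [sliceDeriv_single, hexp] at h1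
    have h2 : ∑ m, (Pi.single k (2 * inner ℝ (z k) w) : Fin n → ℝ) m * ρ m =
        2 * inner ℝ (z k) w * ρ k := by
      rw [Finset.sum_eq_single k]
      · rw [Pi.single_eq_same]
      · intro m _ hm; rw [Pi.single_eq_of_ne hm, zero_mul]
      · simp
    rw [h2] at h1
    exact h1
  have hother : ∀ k, k ≠ i → k ≠ j → τ = -((2 * ρ k) • z k) := by
    intro k hki hkj
    refine ext_inner_right ℝ fun w => ?_
    have := heq k w
    rw [if_neg (Ne.symm hki), if_neg (Ne.symm hki), if_neg (Ne.symm hkj)] at this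
    rw [inner_neg_left, real_inner_smul_left]
    linarith
  have hj : ∀ w, 2 * inner ℝ (z j) w * ρ j + inner ℝ τ w + inner ℝ e₂ w * c = 0 := by
    intro w
    have := heq j w
    rw [if_neg hij, if_neg hij, if_pos rfl] at this
    linarith
  have hi : ∀ w, 2 * inner ℝ (z i) w * ρ i + inner ℝ τ w + inner ℝ e₁ w * a +
      inner ℝ e₂ w * b = 0 := by
    intro w
    have := heq i w
    rw [if_pos rfl, if_pos rfl, if_neg hij.symm] at this
    linarith
  have hzj : z j = inner ℝ e₀ (z j) • e₀ + inner ℝ e₁ (z j) • e₁ := by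
    have hr := h.sum_repr (z j)
    rw [hz.zj, zero_smul, add_zero] at hr
    exact hr.symm
  have hτ0 : τ = 0 := by
    by_contra hτn
    obtain ⟨d, hd⟩ : ∃ d : LieSU2, d = inner ℝ e₀ (z j) • e₁ - inner ℝ e₁ (z j) • e₀ := ⟨_, rfl⟩
    have hd0 : inner ℝ e₀ d = - inner ℝ e₁ (z j) := by
      rw [hd, inner_sub_right, real_inner_smul_right, real_inner_smul_right, h.h01, h.h00]; ring
    have hd1 : inner ℝ e₁ d = inner ℝ e₀ (z j) := by
      rw [hd, inner_sub_right, real_inner_smul_right, real_inner_smul_right, h.h11, h.h10]; ring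
    have hd2 : inner ℝ e₂ d = 0 := by
      rw [hd, inner_sub_right, real_inner_smul_right, real_inner_smul_right, h.h21, h.h20]; ring
    have hdj : inner ℝ (z j) d = 0 := by
      rw [hzj, inner_add_left, real_inner_smul_left, real_inner_smul_left, hd0, hd1]; ring
    have hτd : inner ℝ τ d = 0 := by
      have := hj d
      rw [hdj, hd2] at this
      linarith
    have hzd : ∀ k, k ≠ i → k ≠ j → inner ℝ (z k) d = 0 := by
      intro k hki hkj
      have h1 := hother k hki hkj
      have h2 : ρ k ≠ 0 := by
        intro h0
        rw [h0, mul_zero, zero_smul, neg_zero] at h1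
        exact hτn h1
      rw [h1, inner_neg_left, real_inner_smul_left] at hτd
      have h3 : 2 * ρ k * inner ℝ (z k) d = 0 := by linarith
      rcases mul_eq_zero.1 h3 with h4 | h4
      · exact absurd h4 (by simpa using h2)
      · exact h4
    have hs : ∑ k, inner ℝ (z k) d = 0 := by
      rw [← sum_inner, hz.mem.2, inner_zero_left]
    rw [Finset.sum_eq_single i] at hs
    · rw [hz.zi, real_inner_smul_left, hd0] at hs
      have := mul_pos hℓ hz.pos
      linarith
    · intro k _ hki
      by_cases hkj : k = j
      · rw [hkj, hdj]
      · exact hzd k hki hkj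
    · simp
  have hρj : ρ j = 0 := by
    have := hj e₁
    rw [hτ0, h.h21, inner_zero_left, real_inner_comm] at this
    have h1 : inner ℝ e₁ (z j) * ρ j = 0 := by linarith
    exact (mul_eq_zero.1 h1).resolve_left hz.pos.ne'
  have hc0 : c = 0 := by
    have := hj e₂
    rw [hτ0, h.h22, hρj, inner_zero_left] at this
    linarith
  have hρi : ρ i = 0 := by
    have := hi e₀
    rw [hτ0, h.h10, h.h20, inner_zero_left, hz.zi, real_inner_smul_left, h.h00] at this
    have h1 : (ℓ i : ℝ) * ρ i = 0 := by linarith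
    exact (mul_eq_zero.1 h1).resolve_left hℓ.ne'
  have ha0 : a = 0 := by
    have := hi e₁
    rw [hτ0, h.h11, h.h21, inner_zero_left, hρi] at this
    linarith
  have hb0 : b = 0 := by
    have := hi e₂
    rw [hτ0, h.h12, h.h22, inner_zero_left, hρi] at this
    linarith
  have hρ0 : ∀ k, ρ k = 0 := by
    intro k
    by_cases hki : k = i
    · rw [hki, hρi]
    by_cases hkj : k = j
    · rw [hkj, hρj]
    have h1 := hother k hki hkj
    rw [hτ0, eq_comm, neg_eq_zero] at h1
    rcases smul_eq_zero.1 h1 with h2 | h2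
    · linarith
    · have := hz.mem.1 k
      rw [h2, norm_zero] at this
      exact absurd this (ℓ k).2.ne
  apply hf0
  refine LinearMap.ext fun v => ?_
  obtain ⟨r, s, α, β, γ⟩ := v
  rw [hexp, hτ0, ha0, hb0, hc0]
  simp [hρ0]

theorem finrank_ker_of_range {i j : Fin n} {e₁ e₂ : LieSU2} {z : Fin n → LieSU2}
    (h : (sliceDeriv i j e₁ e₂ z).range = ⊤) :
    Module.finrank ℝ (sliceDeriv i j e₁ e₂ z).ker = 2 * (n - 3) := by
  have h1 := LinearMap.finrank_range_add_finrank_ker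
    (sliceDeriv i j e₁ e₂ z : (Fin n → LieSU2) →ₗ[ℝ] (Fin n → ℝ) × LieSU2 × ℝ × ℝ × ℝ)
  have h2 : Module.finrank ℝ (Fin n → LieSU2) = n * 3 := by
    rw [Module.finrank_pi_fintype]
    simp [finrank_lieSU2]
  have h3 : Module.finrank ℝ ((Fin n → ℝ) × LieSU2 × ℝ × ℝ × ℝ) = n + 6 := by
    simp [finrank_lieSU2]
  have h4 : Module.finrank ℝ (LinearMap.range
      (sliceDeriv i j e₁ e₂ z : (Fin n → LieSU2) →ₗ[ℝ] (Fin n → ℝ) × LieSU2 × ℝ × ℝ × ℝ)) =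
      n + 6 := by
    rw [← h3]
    rw [show LinearMap.range
      (sliceDeriv i j e₁ e₂ z : (Fin n → LieSU2) →ₗ[ℝ] (Fin n → ℝ) × LieSU2 × ℝ × ℝ × ℝ) = ⊤
      from h, finrank_top]
  have h5 : Module.finrank ℝ (LinearMap.ker
      (sliceDeriv i j e₁ e₂ z : (Fin n → LieSU2) →ₗ[ℝ] (Fin n → ℝ) × LieSU2 × ℝ × ℝ × ℝ)) =
      2 * (n - 3) := by omega
  exact h5

/-- Slices exist at every point. -/
theorem exists_isSlice {ℓ : Fin n → Set.Ioi (0 : ℝ)} (x : regPolygonSet ℓ) :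
    ∃ i j e₀ e₁ e₂, IsFrame e₀ e₁ e₂ ∧ IsSlice ℓ i j e₀ e₁ e₂ x.1 := by
  have hx := x.2.2
  have hn : Nonempty (Fin n) := by
    by_contra hn
    exact hx ⟨0, fun i => (hn ⟨i⟩).elim⟩
  obtain ⟨i⟩ := hn
  have hj : ∃ j, x.1 j ∉ Submodule.span ℝ {x.1 i} := by
    by_contra hj
    push Not at hj
    exact hx ⟨_, hj⟩
  obtain ⟨j, hj⟩ := hj
  have hi : x.1 i ≠ 0 := by
    intro h0
    have := x.2.1.1 i
    rw [h0, norm_zero] at this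
    exact absurd this (ℓ i).2.ne
  obtain ⟨e₀, e₁, e₂, he, h1, h2, h3⟩ := exists_frame hi hj
  exact ⟨i, j, e₀, e₁, e₂, he, ⟨x.2.1, by rw [← x.2.1.1 i]; exact h1, h2, h3⟩⟩

/-- The slice as a chart: a local parametrization of a neighbourhood in a slice, smooth
with a smooth left inverse. -/
theorem IsSlice.exists_param {ℓ : Fin n → Set.Ioi (0 : ℝ)} {i j : Fin n}
    {e₀ e₁ e₂ : LieSU2} {z : Fin n → LieSU2} (h : IsFrame e₀ e₁ e₂)
    (hz : IsSlice ℓ i j e₀ e₁ e₂ z) :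
    ∃ (T : Set (ModelSpace n)) (s : ModelSpace n → (Fin n → LieSU2))
      (r : (Fin n → LieSU2) → ModelSpace n),
      IsOpen T ∧ ContDiffOn ℝ ∞ s T ∧ ContDiff ℝ ∞ r ∧ r z ∈ T ∧ s (r z) = z ∧
      (∀ u ∈ T, IsSlice ℓ i j e₀ e₁ e₂ (s u) ∧ r (s u) = u ∧
        ∀ᶠ y in 𝓝 (s u), IsSlice ℓ i j e₀ e₁ e₂ y → r y ∈ T ∧ s (r y) = y) := by
  have hrange := hz.range_sliceDeriv h
  have hstrict := hasStrictFDerivAt_sliceMap i j e₁ e₂ z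
  obtain ⟨K, hK⟩ : ∃ K : (sliceDeriv i j e₁ e₂ z).ker ≃L[ℝ] ModelSpace n, True :=
    ⟨ContinuousLinearEquiv.ofFinrankEq (by rw [finrank_ker_of_range hrange]; simp), trivial⟩
  have hcompl : (sliceDeriv i j e₁ e₂ z).ker.ClosedComplemented :=
    Submodule.ClosedComplemented.of_finiteDimensional _
  obtain ⟨P, hP⟩ : ∃ P : (Fin n → LieSU2) →L[ℝ] (sliceDeriv i j e₁ e₂ z).ker,
      P = Classical.choose hcompl := ⟨_, rfl⟩
  obtain ⟨Ψ, hΨ⟩ : ∃ Ψ : OpenPartialHomeomorph (Fin n → LieSU2)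
      (((Fin n → ℝ) × LieSU2 × ℝ × ℝ × ℝ) × (sliceDeriv i j e₁ e₂ z).ker),
      Ψ = hstrict.implicitToOpenPartialHomeomorphOfComplemented _ _ hrange hcompl := ⟨_, rfl⟩
  have hΨa : ∀ y, Ψ y = (sliceMap i j e₁ e₂ y, P (y - z)) := by
    intro y
    rw [hΨ, hP]
    rfl
  have hΨz : z ∈ Ψ.source := by
    rw [hΨ]
    exact hstrict.mem_implicitToOpenPartialHomeomorphOfComplemented_source hrange hcompl
  have hΨs : ∀ᶠ w in 𝓝 (Ψ z), ContDiffAt ℝ ω Ψ.symm w := by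
    refine ContDiffAt.eventually ?_ (by decide)
    have hd := (HasStrictFDerivAt.implicitFunctionDataOfComplemented (sliceMap i j e₁ e₂)
      (sliceDeriv i j e₁ e₂ z) hstrict hrange hcompl).hasStrictFDerivAt
    refine Ψ.contDiffAt_symm (Ψ.map_source hΨz) (f₀' := ?_) ?_ ?_
    · exact (ContinuousLinearMap.equivProdOfSurjectiveOfIsCompl _ _
        (HasStrictFDerivAt.implicitFunctionDataOfComplemented (sliceMap i j e₁ e₂)
          (sliceDeriv i j e₁ e₂ z) hstrict hrange hcompl).range_leftDeriv
        (HasStrictFDerivAt.implicitFunctionDataOfComplemented (sliceMap i j e₁ e₂)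
          (sliceDeriv i j e₁ e₂ z) hstrict hrange hcompl).range_rightDeriv
        (HasStrictFDerivAt.implicitFunctionDataOfComplemented (sliceMap i j e₁ e₂)
          (sliceDeriv i j e₁ e₂ z) hstrict hrange hcompl).isCompl_ker)
    · rw [Ψ.left_inv hΨz, hΨ]
      exact hd.hasFDerivAt
    · have : (Ψ : (Fin n → LieSU2) → _) = fun y => (sliceMap i j e₁ e₂ y, P (y - z)) :=
        funext hΨa
      rw [this]
      exact ((contDiff_sliceMap i j e₁ e₂).prodMk
        (P.contDiff.comp (contDiff_id.sub contDiff_const))).contDiffAt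
  obtain ⟨V, hV, hVo, hzV⟩ := eventually_nhds_iff.1 hΨs
  obtain ⟨O, hO⟩ : ∃ O : Set (Fin n → LieSU2),
      O = {x | 0 < inner ℝ e₀ (x i)} ∩ {x | 0 < inner ℝ e₁ (x j)} := ⟨_, rfl⟩
  have hOo : IsOpen O := by
    rw [hO]
    exact (isOpen_lt continuous_const (continuous_const.inner (continuous_apply i))).inter
      (isOpen_lt continuous_const (continuous_const.inner (continuous_apply j)))
  have hslO : ∀ y, IsSlice ℓ i j e₀ e₁ e₂ y → y ∈ O := by
    intro y hy
    rw [hO]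
    refine ⟨?_, hy.pos⟩
    change 0 < inner ℝ e₀ (y i)
    rw [hy.zi, real_inner_smul_right, h.h00, mul_one]
    exact (ℓ i).2
  have hslc : ∀ y, IsSlice ℓ i j e₀ e₁ e₂ y → sliceMap i j e₁ e₂ y = sliceMap i j e₁ e₂ z := by
    intro y hy
    refine Prod.ext (funext fun k => ?_) (Prod.ext ?_ (Prod.ext ?_ (Prod.ext ?_ ?_)))
    · change inner ℝ (y k) (y k) = inner ℝ (z k) (z k)
      rw [real_inner_self_eq_norm_sq, real_inner_self_eq_norm_sq, hy.mem.1, hz.mem.1]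
    · exact hy.mem.2.trans hz.mem.2.symm
    · change inner ℝ e₁ (y i) = inner ℝ e₁ (z i)
      rw [hy.zi, hz.zi]
    · change inner ℝ e₂ (y i) = inner ℝ e₂ (z i)
      rw [hy.zi, hz.zi]
    · exact hy.zj.trans hz.zj.symm
  obtain ⟨ι, hι⟩ : ∃ ι : ModelSpace n →
      ((Fin n → ℝ) × LieSU2 × ℝ × ℝ × ℝ) × (sliceDeriv i j e₁ e₂ z).ker,
      ι = fun u => (sliceMap i j e₁ e₂ z, K.symm u) := ⟨_, rfl⟩
  have hιc : ContDiff ℝ ∞ ι := by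
    rw [hι]
    exact contDiff_const.prodMk K.symm.contDiff
  have hrι : ∀ y, IsSlice ℓ i j e₀ e₁ e₂ y → ι (K (P (y - z))) = Ψ y := by
    intro y hy
    rw [hΨa, hslc y hy, hι]
    simp
  have hTo : IsOpen (V ∩ (Ψ.target ∩ Ψ.symm ⁻¹' O)) :=
    hVo.inter (Ψ.symm.isOpen_inter_preimage hOo)
  have hmem : ∀ y, IsSlice ℓ i j e₀ e₁ e₂ y → y ∈ Ψ.source → Ψ y ∈ V →
      K (P (y - z)) ∈ ι ⁻¹' (V ∩ (Ψ.target ∩ Ψ.symm ⁻¹' O)) ∧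
        Ψ.symm (ι (K (P (y - z)))) = y := by
    intro y hy hys hyV
    rw [Set.mem_preimage, hrι y hy]
    refine ⟨⟨hyV, Ψ.map_source hys, ?_⟩, Ψ.left_inv hys⟩
    rw [Set.mem_preimage, Ψ.left_inv hys]
    exact hslO y hy
  refine ⟨ι ⁻¹' (V ∩ (Ψ.target ∩ Ψ.symm ⁻¹' O)), fun u => Ψ.symm (ι u),
    fun y => K (P (y - z)), hTo.preimage hιc.continuous, ?_, ?_, ?_, ?_, ?_⟩
  · intro u hu
    exact (((hV _ hu.1).of_le le_top).comp u hιc.contDiffAt).contDiffWithinAt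
  · exact K.contDiff.comp (P.contDiff.comp (contDiff_id.sub contDiff_const))
  · exact (hmem z hz hΨz hzV).1
  · exact (hmem z hz hΨz hzV).2
  · rintro u ⟨hu1, hu2, hu3⟩
    have hr : Ψ (Ψ.symm (ι u)) = ι u := Ψ.right_inv hu2
    have hr1 := hΨa (Ψ.symm (ι u))
    rw [hr] at hr1
    have hι1 : (ι u).1 = sliceMap i j e₁ e₂ z := by rw [hι]
    have hι2 : (ι u).2 = K.symm u := by rw [hι]
    have hc := hι1.symm.trans (congrArg Prod.fst hr1)
    have hp := hι2.symm.trans (congrArg Prod.snd hr1)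
    simp only at hc hp
    have hs : Ψ.symm (ι u) ∈ Ψ.source := Ψ.map_target hu2
    refine ⟨?_, ?_, ?_⟩
    · rw [Set.mem_preimage, hO] at hu3
      exact hz.of_sliceMap h hc.symm hu3.1 hu3.2
    · change K (P (Ψ.symm (ι u) - z)) = u
      rw [← hp]
      simp
    · have hcont : ContinuousAt Ψ (Ψ.symm (ι u)) := Ψ.continuousAt hs
      filter_upwards [Ψ.open_source.mem_nhds hs,
        hcont.preimage_mem_nhds (hVo.mem_nhds (by rw [hr]; exact hu1))] with y hy1 hy2 hy3
      exact hmem y hy3 hy1 hy2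

theorem exists_quotientChart {ℓ : Fin n → Set.Ioi (0 : ℝ)} (p : RegularModuli ℓ) :
    ∃ φ : OpenPartialHomeomorph (RegularModuli ℓ) (ModelSpace n),
      IsQuotientChart ℓ φ ∧ p ∈ φ.source := by
  classical
  obtain ⟨x₀, rfl⟩ := proj_surjective ℓ p
  obtain ⟨i, j, e₀, e₁, e₂, h, hz⟩ := exists_isSlice x₀
  obtain ⟨T, s, r, hT, hs, hr, hrT, hsr, hTs⟩ := hz.exists_param h
  obtain ⟨G, hG⟩ : ∃ G : ModelSpace n → RegularModuli ℓ,
      ∀ u (hu : u ∈ T), G u = proj ℓ ⟨s u, (hTs u hu).1.mem_reg h⟩ := by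
    exact ⟨fun u => if hu : u ∈ T then proj ℓ ⟨s u, (hTs u hu).1.mem_reg h⟩ else proj ℓ x₀,
      fun u hu => dif_pos hu⟩
  have hinj : Set.InjOn G T := by
    intro u hu v hv huv
    rw [hG u hu, hG v hv] at huv
    obtain ⟨g, hg⟩ := proj_eq_iff.1 huv
    have := (hTs v hv).1.eq_of_smul h (hTs u hu).1 hg
    rw [← (hTs u hu).2.1, ← (hTs v hv).2.1, this]
  have hrep : ∀ u, u ∈ T → ∀ x : regPolygonSet ℓ, proj ℓ x = G u →
      ∃ U : Set (Fin n → LieSU2), IsOpen U ∧ x.1 ∈ U ∧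
        ∃ F : (Fin n → LieSU2) → ModelSpace n, ContDiffOn ℝ ∞ F U ∧
          ∀ y : regPolygonSet ℓ, y.1 ∈ U → F y.1 ∈ T ∧ G (F y.1) = proj ℓ y := by
    intro u hu x hx
    rw [hG u hu] at hx
    obtain ⟨g, hg⟩ := proj_eq_iff.1 hx.symm
    have hsu := (hTs u hu).1
    have hgc : ContDiff ℝ ∞ (fun y : Fin n → LieSU2 => g • y) :=
      contDiff_pi.2 fun k => (adj g).toContinuousLinearMap.contDiff.comp
        (contDiff_apply ℝ LieSU2 k)
    have hok := hsu.gaugeOK h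
    have hgau := hok.contDiffAt (e₂ := e₂) h
    have hge := hsu.gauge_eq h
    have h1 : ∀ᶠ y in 𝓝 (s u), GaugeOK (ℓ i) i j e₀ e₁ y ∧
        (IsSlice ℓ i j e₀ e₁ e₂ (gauge (ℓ i) i j e₀ e₁ e₂ y) →
          r (gauge (ℓ i) i j e₀ e₁ e₂ y) ∈ T ∧
          s (r (gauge (ℓ i) i j e₀ e₁ e₂ y)) = gauge (ℓ i) i j e₀ e₁ e₂ y) := by
      refine hok.eventually.and ?_
      have h2 : Filter.Tendsto (gauge (ℓ i) i j e₀ e₁ e₂) (𝓝 (s u)) (𝓝 (s u)) := by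
        have := hgau.continuousAt.tendsto
        rwa [hge] at this
      exact h2.eventually (hTs u hu).2.2
    have h3 : ∀ᶠ y in 𝓝 x.1, GaugeOK (ℓ i) i j e₀ e₁ (g • y) ∧
        (IsSlice ℓ i j e₀ e₁ e₂ (gauge (ℓ i) i j e₀ e₁ e₂ (g • y)) →
          r (gauge (ℓ i) i j e₀ e₁ e₂ (g • y)) ∈ T ∧
          s (r (gauge (ℓ i) i j e₀ e₁ e₂ (g • y))) = gauge (ℓ i) i j e₀ e₁ e₂ (g • y)) := by
      have h4 : Filter.Tendsto (fun y : Fin n → LieSU2 => g • y) (𝓝 x.1) (𝓝 (s u)) := by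
        have := hgc.continuous.tendsto x.1
        rwa [show g • x.1 = s u from hg] at this
      exact h4.eventually h1
    obtain ⟨U, hU, hUo, hxU⟩ := eventually_nhds_iff.1 h3
    refine ⟨U, hUo, hxU, fun y => r (gauge (ℓ i) i j e₀ e₁ e₂ (g • y)), ?_, ?_⟩
    · intro y hy
      exact (hr.contDiffAt.comp y
        (((hU y hy).1.contDiffAt (e₂ := e₂) h).comp y hgc.contDiffAt)).contDiffWithinAt
    · intro y hy
      have hsl := (hU y hy).1.isSlice h (smul_mem_polygonSet g y.2.1)
      obtain ⟨h5, h6⟩ := (hU y hy).2 hsl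
      refine ⟨h5, ?_⟩
      rw [hG _ h5]
      obtain ⟨g', hg'⟩ := (hU y hy).1.exists_smul h
      refine proj_eq_iff.2 ⟨g' * g, ?_⟩
      simp only
      rw [h6, hg', mul_smul]
  have hinv : ∀ u ∈ T, Function.invFunOn G T (G u) = u := fun u hu => hinj.leftInvOn_invFunOn hu
  let E : PartialEquiv (RegularModuli ℓ) (ModelSpace n) :=
    { toFun := Function.invFunOn G T
      invFun := G
      source := G '' T
      target := T
      map_source' := by rintro _ ⟨u, hu, rfl⟩; rw [hinv u hu]; exact hu
      map_target' := fun u hu => ⟨u, hu, rfl⟩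
      left_inv' := by rintro _ ⟨u, hu, rfl⟩; rw [hinv u hu]
      right_inv' := hinv }
  let φ : OpenPartialHomeomorph (RegularModuli ℓ) (ModelSpace n) :=
    { toPartialEquiv := E
      open_source := by
        rw [isOpen_iff_mem_nhds]
        rintro _ ⟨u, hu, rfl⟩
        obtain ⟨x, hx⟩ := proj_surjective ℓ (G u)
        obtain ⟨U, hU, hxU, F, -, hF⟩ := hrep u hu x hx
        rw [← hx]
        exact mem_nhds_proj x hU hxU fun y hy => ⟨F y.1, (hF y hy).1, (hF y hy).2⟩
      open_target := hT
      continuousOn_toFun := by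
        rintro _ ⟨u, hu, rfl⟩
        apply ContinuousAt.continuousWithinAt
        obtain ⟨x, hx⟩ := proj_surjective ℓ (G u)
        obtain ⟨U, hU, hxU, F, hFc, hF⟩ := hrep u hu x hx
        rw [← hx]
        intro N hN
        have hFx : Function.invFunOn G T (proj ℓ x) = F x.1 := by
          rw [← (hF x hxU).2, hinv _ (hF x hxU).1]
        change N ∈ 𝓝 (Function.invFunOn G T (proj ℓ x)) at hN
        rw [hFx] at hN
        obtain ⟨W, hW, hWo, hxW⟩ := mem_nhds_iff.1
          ((hFc.continuousOn.continuousAt (hU.mem_nhds hxU)).preimage_mem_nhds hN)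
        refine mem_nhds_proj x (hU.inter hWo) ⟨hxU, hxW⟩ fun y hy => ?_
        change Function.invFunOn G T (proj ℓ y) ∈ N
        rw [← (hF y hy.1).2, hinv _ (hF y hy.1).1]
        exact hW hy.2
      continuousOn_invFun := by
        change ContinuousOn G T
        rw [continuousOn_iff_continuous_domRestrict]
        have h1 : T.domRestrict G =
            fun u : T => proj ℓ ⟨s u, (hTs u.1 u.2).1.mem_reg h⟩ := funext fun u => hG u.1 u.2
        rw [h1]
        exact (continuous_proj ℓ).comp
          (Continuous.subtype_mk (continuousOn_iff_continuous_domRestrict.1 hs.continuousOn) _) }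
  refine ⟨φ, ⟨?_, ?_⟩, ?_⟩
  · rintro x ⟨u, hu, hux⟩
    obtain ⟨U, hU, hxU, F, hFc, hF⟩ := hrep u hu x hux.symm
    refine ⟨U, hU, hxU, F, hFc, fun y hy => ⟨⟨F y.1, (hF y hy).1, (hF y hy).2⟩, ?_⟩⟩
    change F y.1 = Function.invFunOn G T (proj ℓ y)
    rw [← (hF y hy).2, hinv _ (hF y hy).1]
  · intro u hu
    exact ⟨T, hT, hu, s, hs, fun w hw => ⟨hw, (hTs w hw).1.mem_reg h, (hG w hw).symm⟩⟩
  · refine ⟨r x₀.1, hrT, ?_⟩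
    rw [hG _ hrT]
    exact congrArg _ (Subtype.ext hsr)

/-- The smooth structure of `M_ℓ ∖ S_ℓ`: all quotient charts. -/
instance (ℓ : Fin n → Set.Ioi (0 : ℝ)) : ChartedSpace (ModelSpace n) (RegularModuli ℓ) where
  atlas := {φ | IsQuotientChart ℓ φ}
  chartAt p := (exists_quotientChart p).choose
  mem_chart_source p := (exists_quotientChart p).choose_spec.2
  chart_mem_atlas p := (exists_quotientChart p).choose_spec.1

instance (ℓ : Fin n → Set.Ioi (0 : ℝ)) :
    IsManifold 𝓘(ℝ, ModelSpace n) ∞ (RegularModuli ℓ) := by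
  refine isManifold_of_contDiffOn _ _ _ fun φ ψ hφ hψ => ?_
  have h1 := IsQuotientChart.contDiffOn_transition (ℓ := ℓ) hφ hψ
  simpa using h1

theorem isQuotientChart_chartAt {ℓ : Fin n → Set.Ioi (0 : ℝ)} (p : RegularModuli ℓ) :
    IsQuotientChart ℓ (chartAt (ModelSpace n) p) :=
  chart_mem_atlas (ModelSpace n) p

/-! ### The reduced symplectic form and Hamiltonian flows -/

/-- A smooth lift to `P_ℓ`, near the image of `p`, of the inverse of the preferred chart at `p`. -/
theorem exists_chartLift {ℓ : Fin n → Set.Ioi (0 : ℝ)} (p : RegularModuli ℓ) :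
    ∃ σ : ModelSpace n → (Fin n → LieSU2), ∃ U : Set (ModelSpace n),
      IsOpen U ∧ chartAt (ModelSpace n) p p ∈ U ∧ ContDiffOn ℝ ∞ σ U ∧
      ∀ w ∈ U, w ∈ (chartAt (ModelSpace n) p).target ∧ ∃ h : σ w ∈ regPolygonSet ℓ,
        proj ℓ ⟨σ w, h⟩ = (chartAt (ModelSpace n) p).symm w := by
  obtain ⟨U, hU, hpU, σ, hσ, h⟩ := (isQuotientChart_chartAt p).lift _
    ((chartAt (ModelSpace n) p).map_source (mem_chart_source _ p))
  exact ⟨σ, U, hU, hpU, hσ, h⟩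

/-- A chosen smooth lift of the inverse of the preferred chart at `p`, i.e. a local section of
`proj` read in the chart. -/
def chartLift {ℓ : Fin n → Set.Ioi (0 : ℝ)} (p : RegularModuli ℓ) :
    ModelSpace n → (Fin n → LieSU2) := (exists_chartLift p).choose

/-- The reduced symplectic form of `M_ℓ ∖ S_ℓ`: its pull-back by `proj` is the restriction to `P_ℓ`
of the product of the Kirillov-Kostant-Souriau forms of the spheres. It is evaluated here by lifting
the tangent vectors to `P_ℓ` along the local section `chartLift p`; since the product form is
`SU(2)`-invariant and its restriction to `P_ℓ` vanishes on the directions of the orbits,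
the value does not depend on the section. -/
def reducedForm {ℓ : Fin n → Set.Ioi (0 : ℝ)} (p : RegularModuli ℓ)
    (u v : TangentSpace 𝓘(ℝ, ModelSpace n) p) : ℝ :=
  ∑ i, kks (chartLift p (chartAt (ModelSpace n) p p) i)
    (fderiv ℝ (chartLift p) (chartAt (ModelSpace n) p p) u i)
    (fderiv ℝ (chartLift p) (chartAt (ModelSpace n) p p) v i)

/-- The derivative of `f` at `p` in the direction `v`. -/
def dirDeriv {ℓ : Fin n → Set.Ioi (0 : ℝ)} (f : RegularModuli ℓ → ℝ) (p : RegularModuli ℓ)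
    (v : TangentSpace 𝓘(ℝ, ModelSpace n) p) : ℝ :=
  mfderiv 𝓘(ℝ, ModelSpace n) 𝓘(ℝ, ℝ) f p v

/-- `X` is the value at `p` of the Hamiltonian vector field of `f`: `f` is differentiable at `p` and
`df + ω(X, ·) = 0` at `p`. -/
def IsHamiltonianVector {ℓ : Fin n → Set.Ioi (0 : ℝ)} (f : RegularModuli ℓ → ℝ)
    (p : RegularModuli ℓ) (X : TangentSpace 𝓘(ℝ, ModelSpace n) p) : Prop :=
  MDifferentiableAt 𝓘(ℝ, ModelSpace n) 𝓘(ℝ, ℝ) f p ∧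
    ∀ v : TangentSpace 𝓘(ℝ, ModelSpace n) p,
      dirDeriv f p v + reducedForm p X v = 0

/-- `Φ` is a complete Hamiltonian flow of `f` on the open set `U`: `Φ 0` is the identity and each
curve `t ↦ Φ t p` is an integral curve of the Hamiltonian vector field of `f`. -/
def IsHamiltonianFlow {ℓ : Fin n → Set.Ioi (0 : ℝ)}
    (U : TopologicalSpace.Opens (RegularModuli ℓ)) (f : RegularModuli ℓ → ℝ)
    (Φ : ℝ → U → U) : Prop :=
  (∀ p, Φ 0 p = p) ∧
    ∃ X : (p : RegularModuli ℓ) → TangentSpace 𝓘(ℝ, ModelSpace n) p,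
      (∀ p ∈ U, IsHamiltonianVector f p (X p)) ∧
        ∀ p : U, IsMIntegralCurve (I := 𝓘(ℝ, ModelSpace n))
          (fun t => (Φ t p : RegularModuli ℓ)) X

/-! ### Admissible graphs -/

/-- Admissible graphs with vertex set `V` (to be taken finite) and with `n` half-edges: the internal
edges form a tree, the half-edges are numbered, `half i` is the endpoint of the `i`-th half-edge,
and each vertex is incident to exactly three edges. -/
structure AdmissibleGraph (V : Type*) (n : ℕ) where
  graph : SimpleGraph V
  half : Fin n → V
  isTree : graph.IsTree
  trivalent : ∀ v, (graph.neighborSet v).ncard + {i | half i = v}.ncard = 3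

namespace AdmissibleGraph

variable {V : Type*} (Γ : AdmissibleGraph V n)

/-- The internal edges. -/
def IntEdge : Type _ := Γ.graph.edgeSet

instance [Finite V] : Finite Γ.IntEdge := inferInstanceAs (Finite Γ.graph.edgeSet)

instance [Finite V] : Fintype Γ.IntEdge := Fintype.ofFinite _

/-- All the edges: the internal ones and the half-edges. -/
abbrev Edge : Type _ := Γ.IntEdge ⊕ Fin n

/-- The edge `e` is incident to the vertex `v`. -/
def Incident (e : Γ.Edge) (v : V) : Prop :=
  Sum.elim (fun a : Γ.IntEdge => v ∈ a.1) (fun i => Γ.half i = v) e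

/-- An orientation of the internal edges. -/
structure Orientation where
  dart : Γ.IntEdge → Γ.graph.Dart
  edge_dart : ∀ a, (dart a).edge = a.1

/-- The polyhedron `Δ(Γ)`: assignments of lengths to all the edges, satisfying the triangle
inequalities at each vertex. -/
def polyhedron : Set (Γ.Edge → ℝ) :=
  {d | (∀ e, 0 ≤ d e) ∧ ∀ v, ∀ a b c : Γ.Edge, a ≠ b → b ≠ c → a ≠ c →
    Γ.Incident a v → Γ.Incident b v → Γ.Incident c v → |d a - d b| ≤ d c ∧ d c ≤ d a + d b}

/-- The polyhedron `Δ(ℓ, Γ)`. -/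
def sidePolyhedron (ℓ : Fin n → Set.Ioi (0 : ℝ)) : Set (Γ.IntEdge → ℝ) :=
  {d | Sum.elim d (fun i => (ℓ i : ℝ)) ∈ Γ.polyhedron}

/-- The torus `𝕋^{E_int(Γ)}`, with `𝕋 = ℝ / 2πℤ`. -/
abbrev Torus : Type _ := Γ.IntEdge → AddCircle (2 * Real.pi)

variable {Γ}

open Classical in
/-- The element of the torus with coordinate `t` at `a` and zero at the other edges. -/
def torusSingle (a : Γ.IntEdge) (t : ℝ) : Γ.Torus := fun b => if b = a then (t : AddCircle _) else 0

/-- The canonical projection of `ℝ^{E_int(Γ)}` onto the torus. -/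
def torusMk (t : Γ.IntEdge → ℝ) : Γ.Torus := fun a => (t a : AddCircle (2 * Real.pi))

open Classical in
/-- The set `I(a)` of the half-edges connected to the initial vertex of `a` by a path which doesn't
contain the terminal vertex of `a`. -/
def initialSet (o : Γ.Orientation) (a : Γ.IntEdge) : Finset (Fin n) :=
  Finset.univ.filter fun i => ∃ w : Γ.graph.Walk (Γ.half i) (o.dart a).fst,
    w.IsPath ∧ (o.dart a).snd ∉ w.support

end AdmissibleGraph

open AdmissibleGraph

variable {V : Type*} {Γ : AdmissibleGraph V n}

/-- The length functions `λ_a` of `M_ℓ`, as a map `λ : M_ℓ → ℝ^{E_int(Γ)}`. -/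
def lengthMap (o : Γ.Orientation) (ℓ : Fin n → Set.Ioi (0 : ℝ)) (p : Moduli ℓ) : Γ.IntEdge → ℝ :=
  fun a => Quotient.lift (fun x : polygonSet ℓ => ‖∑ i ∈ initialSet o a, x.1 i‖) (by
    rintro x y ⟨g, hg⟩
    have h : ∑ i ∈ initialSet o a, x.1 i = adj g (∑ i ∈ initialSet o a, y.1 i) := by
      rw [map_sum]
      exact Finset.sum_congr rfl fun i _ => (congrFun (congrArg Subtype.val hg) i).symm
    simp only [h, LinearIsometry.norm_map]) p

theorem continuous_lengthMap (o : Γ.Orientation) (ℓ : Fin n → Set.Ioi (0 : ℝ)) (a : Γ.IntEdge) :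
    Continuous (fun p : Moduli ℓ => lengthMap o ℓ p a) :=
  Continuous.quotient_lift (continuous_norm.comp (continuous_finsetSum _ fun i _ =>
    (continuous_apply i).comp continuous_subtype_val)) _

/-- `M*_{ℓ,Γ}`: the points of `M_ℓ ∖ S_ℓ` where none of the functions `λ_a` vanishes. -/
def starModuli [Finite V] (o : Γ.Orientation) (ℓ : Fin n → Set.Ioi (0 : ℝ)) :
    TopologicalSpace.Opens (RegularModuli ℓ) where
  carrier := {p | ∀ a, lengthMap o ℓ p.1 a ≠ 0}
  is_open' := by
    rw [Set.ofPred_forall]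
    refine isOpen_iInter_of_finite fun a => ?_
    exact isOpen_ne_fun ((continuous_lengthMap o ℓ a).comp continuous_subtype_val)
      continuous_const

/-- `M^reg_{ℓ,Γ} = λ⁻¹(Int Δ(ℓ, Γ))`. -/
def regModuli (o : Γ.Orientation) (ℓ : Fin n → Set.Ioi (0 : ℝ)) : Set (Moduli ℓ) :=
  lengthMap o ℓ ⁻¹' interior (Γ.sidePolyhedron ℓ)

/-- The class in `M_ℓ` of a point of `M*_{ℓ,Γ}`. -/
def starVal [Finite V] {o : Γ.Orientation} {ℓ : Fin n → Set.Ioi (0 : ℝ)} (p : starModuli o ℓ) :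
    Moduli ℓ := p.1.1

end PolygonSpace

end

open PolygonSpace PolygonSpace.AdmissibleGraph

noncomputable section

namespace PolygonSpace

section
/-! ### Bracket identities and rotations -/

/-! Up to rotation, a point of the moduli space is a closed polygon in the Euclidean three-space
`su(2)`, and `λ_a` is the length of the diagonal obtained by adding the sides with index in `I(a)`.
The flow of half this length is bending: the sides in `I(a)` turn rigidly around the diagonal with
angular speed one while the others stay fixed (`bend`, `modBend`). A rotation around the unit vector
`m` has the velocity `[m/2, ·]`, and the inclusion of an orbit is a momentum of the adjoint action.
Contracting the bending velocity with the product form therefore gives minus the differential of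
half the diagonal length (`prodForm_bendVel`), and this passes to the quotient
(`isHamiltonianVector_modBend`). Bending is explicit, hence complete and `2π`-periodic.

Uniqueness has two ingredients. The kernel of the product form on the tangent space of `P_ℓ`
consists of the generators of the group action (`exists_generator_of_prodForm`), so the reduced form
is non-degenerate (`eq_of_reducedForm_eq`) and Hamiltonian vectors are unique. A curve with the
bending velocity at each time is then a bending: bend its point at time `s` by the remaining angle
`T - s`; the Gram matrix and triple products of the result have zero derivative in `s`, and these
invariants separate the orbits of non-collinear tuples (`eq_modBend_of_velocity`,
`exists_smul_eq_of_invariants`).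

The flows commute because the graph is a tree. Cutting two edges yields index sets that are nested,
disjoint, or jointly everything (`laminar_sideSet`). In the first two cases bendings commute on
polygons. The last case reduces to nested sets by passing to a complement, which changes a bending
only by a global rotation (`smul_bend_compl`, `exists_smul_bend_comm`). The same trichotomy shows
that each flow preserves every `λ_b` (`norm_partSum_bend`).

The remaining claims use the triangles attached to the vertices: the three edges at a vertex
partition the half-edges, and the three partial sums add up to zero (`sum_tri`). Over the interior
of the polyhedron all these triangles are non-degenerate (`norm_tri_lt`, `tri_notMem_span`). Bending
along an edge changes only the dihedral angle between the triangles at its two ends. Such an angle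
detects the corresponding torus coordinate, whence freeness (`torusAct_free`). Conversely, two
polygons with the same lengths have congruent triangles, and the dihedral angles can be matched one
edge at a time, growing a subtree, whence transitivity on the fibres (`exists_torusAct_eq`). -/

theorem bracket_add_left (u v w : LieSU2) : bracket (u + v) w = bracket u w + bracket v w :=
  mat_injective (by simp only [bracket, mat_ofMat, map_add]; noncomm_ring)

theorem bracket_smul_left (r : ℝ) (v w : LieSU2) : bracket (r • v) w = r • bracket v w :=
  mat_injective (by simp only [bracket, mat_ofMat, map_smul, smul_mul_assoc, mul_smul_comm,
    smul_sub])

theorem bracket_anticomm (u v : LieSU2) : bracket u v = -bracket v u :=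
  mat_injective (by simp only [bracket, mat_ofMat, map_neg, neg_sub])

theorem bracket_add_right (u v w : LieSU2) : bracket u (v + w) = bracket u v + bracket u w := by
  rw [bracket_anticomm, bracket_add_left, bracket_anticomm v, bracket_anticomm w]; abel

theorem bracket_smul_right (r : ℝ) (v w : LieSU2) : bracket v (r • w) = r • bracket v w := by
  rw [bracket_anticomm, bracket_smul_left, bracket_anticomm w, smul_neg, neg_neg]

@[simp] theorem bracket_self (u : LieSU2) : bracket u u = 0 :=
  mat_injective (by simp only [bracket, mat_ofMat, sub_self, map_zero])

/-- The bracket as a bilinear map. -/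
def bracketₗ : LieSU2 →ₗ[ℝ] LieSU2 →ₗ[ℝ] LieSU2 :=
  LinearMap.mk₂ ℝ bracket bracket_add_left bracket_smul_left bracket_add_right
    (fun r v w => bracket_smul_right r v w)

/-- The bracket as a continuous bilinear map. -/
def bracketL : LieSU2 →L[ℝ] LieSU2 →L[ℝ] LieSU2 :=
  LinearMap.toContinuousLinearMap
    ((LinearMap.toContinuousLinearMap : (LieSU2 →ₗ[ℝ] LieSU2) ≃ₗ[ℝ] _).toLinearMap ∘ₗ bracketₗ)

theorem inner_bracket_cyclic (u v w : LieSU2) :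
    inner ℝ u (bracket v w) = inner ℝ v (bracket w u) := by
  simp only [inner_def, bracket, mat_ofMat, mul_sub, Matrix.trace_sub]
  rw [Matrix.trace_mul_cycle' (mat u) (mat v) (mat w), Matrix.trace_mul_cycle' (mat w) (mat u),
    Matrix.trace_mul_cycle' (mat u) (mat w) (mat v)]

/-- This is the double cross product formula; the factor `4` appears because the commutator is twice
the cross product for the chosen scalar product. -/
theorem bracket_bracket (u v w : LieSU2) :
    bracket u (bracket v w) = (4 * inner ℝ u w) • v - (4 * inner ℝ u v) • w := by
  apply mat_injective
  obtain ⟨a, b, c, h⟩ := exists_coord u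
  obtain ⟨a', b', c', h'⟩ := exists_coord v
  obtain ⟨a'', b'', c'', h''⟩ := exists_coord w
  simp only [inner_def, bracket, mat_ofMat, map_sub, map_smul, h, h', h'', Matrix.trace_fin_two]
  ext i j
  fin_cases i <;> fin_cases j <;> apply Complex.ext <;>
    simp [coordMat, Matrix.mul_apply, Fin.sum_univ_two] <;> ring

/-- The rotation by the angle `t` around the unit vector `m` (Rodrigues' formula). -/
def rot (m : LieSU2) (t : ℝ) (w : LieSU2) : LieSU2 :=
  Real.cos t • w + (Real.sin t / 2) • bracket m w + ((1 - Real.cos t) * inner ℝ m w) • m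

theorem mat_mul_self {m : LieSU2} (hm : ‖m‖ = 1) : mat m * mat m = -1 := by
  have h := (Matrix.mem_unitaryGroup_iff.1
    (Matrix.mem_specialUnitaryGroup_iff.1 (unitElt m hm).2).1)
  change mat m * star (mat m) = 1 at h
  rw [star_mat, mul_neg] at h
  rw [← h, neg_neg]

/-- The rotation by the angle `t` around the unit vector `m`, as an element of `SU(2)`. -/
def rotElt (m : LieSU2) (hm : ‖m‖ = 1) (t : ℝ) : SU2 :=
  ⟨Real.cos (t / 2) • 1 + Real.sin (t / 2) • mat m, by
    rw [Matrix.mem_specialUnitaryGroup_iff]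
    constructor
    · rw [Matrix.mem_unitaryGroup_iff, star_add, star_smul, star_smul, star_mat, star_one]
      simp only [star_trivial, add_mul, mul_add, smul_mul_smul_comm, mat_mul_self hm, mul_neg,
        one_mul, mul_one]
      have h := Real.cos_sq_add_sin_sq (t / 2)
      calc _ = (Real.cos (t / 2) ^ 2 + Real.sin (t / 2) ^ 2) • (1 : Matrix (Fin 2) (Fin 2) ℂ) := by
            module
        _ = 1 := by rw [h, one_smul]
    · have h3 : inner ℝ m m = 1 := by rw [real_inner_self_eq_norm_sq, hm]; norm_num
      have h := Real.cos_sq_add_sin_sq (t / 2)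
      obtain ⟨a, b, c, h'⟩ := exists_coord m
      rw [inner_def, h', Matrix.trace_fin_two] at h3
      rw [h', Matrix.det_fin_two]
      simp [coordMat, Matrix.mul_apply, Fin.sum_univ_two] at h3
      generalize Real.cos (t / 2) = p at h ⊢
      generalize Real.sin (t / 2) = q at h ⊢
      apply Complex.ext
      · simp [coordMat]
        linear_combination h + q ^ 2 * h3
      · simp [coordMat]
        ring⟩

/-- Conjugation by the unit quaternion `cos(t/2) + sin(t/2) m` expands by `m w m = w - 2⟨m, w⟩ m`;
the double angle formulas turn the result into Rodrigues' formula. -/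
theorem rotElt_smul (m : LieSU2) (hm : ‖m‖ = 1) (t : ℝ) (w : LieSU2) :
    rotElt m hm t • w = rot m t w := by
  apply mat_injective
  have h := anticomm m w
  have h1 := mat_mul_self hm
  have hc : Real.cos t = Real.cos (t / 2) ^ 2 - Real.sin (t / 2) ^ 2 := by
    rw [← Real.cos_two_mul']; ring_nf
  have hs : Real.sin t = 2 * Real.sin (t / 2) * Real.cos (t / 2) := by
    rw [← Real.sin_two_mul]; ring_nf
  have h2 := Real.cos_sq_add_sin_sq (t / 2)
  have h3 : mat m * mat w * mat m = mat w + (-2 * inner ℝ m w) • mat m := by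
    rw [eq_sub_of_add_eq h, sub_mul, mul_assoc, h1]
    simp
    abel
  rw [mat_smul]
  change (Real.cos (t / 2) • 1 + Real.sin (t / 2) • mat m) * mat w *
    star (Real.cos (t / 2) • (1 : Matrix (Fin 2) (Fin 2) ℂ) + Real.sin (t / 2) • mat m) = _
  have h4 : 1 - Real.cos t = 2 * Real.sin (t / 2) ^ 2 := by rw [hc]; linarith
  rw [rot, h4, hc, hs, star_add, star_smul, star_smul, star_mat, star_one]
  simp only [star_trivial, add_mul, mul_add, smul_mul_assoc, mul_smul_comm, mul_neg, one_mul,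
    mul_one, smul_neg, h3, map_add, map_smul, bracket, mat_ofMat]
  module

theorem inner_smul_smul (g : SU2) (u v : LieSU2) : inner ℝ (g • u) (g • v) = inner ℝ u v :=
  (adj g).inner_map_map u v

theorem norm_smul_SU2 (g : SU2) (u : LieSU2) : ‖g • u‖ = ‖u‖ := (adj g).norm_map u

theorem smul_sum_SU2 {ι : Type*} (g : SU2) (S : Finset ι) (f : ι → LieSU2) :
    g • ∑ i ∈ S, f i = ∑ i ∈ S, g • f i := map_sum (adj g) f S

theorem smul_add_SU2 (g : SU2) (u v : LieSU2) : g • (u + v) = g • u + g • v := map_add (adj g) u v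

theorem smul_smul_SU2 (g : SU2) (r : ℝ) (u : LieSU2) : g • (r • u) = r • (g • u) :=
  map_smul (adj g) r u

theorem smul_rot (g : SU2) (m : LieSU2) (t : ℝ) (w : LieSU2) :
    g • rot m t w = rot (g • m) t (g • w) := by
  simp only [rot, smul_add_SU2, smul_smul_SU2, smul_bracket, inner_smul_smul]

theorem rot_zero (m w : LieSU2) : rot m 0 w = w := by simp [rot]

theorem rot_self {m : LieSU2} (hm : ‖m‖ = 1) (t : ℝ) : rot m t m = m := by
  rw [rot, bracket_self, real_inner_self_eq_norm_sq, hm]; module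

theorem rot_smul (m : LieSU2) (t r : ℝ) (w : LieSU2) : rot m t (r • w) = r • rot m t w := by
  simp only [rot, bracket_smul_right, inner_smul_right]; module

theorem rot_add_right (m : LieSU2) (t : ℝ) (u w : LieSU2) :
    rot m t (u + w) = rot m t u + rot m t w := by
  simp only [rot, bracket_add_right, inner_add_right]; module

theorem rot_sum {ι : Type*} (m : LieSU2) (t : ℝ) (S : Finset ι) (f : ι → LieSU2) :
    rot m t (∑ i ∈ S, f i) = ∑ i ∈ S, rot m t (f i) :=
  map_sum (AddMonoidHom.mk' (rot m t) (rot_add_right m t)) f S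

theorem rot_rot {m : LieSU2} (hm : ‖m‖ = 1) (s t : ℝ) (w : LieSU2) :
    rot m s (rot m t w) = rot m (s + t) w := by
  have h : inner ℝ m m = 1 := by rw [real_inner_self_eq_norm_sq, hm]; norm_num
  simp only [rot, bracket_add_right, bracket_smul_right, bracket_bracket, bracket_self,
    inner_add_right, inner_smul_right, inner_bracket_left, h, Real.cos_add, Real.sin_add]
  module

theorem rot_neg (m : LieSU2) (t : ℝ) (w : LieSU2) : rot (-m) t w = rot m (-t) w := by
  have h : bracket (-m) w = -bracket m w := by
    rw [← neg_one_smul ℝ m, bracket_smul_left, neg_one_smul]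
  simp only [rot, h, inner_neg_left, Real.cos_neg, Real.sin_neg]
  module

theorem rot_add_two_pi (m : LieSU2) (t : ℝ) (w : LieSU2) :
    rot m (t + 2 * Real.pi) w = rot m t w := by
  simp only [rot, Real.cos_add_two_pi, Real.sin_add_two_pi]

theorem norm_rot {m : LieSU2} (hm : ‖m‖ = 1) (t : ℝ) (w : LieSU2) : ‖rot m t w‖ = ‖w‖ := by
  rw [← rotElt_smul m hm, norm_smul_SU2]

/-- The commutator being twice the cross product, rotating with unit speed around `m` is generated
by `m/2`. This is why half the length, and not the length, has a flow of period `2π`. -/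
theorem hasDerivAt_rot (m w : LieSU2) : HasDerivAt (fun t => rot m t w)
    (bracket ((1 / 2 : ℝ) • m) w) 0 := by
  have h1 := (Real.hasDerivAt_cos 0).smul_const w
  have h2 := ((Real.hasDerivAt_sin 0).div_const 2).smul_const (bracket m w)
  have h3 := ((((Real.hasDerivAt_cos 0).const_sub 1).mul_const (inner ℝ m w))).smul_const m
  refine ((h1.add h2).add h3).congr_deriv ?_
  simp [bracket_smul_left]

/-- A rotation with a fixed vector off the axis is trivial. -/
theorem eq_zero_of_rot_eq {m : LieSU2} (hm : ‖m‖ = 1) {t : ℝ} {w : LieSU2}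
    (hw : w ∉ Submodule.span ℝ {m}) (h : rot m t w = w) :
    (t : AddCircle (2 * Real.pi)) = 0 := by
  have hm' : inner ℝ m m = 1 := by rw [real_inner_self_eq_norm_sq, hm]; norm_num
  -- The component of `w` orthogonal to the axis is non-zero and also fixed; its scalar product with
  -- its image is `cos t` times its squared length.
  obtain ⟨b, hb⟩ : ∃ b, b = w - inner ℝ m w • m := ⟨_, rfl⟩
  have hb0 : b ≠ 0 := by
    rintro rfl
    exact hw (Submodule.mem_span_singleton.2 ⟨inner ℝ m w, (sub_eq_zero.1 hb.symm).symm⟩)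
  have hmb : inner ℝ m b = 0 := by
    rw [hb, inner_sub_right, inner_smul_right, hm']; ring
  have hrb : rot m t b = b := by
    rw [hb, sub_eq_add_neg, ← neg_smul, rot_add_right, rot_smul, rot_self hm, h]
  have h1 : inner ℝ b (rot m t b) = Real.cos t * inner ℝ b b := by
    rw [rot, inner_add_right, inner_add_right, inner_smul_right, inner_smul_right,
      inner_bracket_right, hmb]
    simp
  rw [hrb] at h1
  have h2 : inner ℝ b b ≠ 0 := inner_self_ne_zero.2 hb0
  have h3 : Real.cos t = 1 := by
    have : (Real.cos t - 1) * inner ℝ b b = 0 := by linarith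
    rcases mul_eq_zero.1 this with h4 | h4
    · linarith
    · exact absurd h4 h2
  obtain ⟨k, hk⟩ := (Real.cos_eq_one_iff t).1 h3
  rw [← hk, AddCircle.coe_eq_zero_iff]
  exact ⟨k, by simp⟩

/-- The rotations around an axis act transitively on the circles around it. -/
theorem exists_rot_eq {m : LieSU2} (hm : ‖m‖ = 1) {w w' : LieSU2} (h : ‖w‖ = ‖w'‖)
    (h' : inner ℝ m w = inner ℝ m w') : ∃ t, rot m t w = w' := by
  have hm' : inner ℝ m m = 1 := by rw [real_inner_self_eq_norm_sq, hm]; norm_num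
  have hm0 : m ≠ 0 := by rintro rfl; simp at hm
  -- If `w` is on the axis, the circle is a point: the two hypotheses force `w' = w`.
  by_cases hw : w ∈ Submodule.span ℝ {m}
  · refine ⟨0, ?_⟩
    obtain ⟨c, rfl⟩ := Submodule.mem_span_singleton.1 hw
    rw [rot_zero]
    rw [inner_smul_right, hm', mul_one] at h'
    have h2 : inner ℝ (w' - c • m) (w' - c • m) = 0 := by
      rw [inner_sub_left, inner_sub_right, inner_sub_right, inner_smul_left, inner_smul_left,
        inner_smul_right, inner_smul_right, hm', real_inner_comm m w', ← h', real_inner_self_eq_norm_sq,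
        ← h, norm_smul, hm]
      simp only [conj_trivial, mul_one, Real.norm_eq_abs, sq_abs]
      ring
    exact (sub_eq_zero.1 (inner_self_eq_zero.1 h2)).symm
  -- In a frame starting with `m`, the vector `w` has transverse coordinates `(a, 0)` with `a > 0`,
  -- and those of `w'` lie on the circle of radius `a`.
  · obtain ⟨_, e₁, e₂, hf, hm1, h2, h1⟩ := exists_frame hm0 hw
    rw [hm, one_smul] at hm1
    obtain rfl := hm1
    have hn := hf.norm_sq w
    have hn' := hf.norm_sq w'
    rw [h, hn', h', h2] at hn
    have hr := hf.sum_repr w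
    rw [h2, zero_smul, add_zero] at hr
    obtain ⟨a, ha⟩ : ∃ a, a = inner ℝ e₁ w := ⟨_, rfl⟩
    rw [← ha] at hn h1 hr
    have hsq : (inner ℝ e₁ w' / a) ^ 2 + (inner ℝ e₂ w' / a) ^ 2 = 1 := by
      field_simp
      linarith
    obtain ⟨t, ht1, ht2⟩ : ∃ t, Real.cos t = inner ℝ e₁ w' / a ∧ Real.sin t = inner ℝ e₂ w' / a := by
      -- The angle is the argument of the unit complex number formed by the normalized transverse
      -- coordinates of `w'`.
      obtain ⟨z, hz⟩ : ∃ z : ℂ, z = ⟨inner ℝ e₁ w' / a, inner ℝ e₂ w' / a⟩ := ⟨_, rfl⟩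
      have hz1 : ‖z‖ = 1 := by
        have : ‖z‖ ^ 2 = 1 := by
          rw [Complex.sq_norm, Complex.normSq_apply, hz, ← hsq]; ring
        nlinarith [norm_nonneg z]
      have hz0 : z ≠ 0 := by rintro h; rw [h] at hz1; simp at hz1
      refine ⟨z.arg, ?_, ?_⟩
      · rw [Complex.cos_arg hz0, hz1, hz, div_one]
      · rw [Complex.sin_arg, hz1, hz, div_one]
    refine ⟨t, ?_⟩
    have ha0 : a ≠ 0 := h1.ne'
    have hb : bracket m e₁ = (2 : ℝ) • e₂ := by rw [hf.br, smul_smul]; norm_num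
    have e1 : a * (inner ℝ e₁ w' / a) = inner ℝ e₁ w' := mul_div_cancel₀ _ ha0
    have e2 : a * (inner ℝ e₂ w' / a / 2 * 2) = inner ℝ e₂ w' := by field_simp
    conv_rhs => rw [← hf.sum_repr w']
    rw [← hr, rot_add_right, rot_smul, rot_smul, rot_self hm, rot, hf.h01, ht1, ht2, h', hb]
    simp only [mul_zero, zero_smul, add_zero, smul_add, smul_smul]
    rw [e1, e2, ← add_assoc]

/-- Pairs of vectors with the same Gram matrix are congruent. -/
theorem exists_smul_eq_of_gram {u v u' v' : LieSU2} (hu : u ≠ 0) (huu : ‖u‖ = ‖u'‖)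
    (hvv : ‖v‖ = ‖v'‖) (huv : inner ℝ u v = inner ℝ u' v') :
    ∃ g : SU2, g • u = u' ∧ g • v = v' := by
  have hu' : u' ≠ 0 := by rw [← norm_ne_zero_iff, ← huu, norm_ne_zero_iff]; exact hu
  have hn : ‖u'‖ ≠ 0 := norm_ne_zero_iff.2 hu'
  have h1 : ∃ g : SU2, g • u = u' := by
    -- The half-turn around `u + u'` exchanges `u` and `u'`. When `u' = -u` this axis vanishes, and
    -- a half-turn around any unit vector orthogonal to `u` is used instead.
    by_cases h0 : u + u' = 0
    · have hx : ∃ x : LieSU2, x ∉ Submodule.span ℝ {u} := by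
        by_contra hx
        push Not at hx
        have h2 : Module.finrank ℝ (Submodule.span ℝ {u}) = 3 := by
          rw [(Submodule.eq_top_iff'.2 hx), finrank_top, finrank_lieSU2]
        have h3 := finrank_span_le_card (R := ℝ) ({u} : Set LieSU2)
        rw [h2] at h3
        simp at h3
      obtain ⟨x, hx⟩ := hx
      obtain ⟨e₀, e₁, e₂, hf, hue, -, -⟩ := exists_frame hu hx
      obtain ⟨g, hg⟩ := exists_halfTurn (a := e₁) (by
        rintro rfl
        have := hf.h11
        simp at this)
      refine ⟨g, ?_⟩
      rw [hg, halfTurn_of_orth]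
      · exact neg_eq_of_add_eq_zero_right h0
      · rw [hue, inner_smul_right, hf.h10, mul_zero]
    · obtain ⟨g, hg⟩ := exists_halfTurn h0
      refine ⟨g, ?_⟩
      rw [hg, halfTurn_add_apply _ h0]
      rw [real_inner_self_eq_norm_sq, real_inner_self_eq_norm_sq, huu]
  obtain ⟨g, hg⟩ := h1
  have hm : ‖‖u'‖⁻¹ • u'‖ = 1 := by rw [norm_smul, norm_inv, norm_norm, inv_mul_cancel₀ hn]
  -- With `u` already moved to `u'`, a rotation around `u'` adjusts the second vector.
  obtain ⟨t, ht⟩ := exists_rot_eq hm (w := g • v) (w' := v') (by rw [norm_smul_SU2, hvv]) (by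
    rw [inner_smul_left, inner_smul_left, ← huv, ← inner_smul_smul g u v, hg])
  refine ⟨rotElt _ hm t * g, ?_, ?_⟩
  · rw [mul_smul, hg, rotElt_smul]
    have hr := congrArg (fun x => ‖u'‖ • x) (rot_self hm t)
    simp only [← rot_smul, smul_smul, mul_inv_cancel₀ hn, one_smul] at hr
    exact hr
  · rw [mul_smul, rotElt_smul, ht]

/-- An element of `SU(2)` that fixes two independent vectors acts trivially. -/
theorem smul_eq_self_of_fixed {u v : LieSU2} (hu : u ≠ 0) (hv : v ∉ Submodule.span ℝ {u}) {g : SU2}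
    (hgu : g • u = u) (hgv : g • v = v) (w : LieSU2) : g • w = w := by
  obtain ⟨e₀, e₁, e₂, hf, hue, h2, h1⟩ := exists_frame hu hv
  have hn : ‖u‖ ≠ 0 := norm_ne_zero_iff.2 hu
  have h0 : g • e₀ = e₀ := by
    rw [hue, smul_smul_SU2] at hgu
    exact smul_right_injective _ hn hgu
  refine hf.smul_eq h0 ?_ w
  have hr := hf.sum_repr v
  rw [h2, zero_smul, add_zero] at hr
  rw [← hr, smul_add_SU2, smul_smul_SU2, smul_smul_SU2, h0] at hgv
  exact smul_right_injective _ h1.ne' (add_left_cancel hgv)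

end

section
/-! ### Bending -/

variable {n : ℕ}

/-- The sum of the sides of a polygon with index in `S`. -/
def partSum (S : Finset (Fin n)) (x : Fin n → LieSU2) : LieSU2 := ∑ i ∈ S, x i

/-- The direction of `partSum S x`. -/
def axis (S : Finset (Fin n)) (x : Fin n → LieSU2) : LieSU2 := ‖partSum S x‖⁻¹ • partSum S x

/-- Bending: the rotation by the angle `t` around `partSum S x` of the sides with index in `S`. -/
def bend (S : Finset (Fin n)) (t : ℝ) (x : Fin n → LieSU2) : Fin n → LieSU2 :=
  fun i => if i ∈ S then rot (axis S x) t (x i) else x i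

variable {S S' : Finset (Fin n)} {x : Fin n → LieSU2} {ℓ : Fin n → Set.Ioi (0 : ℝ)}

theorem norm_axis (h : partSum S x ≠ 0) : ‖axis S x‖ = 1 := by
  rw [axis, norm_smul, norm_inv, norm_norm, inv_mul_cancel₀ (norm_ne_zero_iff.2 h)]

theorem norm_smul_axis (h : partSum S x ≠ 0) : ‖partSum S x‖ • axis S x = partSum S x := by
  rw [axis, smul_smul, mul_inv_cancel₀ (norm_ne_zero_iff.2 h), one_smul]

theorem partSum_smul (g : SU2) (S : Finset (Fin n)) (x : Fin n → LieSU2) :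
    partSum S (g • x) = g • partSum S x := (smul_sum_SU2 g S x).symm

theorem axis_smul (g : SU2) (S : Finset (Fin n)) (x : Fin n → LieSU2) :
    axis S (g • x) = g • axis S x := by
  rw [axis, axis, partSum_smul, norm_smul_SU2, smul_smul_SU2]

theorem bend_smul (g : SU2) (S : Finset (Fin n)) (t : ℝ) (x : Fin n → LieSU2) :
    bend S t (g • x) = g • bend S t x := by
  funext i
  simp only [bend, axis_smul, Pi.smul_apply]
  split_ifs
  · rw [smul_rot]
  · rfl

theorem bend_of_mem {i : Fin n} (hi : i ∈ S) (t : ℝ) (x : Fin n → LieSU2) :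
    bend S t x i = rot (axis S x) t (x i) := if_pos hi

theorem bend_of_notMem {i : Fin n} (hi : i ∉ S) (t : ℝ) (x : Fin n → LieSU2) :
    bend S t x i = x i := if_neg hi

theorem partSum_bend_of_subset (h : S' ⊆ S) (t : ℝ) (x : Fin n → LieSU2) :
    partSum S' (bend S t x) = rot (axis S x) t (partSum S' x) := by
  rw [partSum, partSum, rot_sum]
  exact Finset.sum_congr rfl fun i hi => bend_of_mem (h hi) t x

theorem partSum_bend_of_disjoint (h : Disjoint S S') (t : ℝ) (x : Fin n → LieSU2) :
    partSum S' (bend S t x) = partSum S' x :=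
  Finset.sum_congr rfl fun _ hi => bend_of_notMem (Finset.disjoint_right.1 h hi) t x

theorem rot_axis_partSum (h : partSum S x ≠ 0) (t : ℝ) :
    rot (axis S x) t (partSum S x) = partSum S x := by
  conv_lhs => rw [← norm_smul_axis h]
  rw [rot_smul, rot_self (norm_axis h), norm_smul_axis h]

theorem partSum_bend_self (h : partSum S x ≠ 0) (t : ℝ) :
    partSum S (bend S t x) = partSum S x := by
  rw [partSum_bend_of_subset subset_rfl, rot_axis_partSum h]

theorem axis_bend_self (h : partSum S x ≠ 0) (t : ℝ) : axis S (bend S t x) = axis S x := by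
  rw [axis, axis, partSum_bend_self h]

theorem partSum_sdiff_add (h : S ⊆ S') (x : Fin n → LieSU2) :
    partSum (S' \ S) x + partSum S x = partSum S' x := Finset.sum_sdiff h

/-- The sides of `S` turn around their own sum, so this sum does not move, and neither do the other
sides. -/
theorem partSum_bend_of_superset (h : S ⊆ S') (h0 : partSum S x ≠ 0) (t : ℝ) :
    partSum S' (bend S t x) = partSum S' x := by
  rw [← partSum_sdiff_add h, ← partSum_sdiff_add h, partSum_bend_self h0,
    partSum_bend_of_disjoint Finset.disjoint_sdiff]

theorem partSum_compl (hx : x ∈ polygonSet ℓ) (S : Finset (Fin n)) :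
    partSum Sᶜ x = -partSum S x := by
  have h : partSum Sᶜ x + partSum S x = 0 := by
    rw [← hx.2]
    exact Finset.sum_compl_add_sum S x
  exact eq_neg_of_add_eq_zero_left h

theorem axis_compl (hx : x ∈ polygonSet ℓ) (S : Finset (Fin n)) : axis Sᶜ x = -axis S x := by
  rw [axis, axis, partSum_compl hx, norm_neg, smul_neg]

@[simp] theorem bend_zero (S : Finset (Fin n)) (x : Fin n → LieSU2) : bend S 0 x = x := by
  funext i
  simp [bend, rot_zero]

theorem bend_bend (h : partSum S x ≠ 0) (s t : ℝ) :
    bend S s (bend S t x) = bend S (s + t) x := by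
  funext i
  by_cases hi : i ∈ S
  · rw [bend_of_mem hi, bend_of_mem hi, bend_of_mem hi, axis_bend_self h, rot_rot (norm_axis h)]
  · rw [bend_of_notMem hi, bend_of_notMem hi, bend_of_notMem hi]

theorem bend_add_two_pi (S : Finset (Fin n)) (t : ℝ) (x : Fin n → LieSU2) :
    bend S (t + 2 * Real.pi) x = bend S t x := by
  funext i
  simp only [bend, rot_add_two_pi]

theorem bend_mem_polygonSet (hx : x ∈ polygonSet ℓ) (h : partSum S x ≠ 0) (t : ℝ) :
    bend S t x ∈ polygonSet ℓ := by
  constructor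
  · intro i
    by_cases hi : i ∈ S
    · rw [bend_of_mem hi, norm_rot (norm_axis h), hx.1]
    · rw [bend_of_notMem hi, hx.1]
  · exact (partSum_bend_of_superset (Finset.subset_univ S) h t).trans hx.2

/-- The non-zero partial sum spans the common line, so all the sides are on the rotation axis. -/
theorem IsCollinear.bend_eq (hx : IsCollinear x) (h : partSum S x ≠ 0) (t : ℝ) :
    bend S t x = x := by
  obtain ⟨v, hv⟩ := hx
  obtain ⟨c, hc⟩ := Submodule.mem_span_singleton.1
    (Submodule.sum_mem (Submodule.span ℝ {v}) fun i (_ : i ∈ S) => hv i)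
  change c • v = partSum S x at hc
  have hc0 : c ≠ 0 := by rintro rfl; rw [zero_smul] at hc; exact h hc.symm
  have hrv : rot (axis S x) t v = v := by
    have h1 := rot_axis_partSum h t
    rw [← hc, rot_smul, hc] at h1
    exact smul_right_injective _ hc0 (h1.trans hc.symm)
  funext i
  by_cases hi : i ∈ S
  · obtain ⟨d, hd⟩ := Submodule.mem_span_singleton.1 (hv i)
    rw [bend_of_mem hi, ← hd, rot_smul, hrv]
  · rw [bend_of_notMem hi]

theorem bend_mem_reg (hx : x ∈ regPolygonSet ℓ) (h : partSum S x ≠ 0) (t : ℝ) :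
    bend S t x ∈ regPolygonSet ℓ := by
  refine ⟨bend_mem_polygonSet hx.1 h t, fun hc => hx.2 ?_⟩
  -- A collinear bent polygon would be fixed by bending back, so it would coincide with `x`.
  have h1 := hc.bend_eq (by rwa [partSum_bend_self h]) (-t)
  rw [bend_bend h, neg_add_cancel, bend_zero] at h1
  rwa [h1]

/-- Up to a global rotation, bending a part and bending its complement are the same. -/
theorem smul_bend_compl (hx : x ∈ polygonSet ℓ) (h : partSum S x ≠ 0) (t : ℝ) :
    rotElt (axis S x) (norm_axis h) t • bend Sᶜ t x = bend S t x := by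
  funext i
  rw [Pi.smul_apply, rotElt_smul]
  by_cases hi : i ∈ S
  · rw [bend_of_mem hi, bend_of_notMem (by simpa using hi)]
  -- The complement has the opposite axis, so its sides have turned by `-t` around the axis of `S`;
  -- the global rotation puts them back.
  · rw [bend_of_notMem hi, bend_of_mem (by simpa using hi), axis_compl hx, rot_neg,
      rot_rot (norm_axis h), add_neg_cancel, rot_zero]

/-- Two sets are nested, disjoint or cover everything. -/
def Laminar (S S' : Finset (Fin n)) : Prop :=
  S ⊆ S' ∨ S' ⊆ S ∨ Disjoint S S' ∨ Sᶜ ⊆ S'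

/-- In every case the sum over `S'`, or the opposite sum over its complement, is either unmoved or
rotated as a whole. -/
theorem norm_partSum_bend (hx : x ∈ polygonSet ℓ) (h : partSum S x ≠ 0) (hS : Laminar S S')
    (t : ℝ) : ‖partSum S' (bend S t x)‖ = ‖partSum S' x‖ := by
  rcases hS with h1 | h1 | h1 | h1
  · rw [partSum_bend_of_superset h1 h]
  · rw [partSum_bend_of_subset h1, norm_rot (norm_axis h)]
  · rw [partSum_bend_of_disjoint h1]
  · have h2 : S'ᶜ ⊆ S := compl_le_iff_compl_le.1 h1
    rw [← norm_neg, ← partSum_compl (bend_mem_polygonSet hx h t), partSum_bend_of_subset h2,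
      norm_rot (norm_axis h), partSum_compl hx, norm_neg]

/-- The inner bending does not move the axis of `S'`, while the outer one rotates the axis of `S`
rigidly together with its sides. Conjugating the inner rotation by the outer one gives the equality.
-/
theorem bend_comm_of_subset (hS : S ⊆ S') (h : partSum S x ≠ 0) (h' : partSum S' x ≠ 0)
    (s t : ℝ) : bend S s (bend S' t x) = bend S' t (bend S s x) := by
  have ha : axis S' (bend S s x) = axis S' x := by
    rw [axis, axis, partSum_bend_of_superset hS h]
  have hb : axis S (bend S' t x) = rot (axis S' x) t (axis S x) := by
    rw [axis, partSum_bend_of_subset hS, norm_rot (norm_axis h'), ← rot_smul, ← axis]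
  funext i
  by_cases hi : i ∈ S
  · rw [bend_of_mem hi, bend_of_mem (hS hi), bend_of_mem (hS hi), bend_of_mem hi, ha, hb,
      ← rotElt_smul _ (norm_axis h'), ← rotElt_smul _ (norm_axis h'),
      ← rotElt_smul _ (norm_axis h'), smul_rot]
  · rw [bend_of_notMem hi]
    by_cases hi' : i ∈ S'
    · rw [bend_of_mem hi', bend_of_mem hi', bend_of_notMem hi, ha]
    · rw [bend_of_notMem hi', bend_of_notMem hi', bend_of_notMem hi]

theorem bend_comm_of_disjoint (hS : Disjoint S S') (s t : ℝ) (x : Fin n → LieSU2) :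
    bend S s (bend S' t x) = bend S' t (bend S s x) := by
  have ha : axis S' (bend S s x) = axis S' x := by
    rw [axis, axis, partSum_bend_of_disjoint hS]
  have hb : axis S (bend S' t x) = axis S x := by
    rw [axis, axis, partSum_bend_of_disjoint hS.symm]
  funext i
  by_cases hi : i ∈ S
  · have hi' := Finset.disjoint_left.1 hS hi
    rw [bend_of_mem hi, bend_of_notMem hi', bend_of_notMem hi', bend_of_mem hi, hb]
  · rw [bend_of_notMem hi]
    by_cases hi' : i ∈ S'
    · rw [bend_of_mem hi', bend_of_mem hi', bend_of_notMem hi, ha]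
    · rw [bend_of_notMem hi', bend_of_notMem hi', bend_of_notMem hi]

/-- Bendings along a laminar pair commute up to a global rotation. -/
theorem exists_smul_bend_comm (hx : x ∈ polygonSet ℓ) (h : partSum S x ≠ 0)
    (h' : partSum S' x ≠ 0) (hS : Laminar S S') (s t : ℝ) :
    ∃ g : SU2, g • bend S' t (bend S s x) = bend S s (bend S' t x) := by
  rcases hS with h1 | h1 | h1 | h1
  · exact ⟨1, by rw [one_smul, bend_comm_of_subset h1 h h']⟩
  · exact ⟨1, by rw [one_smul, bend_comm_of_subset h1 h' h]⟩
  · exact ⟨1, by rw [one_smul, bend_comm_of_disjoint h1]⟩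
  · have hc : partSum Sᶜ x ≠ 0 := by rwa [partSum_compl hx, neg_ne_zero]
    have hx' := bend_mem_polygonSet hx h' t
    have h2 : partSum S (bend S' t x) ≠ 0 := by
      rw [← norm_ne_zero_iff, norm_partSum_bend hx h', norm_ne_zero_iff]
      · exact h
      · exact Or.inr (Or.inr (Or.inr (compl_le_iff_compl_le.1 h1)))
    -- The bending along `S` is replaced by that along its complement, which is contained in `S'`,
    -- on both sides of the equality. The two factors are the global rotations of these
    -- replacements, after and before bending `S'`.
    refine ⟨rotElt _ (norm_axis h2) s * (rotElt _ (norm_axis h) s)⁻¹, ?_⟩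
    rw [← smul_bend_compl hx' h2, mul_smul, bend_comm_of_subset h1 hc h', ← bend_smul,
      ← smul_bend_compl hx h, inv_smul_smul]

end

section
/-! ### Linear algebra at a polygon -/

variable {n : ℕ} {x : Fin n → LieSU2} {ℓ : Fin n → Set.Ioi (0 : ℝ)}

theorem inner_bracket_rotate (u v w : LieSU2) :
    inner ℝ u (bracket v w) = inner ℝ w (bracket u v) := by
  rw [inner_bracket_cyclic, inner_bracket_cyclic]

theorem bracket_ne_zero_iff {u v : LieSU2} (hu : u ≠ 0) :
    bracket u v ≠ 0 ↔ v ∉ Submodule.span ℝ {u} := by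
  rw [not_iff_not]
  constructor
  · intro h
    have h1 := bracket_bracket u u v
    rw [h, real_inner_self_eq_norm_sq] at h1
    have h2 : bracket u (0 : LieSU2) = 0 := map_zero (bracketₗ u)
    rw [h2] at h1
    have hn : ‖u‖ ≠ 0 := norm_ne_zero_iff.2 hu
    refine Submodule.mem_span_singleton.2 ⟨inner ℝ u v / ‖u‖ ^ 2, ?_⟩
    have h3 : (4 * ‖u‖ ^ 2) • v = (4 * inner ℝ u v) • u := (sub_eq_zero.1 h1.symm).symm
    have h4 : (4 * ‖u‖ ^ 2)⁻¹ • (4 * ‖u‖ ^ 2) • v = v := by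
      rw [smul_smul, inv_mul_cancel₀ (by positivity), one_smul]
    rw [h3, smul_smul] at h4
    refine Eq.trans ?_ h4
    congr 1
    field_simp
  · intro h
    obtain ⟨c, rfl⟩ := Submodule.mem_span_singleton.1 h
    rw [bracket_smul_right, bracket_self, smul_zero]

theorem exists_bracket_ne_zero (hx : ¬ IsCollinear x) : ∃ i j, bracket (x i) (x j) ≠ 0 := by
  by_contra h
  push Not at h
  apply hx
  by_cases h0 : ∃ i, x i ≠ 0
  · obtain ⟨i, hi⟩ := h0
    refine ⟨x i, fun j => ?_⟩
    by_contra hj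
    exact (bracket_ne_zero_iff hi).2 hj (h i j)
  · push Not at h0
    exact ⟨0, fun i => by rw [h0]; exact zero_mem _⟩

/-- Orthogonality to `u` and `v` gives `[w, [u, v]] = 0`, whereas `w ⊥ [u, v]` makes the squared
length of this bracket equal to `4 ‖w‖² ‖[u, v]‖²`. Thus `u`, `v`, `[u, v]` serve as a basis for
testing vectors. -/
theorem eq_zero_of_inner_eq_zero {u v w : LieSU2} (h : bracket u v ≠ 0) (hu : inner ℝ u w = 0)
    (hv : inner ℝ v w = 0) (huv : inner ℝ (bracket u v) w = 0) : w = 0 := by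
  have h1 : bracket w (bracket u v) = 0 := by
    rw [bracket_bracket, real_inner_comm v w, real_inner_comm u w, hu, hv]; simp
  have h2 := inner_bracket_self w (bracket u v)
  rw [h1, real_inner_comm (bracket u v) w, huv, inner_zero_left, real_inner_self_eq_norm_sq,
    real_inner_self_eq_norm_sq] at h2
  have h3 : ‖w‖ ^ 2 * ‖bracket u v‖ ^ 2 = 0 := by linarith
  rcases mul_eq_zero.1 h3 with h4 | h4
  · simpa using h4
  · exact absurd (by simpa using h4) h

/-! ### Invariants of the diagonal action and rigidity of polygons -/

/-- The invariants of a polygon: Gram matrix and triple products. -/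
def invariants (x : Fin n → LieSU2) : (Fin n → Fin n → ℝ) × (Fin n → Fin n → Fin n → ℝ) :=
  (fun i j => inner ℝ (x i) (x j), fun i j k => inner ℝ (x i) (bracket (x j) (x k)))

theorem invariants_smul (g : SU2) (x : Fin n → LieSU2) : invariants (g • x) = invariants x := by
  simp only [invariants, Pi.smul_apply, ← smul_bracket, inner_smul_smul]

theorem contDiff_invariants {m : ℕ∞ω} : ContDiff ℝ m (invariants (n := n)) := by
  have hk : ∀ k : Fin n, ContDiff ℝ m (fun x : Fin n → LieSU2 => x k) := fun k =>
    contDiff_apply ℝ LieSU2 k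
  refine ContDiff.prodMk (contDiff_pi.2 fun i => contDiff_pi.2 fun j => (hk i).inner ℝ (hk j))
    (contDiff_pi.2 fun i => contDiff_pi.2 fun j => contDiff_pi.2 fun k => (hk i).inner ℝ ?_)
  exact (bracketL.contDiff.comp (hk j)).clm_apply (hk k)

/-- The invariants separate the orbits. -/
theorem exists_smul_eq_of_invariants {y : Fin n → LieSU2} (hx : ¬ IsCollinear x)
    (h : invariants x = invariants y) : ∃ g : SU2, g • x = y := by
  obtain ⟨i, j, hij⟩ := exists_bracket_ne_zero hx
  have hG : ∀ i j, inner ℝ (x i) (x j) = inner ℝ (y i) (y j) := fun i j =>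
    congrFun (congrFun (congrArg Prod.fst h) i) j
  have hT : ∀ i j k, inner ℝ (x i) (bracket (x j) (x k)) = inner ℝ (y i) (bracket (y j) (y k)) :=
    fun i j k => congrFun (congrFun (congrFun (congrArg Prod.snd h) i) j) k
  have hN : ∀ i, ‖x i‖ = ‖y i‖ := fun i => by
    have := hG i i
    rwa [real_inner_self_eq_norm_sq, real_inner_self_eq_norm_sq,
      sq_eq_sq₀ (norm_nonneg _) (norm_nonneg _)] at this
  have hi : x i ≠ 0 := by
    intro h0
    rw [h0] at hij
    exact hij (by simpa using bracket_smul_left 0 0 (x j))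
  -- Two independent sides fix the rotation. Every other side is then determined by its products
  -- with these two and with their bracket; the last product is a triple product, which excludes
  -- reflections.
  obtain ⟨g, hgi, hgj⟩ := exists_smul_eq_of_gram hi (hN i) (hN j) (hG i j)
  refine ⟨g, funext fun k => ?_⟩
  rw [Pi.smul_apply, ← sub_eq_zero]
  have hb : g • bracket (x i) (x j) = bracket (y i) (y j) := by rw [smul_bracket, hgi, hgj]
  apply eq_zero_of_inner_eq_zero (u := y i) (v := y j)
  · rw [← hb]
    intro h0
    rw [← norm_eq_zero, norm_smul_SU2, norm_eq_zero] at h0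
    exact hij h0
  · rw [inner_sub_right, ← hG, ← hgi, inner_smul_smul, sub_self]
  · rw [inner_sub_right, ← hG, ← hgj, inner_smul_smul, sub_self]
  · rw [inner_sub_right, real_inner_comm (y k), ← hT, ← hb, inner_smul_smul,
      real_inner_comm (x k), sub_self]

theorem fderiv_invariants_apply (x u : Fin n → LieSU2) :
    fderiv ℝ invariants x u = (fun i j => inner ℝ (x i) (u j) + inner ℝ (u i) (x j),
      fun i j k => inner ℝ (x i) (bracket (x j) (u k) + bracket (u j) (x k)) +
        inner ℝ (u i) (bracket (x j) (x k))) := by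
  have h1 : HasDerivAt (fun s : ℝ => x + s • u) u 0 := by
    simpa using ((hasDerivAt_id (0 : ℝ)).smul_const u).const_add x
  have hk : ∀ k, HasDerivAt (fun s : ℝ => (x + s • u) k) (u k) 0 := fun k => hasDerivAt_pi.1 h1 k
  have h0 : ∀ k, (x + (0 : ℝ) • u) k = x k := fun k => by simp
  have h2 : HasDerivAt (fun s : ℝ => invariants (x + s • u)) (fderiv ℝ invariants x u) 0 := by
    have h3 : HasFDerivAt (invariants (n := n)) (fderiv ℝ invariants x) (x + (0 : ℝ) • u) := by
      rw [zero_smul, add_zero]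
      exact (contDiff_invariants.differentiable one_ne_zero x).hasFDerivAt
    exact h3.comp_hasDerivAt 0 h1
  refine h2.unique (HasDerivAt.prodMk (hasDerivAt_pi.2 fun i => hasDerivAt_pi.2 fun j => ?_)
    (hasDerivAt_pi.2 fun i => hasDerivAt_pi.2 fun j => hasDerivAt_pi.2 fun k => ?_))
  · have := (hk i).inner ℝ (hk j)
    rwa [h0, h0] at this
  · have hb : HasDerivAt (fun s : ℝ => bracket ((x + s • u) j) ((x + s • u) k))
        (bracket (x j) (u k) + bracket (u j) (x k)) 0 := by
      have h4 := bracketL.hasDerivAt_of_bilinear (fun _ => hk j) (fun _ => hk k)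
      rwa [h0, h0] at h4
    have := (hk i).inner ℝ hb
    rw [h0, h0, h0] at this
    exact this

/-- The generators of the action of `SU(2)` on polygons. -/
def generator (x : Fin n → LieSU2) : LieSU2 →ₗ[ℝ] (Fin n → LieSU2) :=
  LinearMap.pi fun k => bracketₗ.flip (x k)

@[simp] theorem generator_apply (x : Fin n → LieSU2) (ζ : LieSU2) (k : Fin n) :
    generator x ζ k = bracket ζ (x k) := rfl

/-- A non-zero `ζ` commuting with all the sides would span a line containing them. -/
theorem ker_generator (hx : ¬ IsCollinear x) : LinearMap.ker (generator x) = ⊥ := by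
  rw [LinearMap.ker_eq_bot']
  intro ζ hζ
  by_contra h0
  refine hx ⟨ζ, fun i => ?_⟩
  by_contra hi
  exact (bracket_ne_zero_iff h0).2 hi (congrFun hζ i)

/-- Infinitesimal rigidity. -/
theorem exists_generator_of_fderiv_invariants {u : Fin n → LieSU2} (hx : ¬ IsCollinear x)
    (h : fderiv ℝ invariants x u = 0) : ∃ ζ, generator x ζ = u := by
  obtain ⟨i, j, hij⟩ := exists_bracket_ne_zero hx
  have hi : x i ≠ 0 := by
    intro h0
    rw [h0] at hij
    exact hij (by simpa using bracket_smul_left 0 0 (x j))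
  have hni : inner ℝ (x i) (x i) ≠ 0 := inner_self_ne_zero.2 hi
  -- The variation `u i` is orthogonal to `x i`, so it is an infinitesimal rotation of `x i`;
  -- subtracting the generator of `ζ` makes the variation of this side zero.
  obtain ⟨ζ, hζ⟩ : ∃ ζ, bracket ζ (x i) = u i := by
    rw [fderiv_invariants_apply] at h
    have h1 := congrFun (congrFun (congrArg Prod.fst h) i) i
    have h2 : inner ℝ (x i) (u i) = 0 := by
      simp only [Prod.fst_zero, Pi.zero_apply] at h1
      rw [real_inner_comm (x i)] at h1
      linarith
    refine ⟨(4 * inner ℝ (x i) (x i))⁻¹ • bracket (x i) (u i), ?_⟩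
    rw [bracket_smul_left, bracket_anticomm, bracket_bracket, h2, mul_zero, zero_smul, zero_sub,
      neg_neg, smul_smul, inv_mul_cancel₀ (by simpa using hni), one_smul]
  have key : ∀ ξ, fderiv ℝ invariants x (generator x ξ) = 0 := by
    intro ξ
    rw [fderiv_invariants_apply]
    refine Prod.ext (funext fun i => funext fun j => ?_)
      (funext fun i => funext fun j => funext fun k => ?_)
    · simp only [generator_apply, Prod.fst_zero, Pi.zero_apply]
      rw [inner_bracket_rotate, real_inner_comm, bracket_anticomm, inner_neg_left]
      ring
    · simp only [generator_apply, Prod.snd_zero, Pi.zero_apply]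
      -- The Jacobi identity: `[ξ, ·]` is a derivation of the bracket.
      have e : bracket (x j) (bracket ξ (x k)) + bracket (bracket ξ (x j)) (x k) =
          bracket ξ (bracket (x j) (x k)) := by
        rw [bracket_bracket, bracket_anticomm (bracket ξ (x j)), bracket_bracket, bracket_bracket,
          real_inner_comm (x j) (x k), real_inner_comm ξ (x j), real_inner_comm ξ (x k)]
        module
      rw [e, inner_bracket_rotate, real_inner_comm, bracket_anticomm (x i) ξ, inner_neg_left]
      ring
  obtain ⟨u', hu'⟩ : ∃ u', u' = u - generator x ζ := ⟨_, rfl⟩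
  have h' : fderiv ℝ invariants x u' = 0 := by rw [hu', map_sub, h, key, sub_zero]
  have hi' : u' i = 0 := by rw [hu', Pi.sub_apply, generator_apply, hζ, sub_self]
  -- The corrected variation of `x j` is orthogonal to both `x i` and `x j`. It is hence produced by
  -- an infinitesimal rotation around `x i`, which does not disturb `x i`.
  obtain ⟨c, hc⟩ : ∃ c : ℝ, c • bracket (x i) (x j) = u' j := by
    rw [fderiv_invariants_apply] at h'
    have h1 := congrFun (congrFun (congrArg Prod.fst h') j) j
    have h2 := congrFun (congrFun (congrArg Prod.fst h') i) j
    simp only [Prod.fst_zero, Pi.zero_apply, hi', inner_zero_left, add_zero] at h1 h2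
    rw [real_inner_comm (x j)] at h1
    have hb : inner ℝ (bracket (x i) (x j)) (bracket (x i) (x j)) ≠ 0 := inner_self_ne_zero.2 hij
    refine ⟨inner ℝ (bracket (x i) (x j)) (u' j) /
      inner ℝ (bracket (x i) (x j)) (bracket (x i) (x j)), ?_⟩
    rw [← sub_eq_zero]
    apply eq_zero_of_inner_eq_zero hij
    · rw [inner_sub_right, inner_smul_right, inner_bracket_left, h2]; ring
    · rw [inner_sub_right, inner_smul_right, inner_bracket_right]; linarith
    · rw [inner_sub_right, inner_smul_right, div_mul_cancel₀ _ hb, sub_self]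
  have h'' : fderiv ℝ invariants x (u' - generator x (c • x i)) = 0 := by
    rw [map_sub, h', key, sub_zero]
  obtain ⟨u'', hu''⟩ : ∃ u'', u'' = u' - generator x (c • x i) := ⟨_, rfl⟩
  rw [← hu''] at h''
  have hi'' : u'' i = 0 := by
    rw [hu'', Pi.sub_apply, generator_apply, hi', bracket_smul_left, bracket_self]; simp
  have hj'' : u'' j = 0 := by
    rw [hu'', Pi.sub_apply, generator_apply, bracket_smul_left, hc, sub_self]
  -- Once two independent sides do not vary, the constancy of the products with them and of the
  -- triple products freezes all the others.
  have hall : u'' = 0 := by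
    rw [fderiv_invariants_apply] at h''
    funext k
    have h1 := congrFun (congrFun (congrArg Prod.fst h'') i) k
    have h2 := congrFun (congrFun (congrArg Prod.fst h'') j) k
    have h3 := congrFun (congrFun (congrFun (congrArg Prod.snd h'') k) i) j
    simp only [Prod.fst_zero, Prod.snd_zero, Pi.zero_apply, hi'', hj'', inner_zero_left,
      add_zero] at h1 h2 h3
    rw [show bracket (x i) (0 : LieSU2) = 0 from map_zero (bracketₗ (x i)),
      show bracket (0 : LieSU2) (x j) = 0 from by simpa using bracket_smul_left 0 0 (x j),
      add_zero, inner_zero_right, zero_add, real_inner_comm] at h3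
    exact eq_zero_of_inner_eq_zero hij h1 h2 h3
  refine ⟨ζ + c • x i, ?_⟩
  rw [map_add]
  have e1 := hu''.symm.trans hall
  rw [hu'] at e1
  rw [sub_sub, sub_eq_zero] at e1
  exact e1.symm

/-- Each generator is the velocity of a curve in the orbit. -/
theorem exists_hasDerivAt_smul (x : Fin n → LieSU2) (ζ : LieSU2) :
    ∃ g : ℝ → SU2, g 0 • x = x ∧ HasDerivAt (fun s => g s • x) (generator x ζ) 0 := by
  by_cases h0 : ζ = 0
  · refine ⟨fun _ => 1, one_smul _ _, ?_⟩
    rw [h0, map_zero]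
    exact hasDerivAt_const _ _
  have hn : ‖ζ‖ ≠ 0 := norm_ne_zero_iff.2 h0
  have hm : ‖‖ζ‖⁻¹ • ζ‖ = 1 := by rw [norm_smul, norm_inv, norm_norm, inv_mul_cancel₀ hn]
  -- Unit angular speed around `m = ζ/‖ζ‖` gives the velocity `[m/2, ·]`, so the speed must be
  -- `2‖ζ‖`.
  refine ⟨fun s => rotElt _ hm ((2 * ‖ζ‖) * s), ?_, hasDerivAt_pi.2 fun k => ?_⟩
  · funext k
    rw [Pi.smul_apply, rotElt_smul, mul_zero, rot_zero]
  · simp only [Pi.smul_apply, rotElt_smul]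
    have h1 : HasDerivAt (fun s : ℝ => (2 * ‖ζ‖) * s) (2 * ‖ζ‖) 0 := by
      simpa using (hasDerivAt_id (0 : ℝ)).const_mul (2 * ‖ζ‖)
    have h2 := hasDerivAt_rot (‖ζ‖⁻¹ • ζ) (x k)
    rw [← mul_zero (2 * ‖ζ‖)] at h2
    refine (h2.scomp (0 : ℝ) h1).congr_deriv ?_
    rw [generator_apply, ← bracket_smul_left, smul_smul, smul_smul]
    congr 1
    rw [show 2 * ‖ζ‖ * (1 / 2) * ‖ζ‖⁻¹ = 1 by field_simp, one_smul]

/-! ### The tangent space of the polygon set and the kernel of the product form -/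

/-- The tangent space of `P_ℓ`. -/
def tangentSub (x : Fin n → LieSU2) : Submodule ℝ (Fin n → LieSU2) where
  carrier := {u | (∀ i, inner ℝ (x i) (u i) = 0) ∧ ∑ i, u i = 0}
  add_mem' := by
    rintro u v ⟨h1, h2⟩ ⟨h3, h4⟩
    refine ⟨fun i => ?_, ?_⟩
    · rw [Pi.add_apply, inner_add_right, h1, h3, add_zero]
    · simp only [Pi.add_apply, Finset.sum_add_distrib, h2, h4, add_zero]
  zero_mem' := ⟨fun i => by simp, by simp⟩
  smul_mem' := by
    rintro c u ⟨h1, h2⟩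
    refine ⟨fun i => ?_, ?_⟩
    · rw [Pi.smul_apply, inner_smul_right, h1, mul_zero]
    · simp only [Pi.smul_apply, ← Finset.smul_sum, h2, smul_zero]

theorem generator_mem_tangentSub (hx : x ∈ polygonSet ℓ) (ζ : LieSU2) :
    generator x ζ ∈ tangentSub x := by
  refine ⟨fun i => inner_bracket_right _ _, ?_⟩
  simp only [generator_apply]
  have h := map_sum (bracketₗ ζ) x Finset.univ
  rw [hx.2, map_zero] at h
  exact h.symm

/-- The product of the symplectic forms of the spheres. -/
def prodForm (x u v : Fin n → LieSU2) : ℝ := ∑ i, kks (x i) (u i) (v i)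

/-- This is the momentum map identity on one sphere: contracting the form with the generator of `ζ`
gives minus the differential of `⟨ζ, ·⟩`. -/
theorem kks_bracket_left {y : LieSU2} (hy : y ≠ 0) (ζ : LieSU2) {v : LieSU2}
    (hv : inner ℝ y v = 0) : kks y (bracket ζ y) v = -inner ℝ ζ v := by
  have hn : ‖y‖ ≠ 0 := norm_ne_zero_iff.2 hy
  rw [kks, inner_bracket_rotate, bracket_bracket, inner_sub_right, inner_smul_right,
    inner_smul_right, real_inner_comm y v, hv, real_inner_self_eq_norm_sq,
    real_inner_comm ζ v]
  field_simp
  ring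

theorem kks_add_left (y u u' v : LieSU2) : kks y (u + u') v = kks y u v + kks y u' v := by
  simp only [kks, bracket_add_left, inner_add_right]; ring

theorem kks_add_right (y u v v' : LieSU2) : kks y u (v + v') = kks y u v + kks y u v' := by
  simp only [kks, bracket_add_right, inner_add_right]; ring

theorem kks_smul_right (y u v : LieSU2) (r : ℝ) : kks y u (r • v) = r * kks y u v := by
  simp only [kks, bracket_smul_right, inner_smul_right]; ring

theorem kks_swap (y u v : LieSU2) : kks y u v = -kks y v u := by
  simp only [kks]; rw [bracket_anticomm, inner_neg_right]; ring

theorem prodForm_add_left (x u u' v : Fin n → LieSU2) :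
    prodForm x (u + u') v = prodForm x u v + prodForm x u' v := by
  simp only [prodForm, Pi.add_apply, kks_add_left, Finset.sum_add_distrib]

/-- The product form as a linear functional of its second argument. -/
def prodFormₗ (x u : Fin n → LieSU2) : (Fin n → LieSU2) →ₗ[ℝ] ℝ where
  toFun := prodForm x u
  map_add' v v' := by simp only [prodForm, Pi.add_apply, kks_add_right, Finset.sum_add_distrib]
  map_smul' r v := by
    simp only [prodForm, Pi.smul_apply, kks_smul_right, ← Finset.mul_sum, RingHom.id_apply,
      smul_eq_mul]

theorem prodForm_swap (x u v : Fin n → LieSU2) : prodForm x u v = -prodForm x v u := by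
  simp only [prodForm, ← Finset.sum_neg_distrib]
  exact Finset.sum_congr rfl fun i _ => kks_swap _ _ _

theorem ne_zero_of_mem_polygonSet (hx : x ∈ polygonSet ℓ) (i : Fin n) : x i ≠ 0 := by
  intro h
  have := hx.1 i
  rw [h, norm_zero] at this
  exact absurd this (ℓ i).2.ne

/-- The momentum of the diagonal action is the sum of the sides, which does not vary along the
tangent vectors of `P_ℓ`. -/
theorem prodForm_generator (hx : x ∈ polygonSet ℓ) (ζ : LieSU2) {v : Fin n → LieSU2}
    (hv : v ∈ tangentSub x) : prodForm x (generator x ζ) v = 0 := by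
  rw [prodForm]
  simp only [generator_apply, kks_bracket_left (ne_zero_of_mem_polygonSet hx _) ζ (hv.1 _)]
  rw [Finset.sum_neg_distrib, ← inner_sum, hv.2, inner_zero_right, neg_zero]

/-- The equations of the tangent space. -/
def tangentEq (x : Fin n → LieSU2) : (Fin n → LieSU2) →ₗ[ℝ] (Fin n → ℝ) × LieSU2 :=
  (LinearMap.pi fun i => (innerₗ LieSU2 (x i)) ∘ₗ LinearMap.proj i).prod
    (∑ i, LinearMap.proj i)

theorem ker_tangentEq (x : Fin n → LieSU2) : LinearMap.ker (tangentEq x) = tangentSub x := by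
  ext u
  rw [LinearMap.mem_ker, tangentEq, LinearMap.prod_apply]
  refine Prod.mk_eq_zero.trans ?_
  refine and_congr ⟨fun h i => congrFun h i, fun h => funext h⟩ ?_
  rw [LinearMap.sum_apply]
  rfl

/-- The kernel of the restriction of the product form to the tangent space is spanned by the
generators. -/
theorem exists_generator_of_prodForm {u : Fin n → LieSU2} (hx : x ∈ polygonSet ℓ)
    (hu : u ∈ tangentSub x) (h : ∀ v ∈ tangentSub x, prodForm x u v = 0) :
    ∃ ζ, generator x ζ = u := by
  -- Lagrange multipliers: a functional that vanishes on the kernel of the equations factors through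
  -- them. The multipliers are one scalar `φ (Pi.single k 1, 0)` per sphere and one vector `τ` for
  -- the closing condition.
  have h1 : prodFormₗ x u ∈ LinearMap.range (tangentEq x).dualMap := by
    rw [LinearMap.range_dualMap_eq_dualAnnihilator_ker, Submodule.mem_dualAnnihilator]
    intro v hv
    rw [ker_tangentEq] at hv
    exact h v hv
  obtain ⟨φ, hφ⟩ := h1
  obtain ⟨g, hg⟩ : ∃ g : LieSU2 →ₗ[ℝ] ℝ, ∀ w, g w = φ (0, w) :=
    ⟨φ ∘ₗ LinearMap.inr ℝ _ _, fun _ => rfl⟩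
  obtain ⟨τ, hτ⟩ : ∃ τ : LieSU2, ∀ w, inner ℝ τ w = g w :=
    ⟨(InnerProductSpace.toDual ℝ LieSU2).symm (LinearMap.toContinuousLinearMap g), fun w => by
      simp⟩
  have hk : ∀ k w, kks (x k) (u k) w =
      inner ℝ (x k) w * φ (Pi.single k 1, 0) + inner ℝ τ w := by
    intro k w
    have h2 := LinearMap.congr_fun hφ (Pi.single k w)
    have h3 : tangentEq x (Pi.single k w) =
        inner ℝ (x k) w • (Pi.single k (1 : ℝ), (0 : LieSU2)) + (0, w) := by
      refine Prod.ext (funext fun i => ?_) ?_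
      · by_cases hi : i = k
        · subst hi
          simp [tangentEq]
        · simp [tangentEq, hi]
      · simp [tangentEq, Finset.sum_pi_single']
    rw [LinearMap.dualMap_apply, h3, map_add, map_smul, ← hg, ← hτ, smul_eq_mul] at h2
    rw [h2]
    change kks (x k) (u k) w = ∑ i, kks (x i) (u i) ((Pi.single k w : Fin n → LieSU2) i)
    rw [Finset.sum_eq_single k, Pi.single_eq_same]
    · intro i _ hi
      rw [Pi.single_eq_of_ne hi, ← zero_smul ℝ (0 : LieSU2), kks_smul_right, zero_mul]
    · simp
  refine ⟨-τ, funext fun k => ?_⟩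
  have hxk := ne_zero_of_mem_polygonSet hx k
  have hn : ‖x k‖ ≠ 0 := norm_ne_zero_iff.2 hxk
  have h4 : bracket (x k) (u k) = (-(4 * ‖x k‖ ^ 2)) • (φ (Pi.single k 1, 0) • x k + τ) := by
    refine ext_inner_right ℝ fun w => ?_
    have h5 := hk k w
    rw [kks, inner_bracket_rotate, real_inner_comm _ w, div_eq_iff (by positivity)] at h5
    rw [inner_smul_left, inner_add_left, inner_smul_left]
    simp only [conj_trivial]
    linarith
  -- Since `u k` is orthogonal to `x k`, a second bracket with `x k` recovers `u k` and removes the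
  -- radial multiplier, leaving `u k = [x k, τ]`.
  have h6 := bracket_bracket (x k) (x k) (u k)
  rw [hu.1 k, h4, bracket_smul_right, bracket_add_right, bracket_smul_right, bracket_self,
    real_inner_self_eq_norm_sq] at h6
  have h7 : (4 * ‖x k‖ ^ 2) • bracket (x k) τ = (4 * ‖x k‖ ^ 2) • u k := by
    have h8 : (4 * ‖x k‖ ^ 2) • bracket (x k) τ = -(-(4 * ‖x k‖ ^ 2) •
      (φ (Pi.single k 1, 0) • (0 : LieSU2) + bracket (x k) τ)) := by module
    rw [h8, h6]
    module
  have h9 := smul_right_injective _ (show (4 * ‖x k‖ ^ 2 : ℝ) ≠ 0 by positivity) h7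
  rw [generator_apply, ← h9, bracket_anticomm (x k), ← neg_one_smul ℝ τ, bracket_smul_left,
    neg_one_smul]

/-- The three linear conditions of a slice cut the tangent space down to a subspace of the kernel of
`sliceDeriv`, whose dimension is `2 * (n - 3)`. The upper bound is all that the dimension count
needs. -/
theorem finrank_tangentSub_le (hx : x ∈ regPolygonSet ℓ) :
    Module.finrank ℝ (tangentSub x) ≤ 2 * (n - 3) + 3 := by
  obtain ⟨i, j, e₀, e₁, e₂, hf, hs⟩ := exists_isSlice ⟨x, hx⟩
  have hker := finrank_ker_of_range (hs.range_sliceDeriv hf)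
  let f : tangentSub x →ₗ[ℝ] ℝ × ℝ × ℝ :=
    ((innerₗ LieSU2 e₁ ∘ₗ LinearMap.proj i).prod ((innerₗ LieSU2 e₂ ∘ₗ LinearMap.proj i).prod
      (innerₗ LieSU2 e₂ ∘ₗ LinearMap.proj j))) ∘ₗ (tangentSub x).subtype
  have h1 := LinearMap.finrank_range_add_finrank_ker f
  have h2 : Module.finrank ℝ (LinearMap.range f) ≤ 3 := by
    refine (Submodule.finrank_le _).trans ?_
    simp
  have h3 : Module.finrank ℝ (LinearMap.ker f) ≤
      Module.finrank ℝ (sliceDeriv i j e₁ e₂ x).ker := by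
    have h4 : ∀ u : LinearMap.ker f, sliceDeriv i j e₁ e₂ x u.1.1 = 0 := by
      rintro ⟨⟨u, hu1, hu2⟩, hu3⟩
      rw [LinearMap.mem_ker] at hu3
      refine Prod.ext (funext fun k => ?_) (Prod.ext ?_ ?_)
      · change (2 : ℝ) • inner ℝ (x k) (u k) = 0
        rw [hu1, smul_zero]
      · change (∑ k, ContinuousLinearMap.proj (R := ℝ) (φ := fun _ : Fin n => LieSU2) k) u = 0
        rw [sum_apply]
        exact hu2
      · exact hu3
    let L : LinearMap.ker f →ₗ[ℝ] (sliceDeriv i j e₁ e₂ x).ker :=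
      LinearMap.codRestrict _ ((tangentSub x).subtype ∘ₗ (LinearMap.ker f).subtype) h4
    refine LinearMap.finrank_le_finrank_of_injective (f := L) ?_
    intro u v huv
    exact Subtype.ext (Subtype.ext (Subtype.ext_iff.1 huv :))
  rw [hker] at h3
  omega

/-- A subspace of the tangent space of the dimension of `M_ℓ`, transverse to the generators. -/
theorem exists_add_generator {W : Submodule ℝ (Fin n → LieSU2)} (hx : x ∈ regPolygonSet ℓ)
    (hW : W ≤ tangentSub x) (hdim : Module.finrank ℝ W = 2 * (n - 3))
    (hd : Disjoint W (LinearMap.range (generator x))) {u : Fin n → LieSU2}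
    (hu : u ∈ tangentSub x) : ∃ w ∈ W, ∃ ζ, w + generator x ζ = u := by
  have h1 : Module.finrank ℝ (LinearMap.range (generator x)) = 3 := by
    rw [LinearMap.finrank_range_of_inj (LinearMap.ker_eq_bot.1 (ker_generator hx.2)),
      finrank_lieSU2]
  have h2 := Submodule.finrank_sup_add_finrank_inf_eq W (LinearMap.range (generator x))
  rw [hd.eq_bot, finrank_bot, add_zero, hdim, h1] at h2
  have h3 : W ⊔ LinearMap.range (generator x) ≤ tangentSub x := by
    refine sup_le hW ?_
    rintro _ ⟨ζ, rfl⟩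
    exact generator_mem_tangentSub hx.1 ζ
  -- The generators form a space of dimension three, so the direct sum already reaches the bound for
  -- the tangent space.
  have h4 : W ⊔ LinearMap.range (generator x) = tangentSub x :=
    Submodule.eq_of_le_of_finrank_le h3 (by rw [h2]; exact finrank_tangentSub_le hx)
  rw [← h4] at hu
  obtain ⟨w, hw, _, ⟨ζ, rfl⟩, h5⟩ := Submodule.mem_sup.1 hu
  exact ⟨w, hw, ζ, h5⟩

end

section
/-! ### Local lifts and velocities -/

variable {n : ℕ} {S : Finset (Fin n)} {ℓ : Fin n → Set.Ioi (0 : ℝ)}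

theorem contDiffAt_chartLift (p : RegularModuli ℓ) :
    ContDiffAt ℝ ∞ (chartLift p) (chartAt (ModelSpace n) p p) := by
  obtain ⟨U, hU, hpU, hσ, -⟩ := (exists_chartLift p).choose_spec
  exact hσ.contDiffAt (hU.mem_nhds hpU)

theorem eventually_chartLift (p : RegularModuli ℓ) :
    ∀ᶠ w in 𝓝 (chartAt (ModelSpace n) p p), w ∈ (chartAt (ModelSpace n) p).target ∧
      ∃ h : chartLift p w ∈ regPolygonSet ℓ,
        proj ℓ ⟨chartLift p w, h⟩ = (chartAt (ModelSpace n) p).symm w := by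
  obtain ⟨U, hU, hpU, -, h⟩ := (exists_chartLift p).choose_spec
  exact Filter.mem_of_superset (hU.mem_nhds hpU) h

/-- The lift of `p` given by the chosen lift of the chart at `p`. -/
def basePoint (p : RegularModuli ℓ) : Fin n → LieSU2 :=
  chartLift p (chartAt (ModelSpace n) p p)

/-- A smooth local section of `proj` around `p`. -/
def localLift (p q : RegularModuli ℓ) : Fin n → LieSU2 := chartLift p (chartAt (ModelSpace n) p q)

/-- The derivative of the local section at `p`. -/
def liftDeriv (p : RegularModuli ℓ) : ModelSpace n →L[ℝ] (Fin n → LieSU2) :=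
  fderiv ℝ (chartLift p) (chartAt (ModelSpace n) p p)

theorem eventually_localLift (p : RegularModuli ℓ) :
    ∀ᶠ q in 𝓝 p, ∃ h : localLift p q ∈ regPolygonSet ℓ, proj ℓ ⟨localLift p q, h⟩ = q := by
  have hs := (chartAt (ModelSpace n) p).open_source.mem_nhds (mem_chart_source (ModelSpace n) p)
  have hc := (chartAt (ModelSpace n) p).continuousAt (mem_chart_source (ModelSpace n) p)
  filter_upwards [hs, hc.eventually (eventually_chartLift p)] with q hq ⟨_, h, h'⟩
  exact ⟨h, h'.trans ((chartAt (ModelSpace n) p).left_inv hq)⟩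

theorem basePoint_mem (p : RegularModuli ℓ) : basePoint p ∈ regPolygonSet ℓ :=
  (eventually_localLift p).self_of_nhds.1

theorem proj_basePoint (p : RegularModuli ℓ) : proj ℓ ⟨basePoint p, basePoint_mem p⟩ = p :=
  (eventually_localLift p).self_of_nhds.2

theorem contMDiffAt_localLift (p : RegularModuli ℓ) :
    ContMDiffAt 𝓘(ℝ, ModelSpace n) 𝓘(ℝ, Fin n → LieSU2) ∞ (localLift p) p :=
  (contDiffAt_chartLift p).contMDiffAt.comp p
    (contMDiffAt_extChartAt (I := 𝓘(ℝ, ModelSpace n)) (x := p))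

theorem hasMFDerivAt_localLift (p : RegularModuli ℓ) :
    HasMFDerivAt 𝓘(ℝ, ModelSpace n) 𝓘(ℝ, Fin n → LieSU2) (localLift p) p (liftDeriv p) := by
  refine ⟨(contMDiffAt_localLift p).continuousAt, ?_⟩
  have h1 : HasFDerivAt (chartLift p) (liftDeriv p) (chartAt (ModelSpace n) p p) :=
    ((contDiffAt_chartLift p).differentiableAt (by simp)).hasFDerivAt
  refine (h1.congr_of_eventuallyEq ?_).hasFDerivWithinAt
  filter_upwards [(chartAt (ModelSpace n) p).open_target.mem_nhds
    ((chartAt (ModelSpace n) p).map_source (mem_chart_source (ModelSpace n) p))] with w hw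
  change chartLift p (chartAt (ModelSpace n) p ((chartAt (ModelSpace n) p).symm w)) = chartLift p w
  rw [(chartAt (ModelSpace n) p).right_inv hw]

/-- Smooth local extensions of `proj` to the ambient vector space. -/
theorem exists_localProj {x : Fin n → LieSU2} (hx : x ∈ regPolygonSet ℓ) :
    ∃ Q : (Fin n → LieSU2) → RegularModuli ℓ,
      ContMDiffAt 𝓘(ℝ, Fin n → LieSU2) 𝓘(ℝ, ModelSpace n) ∞ Q x ∧
      ∀ᶠ y in 𝓝 x, ∀ hy : y ∈ regPolygonSet ℓ, Q y = proj ℓ ⟨y, hy⟩ := by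
  obtain ⟨p, hp⟩ : ∃ p, p = proj ℓ ⟨x, hx⟩ := ⟨_, rfl⟩
  have hps := mem_chart_source (ModelSpace n) p
  obtain ⟨U, hU, hxU, F, hF, h⟩ := (isQuotientChart_chartAt p).smooth ⟨x, hx⟩ (hp ▸ hps)
  -- `F` is the smooth ambient extension of the chart composed with `proj`, provided by the
  -- definition of quotient charts.
  refine ⟨fun y => (chartAt (ModelSpace n) p).symm (F y), ?_, ?_⟩
  · have h1 : F x = chartAt (ModelSpace n) p p := by
      rw [(h ⟨x, hx⟩ hxU).2, ← hp]
    have h2 : ContMDiffAt 𝓘(ℝ, ModelSpace n) 𝓘(ℝ, ModelSpace n) ∞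
        (chartAt (ModelSpace n) p).symm (F x) := by
      rw [h1]
      exact contMDiffAt_symm_of_mem_maximalAtlas (IsManifold.chart_mem_maximalAtlas p)
        ((chartAt (ModelSpace n) p).map_source hps)
    exact h2.comp x (hF.contDiffAt (hU.mem_nhds hxU)).contMDiffAt
  · filter_upwards [hU.mem_nhds hxU] with y hy hy'
    rw [(h ⟨y, hy'⟩ hy).2]
    exact (chartAt (ModelSpace n) p).left_inv (h ⟨y, hy'⟩ hy).1

/-! ### Velocities of curves and non-degeneracy of the reduced form -/

/-- The curve `γ` has the velocity `X` at the time `s`. -/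
def HasVelocity (γ : ℝ → RegularModuli ℓ) (s : ℝ) (X : ModelSpace n) : Prop :=
  HasMFDerivAt 𝓘(ℝ, ℝ) 𝓘(ℝ, ModelSpace n) γ s
    ((1 : ℝ →L[ℝ] ℝ).smulRight (X : TangentSpace 𝓘(ℝ, ModelSpace n) (γ s)))

theorem HasVelocity.hasDerivAt_localLift {γ : ℝ → RegularModuli ℓ} {s : ℝ} {X : ModelSpace n}
    (h : HasVelocity γ s X) :
    HasDerivAt (fun r => localLift (γ s) (γ r)) (liftDeriv (γ s) X) s := by
  have h1 := (hasMFDerivAt_localLift (γ s)).comp s h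
  have h2 : HasFDerivAt (fun r => localLift (γ s) (γ r))
    ((liftDeriv (γ s)).comp ((1 : ℝ →L[ℝ] ℝ).smulRight X)) s := h1.hasFDerivAt
  have h3 := h2.hasDerivAt
  simpa using h3

theorem HasVelocity.continuousAt {γ : ℝ → RegularModuli ℓ} {s : ℝ} {X : ModelSpace n}
    (h : HasVelocity γ s X) : ContinuousAt γ s := HasMFDerivAt.continuousAt h

/-- As `proj` is defined on a subset of the ambient space only, the velocity is the image of `c'` by
the derivative of a smooth local extension `Q` of `proj`. -/
theorem exists_hasVelocity {γ : ℝ → RegularModuli ℓ} {s : ℝ} {c : ℝ → (Fin n → LieSU2)}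
    {c' : Fin n → LieSU2} (hc : HasDerivAt c c' s)
    (h : ∀ᶠ r in 𝓝 s, ∃ h : c r ∈ regPolygonSet ℓ, proj ℓ ⟨c r, h⟩ = γ r) :
    ∃ X, HasVelocity γ s X := by
  obtain ⟨hs, hs'⟩ := h.self_of_nhds
  obtain ⟨Q, hQ, hQp⟩ := exists_localProj hs
  have h1 := (hQ.mdifferentiableAt (by simp)).hasMFDerivAt.comp s hc.hasFDerivAt.hasMFDerivAt
  have h2 : HasMFDerivAt 𝓘(ℝ, ℝ) 𝓘(ℝ, ModelSpace n) γ s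
      ((mfderiv 𝓘(ℝ, Fin n → LieSU2) 𝓘(ℝ, ModelSpace n) Q (c s)).comp
        (ContinuousLinearMap.toSpanSingleton ℝ c')) := by
    have h4 := h1.congr_of_eventuallyEq (f₁ := γ) (by
      filter_upwards [h, hc.continuousAt.eventually hQp] with r ⟨hr, hr'⟩ hr''
      rw [Function.comp_apply, hr'' hr, hr'])
    exact h4
  obtain ⟨X, hX⟩ : ∃ X : ModelSpace n,
      X = mfderiv 𝓘(ℝ, Fin n → LieSU2) 𝓘(ℝ, ModelSpace n) Q (c s) c' := ⟨_, rfl⟩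
  refine ⟨X, h2.congr_mfderiv ?_⟩
  ext
  rw [hX]
  change mfderiv 𝓘(ℝ, Fin n → LieSU2) 𝓘(ℝ, ModelSpace n) Q (c s) ((1 : ℝ) • c') = _
  rw [one_smul]
  exact (one_smul ℝ _).symm

theorem HasVelocity.unique {γ : ℝ → RegularModuli ℓ} {s : ℝ} {X Y : ModelSpace n}
    (hX : HasVelocity γ s X) (hY : HasVelocity γ s Y) : X = Y := by
  have h := hasMFDerivAt_unique hX hY
  have h1 := congrArg (fun L : ℝ →L[ℝ] ModelSpace n => L 1) h
  have h2 : (1 : ℝ) • X = (1 : ℝ) • Y := h1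
  rwa [one_smul, one_smul] at h2

/-- Velocities of two lifts of the same curve differ by a generator. -/
theorem exists_generator_of_lifts {c₁ c₂ : ℝ → (Fin n → LieSU2)} {u₁ u₂ : Fin n → LieSU2} {s : ℝ}
    (h₁ : HasDerivAt c₁ u₁ s) (h₂ : HasDerivAt c₂ u₂ s) (h : c₁ s = c₂ s)
    (hc : ¬ IsCollinear (c₁ s)) (hg : ∀ᶠ r in 𝓝 s, invariants (c₁ r) = invariants (c₂ r)) :
    ∃ ζ, generator (c₁ s) ζ = u₁ - u₂ := by
  apply exists_generator_of_fderiv_invariants hc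
  have hd : ∀ x, HasFDerivAt (invariants (n := n)) (fderiv ℝ invariants x) x := fun x =>
    (contDiff_invariants.differentiable one_ne_zero x).hasFDerivAt
  have h3 := (hd (c₁ s)).comp_hasDerivAt s h₁
  have h4 := (hd (c₂ s)).comp_hasDerivAt s h₂
  rw [map_sub, sub_eq_zero]
  rw [← h] at h4
  exact h3.unique (h4.congr_of_eventuallyEq hg)

theorem invariants_eq_of_proj_eq {x y : Fin n → LieSU2} {hx : x ∈ regPolygonSet ℓ}
    {hy : y ∈ regPolygonSet ℓ} (h : proj ℓ ⟨x, hx⟩ = proj ℓ ⟨y, hy⟩) :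
    invariants x = invariants y := by
  obtain ⟨g, hg⟩ := proj_eq_iff.1 h
  simp only at hg
  rw [← hg, invariants_smul]

theorem proj_eq_of_invariants_eq {x y : Fin n → LieSU2} (hx : x ∈ regPolygonSet ℓ)
    (hy : y ∈ regPolygonSet ℓ) (h : invariants x = invariants y) :
    proj ℓ ⟨x, hx⟩ = proj ℓ ⟨y, hy⟩ := by
  obtain ⟨g, hg⟩ := exists_smul_eq_of_invariants hx.2 h
  have h' : proj ℓ ⟨y, hy⟩ = proj ℓ ⟨x, hx⟩ := proj_eq_iff.2 ⟨g, hg⟩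
  exact h'.symm

theorem mem_tangentSub_of_hasDerivAt {c : ℝ → (Fin n → LieSU2)} {u : Fin n → LieSU2} {s : ℝ}
    (hc : HasDerivAt c u s) (h : ∀ᶠ r in 𝓝 s, c r ∈ polygonSet ℓ) : u ∈ tangentSub (c s) := by
  have hk : ∀ k, HasDerivAt (fun r => c r k) (u k) s := fun k => hasDerivAt_pi.1 hc k
  constructor
  · intro i
    have h1 := (hk i).inner ℝ (hk i)
    have h2 : HasDerivAt (fun r => inner ℝ (c r i) (c r i)) 0 s := by
      have h3 : (fun r => inner ℝ (c r i) (c r i)) =ᶠ[𝓝 s] fun _ => (ℓ i : ℝ) ^ 2 := by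
        filter_upwards [h] with r hr
        rw [real_inner_self_eq_norm_sq, hr.1]
      exact (hasDerivAt_const s ((ℓ i : ℝ) ^ 2)).congr_of_eventuallyEq h3
    have h3 := h1.unique h2
    rw [real_inner_comm (c s i) (u i)] at h3
    linarith
  · have h1 : HasDerivAt (fun r => ∑ i, c r i) (∑ i, u i) s := HasDerivAt.fun_sum fun i _ => hk i
    refine h1.unique ((hasDerivAt_const s (0 : LieSU2)).congr_of_eventuallyEq ?_)
    filter_upwards [h] with r hr
    exact hr.2

theorem hasDerivAt_chartLift (p : RegularModuli ℓ) (v : ModelSpace n) :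
    HasDerivAt (fun r : ℝ => chartLift p (chartAt (ModelSpace n) p p + r • v))
      (liftDeriv p v) 0 := by
  have h1 : HasDerivAt (fun r : ℝ => chartAt (ModelSpace n) p p + r • v) v 0 := by
    simpa using ((hasDerivAt_id (0 : ℝ)).smul_const v).const_add (chartAt (ModelSpace n) p p)
  have h2 : HasFDerivAt (chartLift p) (liftDeriv p)
      (chartAt (ModelSpace n) p p + (0 : ℝ) • v) := by
    rw [zero_smul, add_zero]
    exact ((contDiffAt_chartLift p).differentiableAt (by simp)).hasFDerivAt
  exact h2.comp_hasDerivAt (0 : ℝ) h1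

theorem liftDeriv_mem_tangentSub (p : RegularModuli ℓ) (v : ModelSpace n) :
    liftDeriv p v ∈ tangentSub (basePoint p) := by
  have h := mem_tangentSub_of_hasDerivAt (ℓ := ℓ) (hasDerivAt_chartLift p v) (by
    have hc : Filter.Tendsto (fun r : ℝ => chartAt (ModelSpace n) p p + r • v) (𝓝 0)
        (𝓝 (chartAt (ModelSpace n) p p)) := by
      have : Continuous (fun r : ℝ => chartAt (ModelSpace n) p p + r • v) := by fun_prop
      simpa using this.tendsto 0
    filter_upwards [hc.eventually (eventually_chartLift p)] with r ⟨_, hr, _⟩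
    exact hr.1)
  rwa [zero_smul, add_zero] at h

/-- Let `Q` extend `proj` locally. Its derivative is a left inverse of `liftDeriv p`, because
`localLift p` is a section, and it kills the generators, because `Q` is constant on the orbit near
the base point. So the section is transverse to the orbit. -/
theorem eq_zero_of_liftDeriv_eq_generator {p : RegularModuli ℓ} {v : ModelSpace n} {ζ : LieSU2}
    (h : liftDeriv p v = generator (basePoint p) ζ) : v = 0 := by
  obtain ⟨Q, hQ, hQp⟩ := exists_localProj (basePoint_mem p)
  have hm := (hQ.mdifferentiableAt (by simp)).hasMFDerivAt
  have h1 : HasMFDerivAt 𝓘(ℝ, ModelSpace n) 𝓘(ℝ, ModelSpace n) id p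
      ((mfderiv 𝓘(ℝ, Fin n → LieSU2) 𝓘(ℝ, ModelSpace n) Q (basePoint p)).comp (liftDeriv p)) := by
    have h2 := HasMFDerivAt.comp p (f := localLift p) (g := Q) hm (hasMFDerivAt_localLift p)
    refine h2.congr_of_eventuallyEq ?_
    filter_upwards [eventually_localLift p,
      (contMDiffAt_localLift p).continuousAt.eventually hQp] with q ⟨hq, hq'⟩ hq''
    rw [Function.comp_apply, hq'' hq, hq']
    rfl
  have h2 := hasMFDerivAt_unique h1 (hasMFDerivAt_id p)
  have h3 : mfderiv 𝓘(ℝ, Fin n → LieSU2) 𝓘(ℝ, ModelSpace n) Q (basePoint p) (liftDeriv p v) = v :=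
    congrArg (fun L : ModelSpace n →L[ℝ] ModelSpace n => L v) h2
  obtain ⟨g, hg0, hg⟩ := exists_hasDerivAt_smul (basePoint p) ζ
  have hm' : HasMFDerivAt 𝓘(ℝ, Fin n → LieSU2) 𝓘(ℝ, ModelSpace n) Q (g 0 • basePoint p)
      (mfderiv 𝓘(ℝ, Fin n → LieSU2) 𝓘(ℝ, ModelSpace n) Q (basePoint p)) := by
    rw [hg0]
    exact hm
  have h4 := HasMFDerivAt.comp (0 : ℝ) (f := fun s => g s • basePoint p) (g := Q) hm'
    hg.hasFDerivAt.hasMFDerivAt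
  have h5 : HasMFDerivAt 𝓘(ℝ, ℝ) 𝓘(ℝ, ModelSpace n) (fun _ : ℝ => Q (g 0 • basePoint p)) 0
      ((mfderiv 𝓘(ℝ, Fin n → LieSU2) 𝓘(ℝ, ModelSpace n) Q (basePoint p)).comp
        (ContinuousLinearMap.toSpanSingleton ℝ (generator (basePoint p) ζ))) := by
    refine h4.congr_of_eventuallyEq ?_
    have hc := hg.continuousAt
    unfold ContinuousAt at hc
    simp only [hg0] at hc
    filter_upwards [hc.eventually hQp] with s hs
    have hr : g s • basePoint p ∈ regPolygonSet ℓ :=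
      ⟨smul_mem_polygonSet _ (basePoint_mem p).1, fun hcol => (basePoint_mem p).2 (by
        have := hcol.smul (g s)⁻¹
        rwa [inv_smul_smul] at this)⟩
    rw [Function.comp_apply, hs hr, hg0, hQp.self_of_nhds (basePoint_mem p)]
    exact proj_eq_iff.2 ⟨(g s)⁻¹, inv_smul_smul _ _⟩
  have h6 := hasMFDerivAt_unique h5 (hasMFDerivAt_const _ (0 : ℝ))
  have h7 : mfderiv 𝓘(ℝ, Fin n → LieSU2) 𝓘(ℝ, ModelSpace n) Q (basePoint p)
      ((1 : ℝ) • generator (basePoint p) ζ) = 0 :=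
    congrArg (fun L : ℝ →L[ℝ] ModelSpace n => L 1) h6
  rw [one_smul, ← h] at h7
  exact h3.symm.trans h7

/-- The reduced form is non-degenerate. -/
theorem eq_of_reducedForm_eq {p : RegularModuli ℓ} {X Y : ModelSpace n}
    (h : ∀ v : ModelSpace n, reducedForm p X v = reducedForm p Y v) : X = Y := by
  have hr : ∀ X v : ModelSpace n,
      reducedForm p X v = prodForm (basePoint p) (liftDeriv p X) (liftDeriv p v) :=
    fun _ _ => rfl
  have h0 : ∀ v, prodForm (basePoint p) (liftDeriv p (X - Y)) (liftDeriv p v) = 0 := by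
    intro v
    have h1 := h v
    rw [hr, hr, show X = (X - Y) + Y by abel, map_add, prodForm_add_left] at h1
    linarith
  have hinj : LinearMap.ker (liftDeriv p : ModelSpace n →ₗ[ℝ] (Fin n → LieSU2)) = ⊥ := by
    rw [LinearMap.ker_eq_bot']
    intro v hv
    exact eq_zero_of_liftDeriv_eq_generator (ζ := 0) (by rw [map_zero]; exact hv)
  obtain ⟨W, hW⟩ : ∃ W, W = LinearMap.range (liftDeriv p : ModelSpace n →ₗ[ℝ] (Fin n → LieSU2)) :=
    ⟨_, rfl⟩
  have hWT : W ≤ tangentSub (basePoint p) := by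
    rw [hW]
    rintro _ ⟨v, rfl⟩
    exact liftDeriv_mem_tangentSub p v
  have hdim : Module.finrank ℝ W = 2 * (n - 3) := by
    rw [hW, LinearMap.finrank_range_of_inj (LinearMap.ker_eq_bot.1 hinj)]
    simp
  have hd : Disjoint W (LinearMap.range (generator (basePoint p))) := by
    rw [Submodule.disjoint_def, hW]
    rintro _ ⟨v, rfl⟩ ⟨ζ, hζ⟩
    have := eq_zero_of_liftDeriv_eq_generator (v := v) hζ.symm
    rw [this, map_zero]
  -- Every tangent vector of `P_ℓ` is a lifted vector plus a generator. The hypothesis handles the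
  -- first term and the momentum identity the second, so the lift of `X - Y` is in the kernel of the
  -- product form.
  obtain ⟨ζ, hζ⟩ := exists_generator_of_prodForm (basePoint_mem p).1
    (liftDeriv_mem_tangentSub p (X - Y)) (by
      intro u hu
      obtain ⟨w, hw, ζ, rfl⟩ := exists_add_generator (basePoint_mem p) hWT hdim hd hu
      rw [hW] at hw
      obtain ⟨v, rfl⟩ := hw
      change prodFormₗ _ _ _ = 0
      rw [map_add]
      change prodForm _ _ (liftDeriv p v) + prodForm _ _ _ = 0
      rw [h0, prodForm_swap, prodForm_generator (basePoint_mem p).1 ζ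
        (liftDeriv_mem_tangentSub p _)]
      simp)
  exact sub_eq_zero.1 (eq_zero_of_liftDeriv_eq_generator hζ.symm)

end

section
/-! ### Bending flows of the moduli space -/

variable {n : ℕ} {S S' : Finset (Fin n)} {ℓ : Fin n → Set.Ioi (0 : ℝ)} {x : Fin n → LieSU2}

theorem contDiff_partSum (S : Finset (Fin n)) : ContDiff ℝ ∞ (partSum S) :=
  ContDiff.sum fun k _ => contDiff_apply ℝ LieSU2 k

theorem contDiffAt_axis (h : partSum S x ≠ 0) : ContDiffAt ℝ ∞ (axis S) x :=
  (((contDiff_partSum S).contDiffAt.norm ℝ h).inv (norm_ne_zero_iff.2 h)).smul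
    (contDiff_partSum S).contDiffAt

theorem contDiffAt_rot {E : Type*} [NormedAddCommGroup E] [NormedSpace ℝ E] {m w : E → LieSU2}
    {t : E → ℝ} {y : E} (hm : ContDiffAt ℝ ∞ m y) (ht : ContDiffAt ℝ ∞ t y)
    (hw : ContDiffAt ℝ ∞ w y) : ContDiffAt ℝ ∞ (fun q => rot (m q) (t q) (w q)) y := by
  have hc := Real.contDiff_cos.contDiffAt.comp y ht
  have hs := Real.contDiff_sin.contDiffAt.comp y ht
  have hb : ContDiffAt ℝ ∞ (fun q => bracket (m q) (w q)) y :=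
    bracketL.isBoundedBilinearMap.contDiff.contDiffAt.comp y (hm.prodMk hw)
  exact ((hc.smul hw).add ((hs.div_const 2).smul hb)).add
    (((contDiffAt_const.sub hc).mul (hm.inner ℝ hw)).smul hm)

theorem contDiffAt_bend (h : partSum S x ≠ 0) (t : ℝ) :
    ContDiffAt ℝ ∞ (fun q : ℝ × (Fin n → LieSU2) => bend S q.1 q.2) (t, x) := by
  refine contDiffAt_pi.2 fun i => ?_
  have hi : ContDiffAt ℝ ∞ (fun q : ℝ × (Fin n → LieSU2) => q.2 i) (t, x) :=
    ((contDiff_apply ℝ LieSU2 i).comp contDiff_snd).contDiffAt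
  by_cases hiS : i ∈ S
  · simp only [bend_of_mem hiS]
    exact contDiffAt_rot ((contDiffAt_axis h).comp (t, x) contDiffAt_snd) contDiffAt_fst hi
  · simp only [bend_of_notMem hiS]
    exact hi

/-- The velocity of a bending. -/
def bendVel (S : Finset (Fin n)) (x : Fin n → LieSU2) : Fin n → LieSU2 :=
  fun i => if i ∈ S then bracket ((1 / 2 : ℝ) • axis S x) (x i) else 0

theorem hasDerivAt_bend (S : Finset (Fin n)) (x : Fin n → LieSU2) :
    HasDerivAt (fun t => bend S t x) (bendVel S x) 0 := by
  refine hasDerivAt_pi.2 fun i => ?_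
  by_cases hi : i ∈ S
  · simp only [bend_of_mem hi, bendVel, if_pos hi]
    exact hasDerivAt_rot _ _
  · simp only [bend_of_notMem hi, bendVel, if_neg hi]
    exact hasDerivAt_const _ _

/-- Hamilton's equation before reduction: the right-hand side is minus the derivative of `½ ‖partSum
S ·‖` along `v`, obtained by adding the momentum identities of the spheres with index in `S`. -/
theorem prodForm_bendVel (hx : x ∈ polygonSet ℓ) {v : Fin n → LieSU2} (hv : v ∈ tangentSub x) :
    prodForm x (bendVel S x) v = -((1 / 2) * inner ℝ (axis S x) (partSum S v)) := by
  have h : ∀ i, kks (x i) (bendVel S x i) (v i) =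
      if i ∈ S then -((1 / 2) * inner ℝ (axis S x) (v i)) else 0 := by
    intro i
    by_cases hi : i ∈ S
    · rw [bendVel, if_pos hi, if_pos hi, kks_bracket_left (ne_zero_of_mem_polygonSet hx i) _
        (hv.1 i), inner_smul_left]
      simp
    · rw [bendVel, if_neg hi, if_neg hi, kks_swap, ← zero_smul ℝ (0 : LieSU2), kks_smul_right]
      simp
  rw [prodForm, Finset.sum_congr rfl fun i _ => h i, Finset.sum_ite_mem, Finset.univ_inter,
    Finset.sum_neg_distrib, ← Finset.mul_sum, ← inner_sum]
  rfl

/-- The length of a partial sum of sides, as a function on the moduli space. -/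
def modLen (S : Finset (Fin n)) (p : RegularModuli ℓ) : ℝ := ‖partSum S (basePoint p)‖

theorem modLen_proj (S : Finset (Fin n)) (hx : x ∈ regPolygonSet ℓ) :
    modLen S (proj ℓ ⟨x, hx⟩) = ‖partSum S x‖ := by
  obtain ⟨g, hg⟩ := proj_eq_iff.1 (proj_basePoint (proj ℓ ⟨x, hx⟩))
  simp only at hg
  rw [modLen, ← hg, partSum_smul, norm_smul_SU2]

theorem modLen_ne_zero_iff {p : RegularModuli ℓ} :
    modLen S p ≠ 0 ↔ partSum S (basePoint p) ≠ 0 := norm_ne_zero_iff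

theorem modLen_proj_ne_zero_iff (hx : x ∈ regPolygonSet ℓ) :
    modLen S (proj ℓ ⟨x, hx⟩) ≠ 0 ↔ partSum S x ≠ 0 := by
  rw [modLen_proj, norm_ne_zero_iff]

/-- Bending, on the moduli space. -/
def modBend (S : Finset (Fin n)) (t : ℝ) (p : RegularModuli ℓ) : RegularModuli ℓ :=
  open Classical in
  if h : partSum S (basePoint p) ≠ 0 then
    proj ℓ ⟨bend S t (basePoint p), bend_mem_reg (basePoint_mem p) h t⟩
  -- A default value where the axis is undefined; it is never taken where `modLen S` is non-zero.
  else p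

theorem modBend_proj (hx : x ∈ regPolygonSet ℓ) (h : partSum S x ≠ 0) (t : ℝ) :
    modBend S t (proj ℓ ⟨x, hx⟩) = proj ℓ ⟨bend S t x, bend_mem_reg hx h t⟩ := by
  have h' := modLen_ne_zero_iff.1 ((modLen_proj_ne_zero_iff hx).2 h)
  rw [modBend, dif_pos h']
  obtain ⟨g, hg⟩ := proj_eq_iff.1 (proj_basePoint (proj ℓ ⟨x, hx⟩))
  refine proj_eq_iff.2 ⟨g, ?_⟩
  simp only at hg ⊢
  rw [← hg, bend_smul]

theorem modBend_eq {p : RegularModuli ℓ} (h : modLen S p ≠ 0) (t : ℝ) :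
    modBend S t p = proj ℓ ⟨bend S t (basePoint p), bend_mem_reg (basePoint_mem p)
      (modLen_ne_zero_iff.1 h) t⟩ := dif_pos (modLen_ne_zero_iff.1 h)

theorem modLen_modBend {p : RegularModuli ℓ} (h : modLen S p ≠ 0) (hS : Laminar S S') (t : ℝ) :
    modLen S' (modBend S t p) = modLen S' p := by
  rw [modBend_eq h, modLen_proj, norm_partSum_bend (basePoint_mem p).1 (modLen_ne_zero_iff.1 h) hS,
    modLen]

theorem Laminar.symm (h : Laminar S S') : Laminar S' S := by
  rcases h with h | h | h | h
  · exact Or.inr (Or.inl h)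
  · exact Or.inl h
  · exact Or.inr (Or.inr (Or.inl h.symm))
  · exact Or.inr (Or.inr (Or.inr (compl_le_iff_compl_le.1 h)))

theorem modBend_zero (S : Finset (Fin n)) (p : RegularModuli ℓ) : modBend S 0 p = p := by
  by_cases h : modLen S p ≠ 0
  · rw [modBend_eq h]
    simp only [bend_zero, proj_basePoint]
  · exact dif_neg (fun h' => h (modLen_ne_zero_iff.2 h'))

theorem modBend_modBend {p : RegularModuli ℓ} (h : modLen S p ≠ 0) (s t : ℝ) :
    modBend S s (modBend S t p) = modBend S (s + t) p := by
  have h' := modLen_ne_zero_iff.1 h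
  rw [modBend_eq h, modBend_eq h, modBend_proj _ (by rwa [partSum_bend_self h'])]
  simp only [bend_bend h']

theorem modBend_add_two_pi (S : Finset (Fin n)) (t : ℝ) (p : RegularModuli ℓ) :
    modBend S (t + 2 * Real.pi) p = modBend S t p := by
  simp only [modBend, bend_add_two_pi]

/-- Bendings of polygons commute only up to a global rotation, which disappears in the quotient. -/
theorem modBend_comm {p : RegularModuli ℓ} (h : modLen S p ≠ 0) (h' : modLen S' p ≠ 0)
    (hS : Laminar S S') (s t : ℝ) :
    modBend S s (modBend S' t p) = modBend S' t (modBend S s p) := by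
  have hx := (basePoint_mem p).1
  have h1 := modLen_ne_zero_iff.1 h
  have h1' := modLen_ne_zero_iff.1 h'
  have h2 : partSum S (bend S' t (basePoint p)) ≠ 0 := by
    rwa [← norm_ne_zero_iff, norm_partSum_bend hx h1' hS.symm]
  have h2' : partSum S' (bend S s (basePoint p)) ≠ 0 := by
    rwa [← norm_ne_zero_iff, norm_partSum_bend hx h1 hS]
  rw [modBend_eq h, modBend_eq h', modBend_proj _ h2, modBend_proj _ h2']
  exact proj_eq_iff.2 (exists_smul_bend_comm hx h1 h1' hS s t)

/-- Consequently the flow of an edge does not depend on its orientation, and either side of the edge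
may be bent. -/
theorem modBend_compl_proj (hx : x ∈ regPolygonSet ℓ) (h : partSum S x ≠ 0) (t : ℝ) :
    modBend Sᶜ t (proj ℓ ⟨x, hx⟩) = modBend S t (proj ℓ ⟨x, hx⟩) := by
  have h' : partSum Sᶜ x ≠ 0 := by rwa [partSum_compl hx.1, neg_ne_zero]
  rw [modBend_proj hx h, modBend_proj hx h', eq_comm]
  exact proj_eq_iff.2 ⟨_, smul_bend_compl hx.1 h t⟩

theorem exists_velocity_modBend {p : RegularModuli ℓ} (h : modLen S p ≠ 0) :
    ∃ X, HasVelocity (fun t => modBend S t p) 0 X :=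
  exists_hasVelocity (hasDerivAt_bend S (basePoint p)) (Filter.Eventually.of_forall fun t =>
    ⟨bend_mem_reg (basePoint_mem p) (modLen_ne_zero_iff.1 h) t, (modBend_eq h t).symm⟩)

/-- The same curve of the quotient has two lifts, the explicit bending and the one in the section
`localLift p`; by infinitesimal rigidity their velocities differ by a generator. -/
theorem liftDeriv_velocity {p : RegularModuli ℓ} {X : ModelSpace n} (h : modLen S p ≠ 0)
    (hX : HasVelocity (fun t => modBend S t p) 0 X) :
    ∃ ζ, liftDeriv p X = bendVel S (basePoint p) + generator (basePoint p) ζ := by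
  have h0 : modBend S 0 p = p := modBend_zero S p
  have h1 := hX.hasDerivAt_localLift
  simp only [h0] at h1
  have hc := hX.continuousAt
  unfold ContinuousAt at hc
  simp only [h0] at hc
  have e0 : localLift p (modBend S 0 p) = basePoint p := by rw [h0]; rfl
  obtain ⟨ζ, hζ⟩ := exists_generator_of_lifts h1 (hasDerivAt_bend S (basePoint p))
    (by rw [e0, bend_zero]) (by rw [e0]; exact (basePoint_mem p).2) (by
      filter_upwards [hc.eventually (eventually_localLift p)] with t ⟨ht, ht'⟩
      refine invariants_eq_of_proj_eq (hx := ht)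
        (hy := bend_mem_reg (basePoint_mem p) (modLen_ne_zero_iff.1 h) t) ?_
      rw [ht', modBend_eq h])
  rw [e0] at hζ
  exact ⟨ζ, by rw [hζ]; abel⟩

theorem hasDerivAt_norm_curve {c : ℝ → LieSU2} {c' : LieSU2} {s : ℝ} (hc : HasDerivAt c c' s)
    (h : c s ≠ 0) : HasDerivAt (fun r => ‖c r‖) (inner ℝ (‖c s‖⁻¹ • c s) c') s := by
  have hn : ‖c s‖ ≠ 0 := norm_ne_zero_iff.2 h
  have h1 := (hc.norm_sq).sqrt (pow_ne_zero 2 hn)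
  have h2 : (fun r => Real.sqrt (‖c r‖ ^ 2)) = fun r => ‖c r‖ :=
    funext fun r => Real.sqrt_sq (norm_nonneg _)
  rw [h2, Real.sqrt_sq (norm_nonneg _)] at h1
  refine h1.congr_deriv ?_
  rw [inner_smul_left]
  simp only [conj_trivial]
  field_simp

/-- The velocity of a bending is the Hamiltonian vector of half the length of the axis. -/
theorem isHamiltonianVector_modBend {p : RegularModuli ℓ} (h : modLen S p ≠ 0) {X : ModelSpace n}
    (hX : HasVelocity (fun t => modBend S t p) 0 X) :
    IsHamiltonianVector (fun q => (1 / 2) * modLen S q) p X := by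
  have hS := modLen_ne_zero_iff.1 h
  obtain ⟨F, hF⟩ : ∃ F : (Fin n → LieSU2) → ℝ, F = fun y => (1 / 2) * ‖partSum S y‖ := ⟨_, rfl⟩
  have hFd : DifferentiableAt ℝ F (basePoint p) := by
    rw [hF]
    exact ((((contDiff_partSum S).contDiffAt.norm ℝ hS).differentiableAt (by simp))).const_mul _
  have hFv : ∀ v, fderiv ℝ F (basePoint p) v =
      (1 / 2) * inner ℝ (axis S (basePoint p)) (partSum S v) := by
    intro v
    have h1 : HasDerivAt (fun s : ℝ => basePoint p + s • v) v 0 := by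
      simpa using ((hasDerivAt_id (0 : ℝ)).smul_const v).const_add (basePoint p)
    have e0 : basePoint p + (0 : ℝ) • v = basePoint p := by rw [zero_smul, add_zero]
    have hFd' : HasFDerivAt F (fderiv ℝ F (basePoint p)) (basePoint p + (0 : ℝ) • v) := by
      rw [e0]; exact hFd.hasFDerivAt
    have h2 := hFd'.comp_hasDerivAt (0 : ℝ) h1
    have h3 : HasDerivAt (fun s : ℝ => partSum S (basePoint p + s • v)) (partSum S v) 0 := by
      have hk : ∀ k, HasDerivAt (fun s : ℝ => (basePoint p + s • v) k) (v k) 0 := fun k =>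
        hasDerivAt_pi.1 h1 k
      exact HasDerivAt.fun_sum fun k _ => hk k
    have h4 := (hasDerivAt_norm_curve h3 (by rwa [e0])).const_mul (1 / 2)
    rw [e0] at h4
    rw [hF] at h2
    rw [hF]
    exact h2.unique h4
  have hm : HasMFDerivAt 𝓘(ℝ, ModelSpace n) 𝓘(ℝ, ℝ) (fun q => (1 / 2) * modLen S q) p
      ((fderiv ℝ F (basePoint p)).comp (liftDeriv p)) := by
    have hFd' : HasMFDerivAt 𝓘(ℝ, Fin n → LieSU2) 𝓘(ℝ, ℝ) F (localLift p p)
      (fderiv ℝ F (basePoint p)) := hFd.hasFDerivAt.hasMFDerivAt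
    refine (HasMFDerivAt.comp p hFd' (hasMFDerivAt_localLift p)).congr_of_eventuallyEq ?_
    filter_upwards [eventually_localLift p] with q ⟨hq, hq'⟩
    rw [Function.comp_apply, hF]
    simp only
    rw [← modLen_proj S hq, hq']
  refine ⟨hm.mdifferentiableAt, fun v => ?_⟩
  have h1 : dirDeriv (fun q => (1 / 2) * modLen S q) p v =
      fderiv ℝ F (basePoint p) (liftDeriv p v) := by
    rw [dirDeriv, hm.mfderiv]
    rfl
  have h2 : reducedForm p X v = prodForm (basePoint p) (liftDeriv p X) (liftDeriv p v) := rfl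
  -- The generator by which the lift differs from the bending velocity is in the kernel of the
  -- product form, so Hamilton's equation descends.
  obtain ⟨ζ, hζ⟩ := liftDeriv_velocity h hX
  have ht := liftDeriv_mem_tangentSub p v
  rw [h1, h2, hFv, hζ, prodForm_add_left, prodForm_generator (basePoint_mem p).1 ζ ht,
    prodForm_bendVel (basePoint_mem p).1 ht]
  ring

/-- Integral curves of the bending vector fields are bendings. -/
theorem eq_modBend_of_velocity {γ : ℝ → RegularModuli ℓ} (h : ∀ s, modLen S (γ s) ≠ 0)
    (hγ : ∀ s, ∃ X, HasVelocity γ s X ∧ HasVelocity (fun t => modBend S t (γ s)) 0 X) (T : ℝ) :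
    γ T = modBend S T (γ 0) := by
  -- `H s` records the congruence class of `γ s` bent by the remaining angle `T - s`. It
  -- interpolates between the bending of `γ 0` by `T` and `γ T`, so it suffices to show that its
  -- derivative vanishes.
  obtain ⟨H, hH⟩ : ∃ H : ℝ → (Fin n → Fin n → ℝ) × (Fin n → Fin n → Fin n → ℝ),
      H = fun s => invariants (bend S (T - s) (basePoint (γ s))) := ⟨_, rfl⟩
  -- The base points of `γ s` need not depend continuously on `s`, but `H` can be computed from any
  -- lift, in particular from a smooth local section.
  have hHl : ∀ s y (hy : y ∈ regPolygonSet ℓ), proj ℓ ⟨y, hy⟩ = γ s →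
      H s = invariants (bend S (T - s) y) := by
    intro s y hy hys
    obtain ⟨g, hg⟩ := proj_eq_iff.1 (hys.trans (proj_basePoint (γ s)).symm)
    simp only at hg
    rw [hH, ← hg, bend_smul, invariants_smul]
  have hd : ∀ s, HasDerivAt H 0 s := by
    intro s
    obtain ⟨X, hX, hX'⟩ := hγ s
    have hS := modLen_ne_zero_iff.1 (h s)
    obtain ⟨ζ, hζ⟩ := liftDeriv_velocity (h s) hX'
    have hc := hX.hasDerivAt_localLift
    obtain ⟨x, hx⟩ : ∃ x, x = basePoint (γ s) := ⟨_, rfl⟩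
    rw [← hx] at hζ hS
    have hxs : localLift (γ s) (γ s) = x := hx.symm
    obtain ⟨G, hG⟩ : ∃ G : ℝ × (Fin n → LieSU2) → (Fin n → Fin n → ℝ) ×
      (Fin n → Fin n → Fin n → ℝ), G = fun q => invariants (bend S (T - q.1) q.2) := ⟨_, rfl⟩
    have hGd : HasFDerivAt G (fderiv ℝ G (s, x)) (s, x) := by
      rw [hG]
      have h1 : ContDiffAt ℝ ∞ (fun q : ℝ × (Fin n → LieSU2) => bend S (T - q.1) q.2) (s, x) := by
        have h2 := contDiffAt_bend hS (T - s)
        have h3 : ContDiffAt ℝ ∞ (fun q : ℝ × (Fin n → LieSU2) => (T - q.1, q.2)) (s, x) :=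
          (contDiffAt_const.sub contDiffAt_fst).prodMk contDiffAt_snd
        exact ContDiffAt.comp (s, x) (f := fun q : ℝ × (Fin n → LieSU2) => (T - q.1, q.2)) h2 h3
      exact ((contDiff_invariants.contDiffAt.comp (s, x) h1).differentiableAt
        (by simp)).hasFDerivAt
    have h1 : HasDerivAt (fun r => G (r, localLift (γ s) (γ r)))
        (fderiv ℝ G (s, x) (1, liftDeriv (γ s) X)) s := by
      have hGd' : HasFDerivAt G (fderiv ℝ G (s, x)) (s, localLift (γ s) (γ s)) := by
        rw [hxs]; exact hGd
      exact hGd'.comp_hasDerivAt s ((hasDerivAt_id s).prodMk hc)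
    -- Along the bending itself, the angle already gained and the remaining angle add up to a
    -- constant.
    have h2 : fderiv ℝ G (s, x) (1, bendVel S x) = 0 := by
      have hb : HasDerivAt (fun r : ℝ => (s + r, bend S r x)) (1, bendVel S x) 0 :=
        ((hasDerivAt_id (0 : ℝ)).const_add s).prodMk (hasDerivAt_bend S x)
      have hGd' : HasFDerivAt G (fderiv ℝ G (s, x)) (s + 0, bend S 0 x) := by
        rw [add_zero, bend_zero]; exact hGd
      refine (hGd'.comp_hasDerivAt (0 : ℝ) hb).unique ?_
      have h3 : (G ∘ fun r : ℝ => (s + r, bend S r x)) = fun _ =>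
          invariants (bend S (T - s) x) := by
        funext r
        rw [hG, Function.comp_apply]
        simp only
        rw [bend_bend hS]
        congr 2
        ring
      rw [h3]
      exact hasDerivAt_const _ _
    -- Bending is equivariant and the invariants are constant on orbits, so the indeterminacy of the
    -- lift does not contribute.
    have h3 : fderiv ℝ G (s, x) (0, generator x ζ) = 0 := by
      obtain ⟨g, hg0, hg⟩ := exists_hasDerivAt_smul x ζ
      have hb : HasDerivAt (fun r : ℝ => (s, g r • x)) (0, generator x ζ) 0 :=
        (hasDerivAt_const (0 : ℝ) s).prodMk hg
      have hGd' : HasFDerivAt G (fderiv ℝ G (s, x)) (s, g 0 • x) := by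
        rw [hg0]; exact hGd
      refine (hGd'.comp_hasDerivAt (0 : ℝ) hb).unique ?_
      have h3 : (G ∘ fun r : ℝ => (s, g r • x)) = fun _ => invariants (bend S (T - s) x) := by
        funext r
        rw [hG, Function.comp_apply]
        simp only
        rw [bend_smul, invariants_smul]
      rw [h3]
      exact hasDerivAt_const _ _
    have h4 : ((1 : ℝ), liftDeriv (γ s) X) = (1, bendVel S x) + (0, generator x ζ) := by
      rw [hζ, Prod.mk_add_mk, add_zero]
    rw [h4, map_add, h2, h3, add_zero] at h1
    refine h1.congr_of_eventuallyEq ?_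
    filter_upwards [hX.continuousAt.eventually (eventually_localLift (γ s))] with r ⟨hr, hr'⟩
    rw [hHl r _ hr hr', hG]
  have hconst : H T = H 0 := is_const_of_deriv_eq_zero (fun s => (hd s).differentiableAt)
    (fun s => (hd s).deriv) T 0
  rw [hHl T _ (basePoint_mem _) (proj_basePoint _), sub_self, bend_zero, hH] at hconst
  simp only [sub_zero] at hconst
  rw [modBend_eq (h 0), ← proj_basePoint (γ T)]
  exact proj_eq_of_invariants_eq _ _ hconst

/-- The group law moves the velocity from time zero to time `s`; existence at time `s` comes from
the explicit lift, and uniqueness of velocities identifies it with `X`. -/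
theorem hasVelocity_modBend {p : RegularModuli ℓ} (h : modLen S p ≠ 0) (s : ℝ) {X : ModelSpace n}
    (hX : HasVelocity (fun t => modBend S t (modBend S s p)) 0 X) :
    HasVelocity (fun t => modBend S t p) s X := by
  have h1 : HasDerivAt (fun t => bend S t (basePoint p)) (bendVel S (bend S s (basePoint p))) s := by
    have h2 := hasDerivAt_bend S (bend S s (basePoint p))
    have h3 := h2.scomp_of_eq (h := fun t => t - s) s ((hasDerivAt_id s).sub_const s)
      (sub_self s).symm
    rw [one_smul] at h3
    refine h3.congr_of_eventuallyEq (Filter.Eventually.of_forall fun t => ?_)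
    rw [Function.comp_apply, bend_bend (modLen_ne_zero_iff.1 h)]
    simp
  obtain ⟨Y, hY⟩ := exists_hasVelocity (γ := fun t => modBend S t p) h1
    (Filter.Eventually.of_forall fun t =>
      ⟨bend_mem_reg (basePoint_mem p) (modLen_ne_zero_iff.1 h) t, (modBend_eq h t).symm⟩)
  have h2 : HasVelocity (fun t => modBend S t (modBend S s p)) 0 Y := by
    have h3 : (fun t => modBend S t (modBend S s p)) =
        (fun t => modBend S t p) ∘ fun t => t + s := by
      funext t
      rw [Function.comp_apply, modBend_modBend h]
    have h4 : HasMFDerivAt 𝓘(ℝ, ℝ) 𝓘(ℝ, ℝ) (fun t : ℝ => t + s) 0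
        (ContinuousLinearMap.toSpanSingleton ℝ (1 : ℝ)) :=
      ((hasDerivAt_id (0 : ℝ)).add_const s).hasFDerivAt.hasMFDerivAt
    have h5 : HasMFDerivAt 𝓘(ℝ, ℝ) 𝓘(ℝ, ModelSpace n) (fun t => modBend S t p) (0 + s)
        ((1 : ℝ →L[ℝ] ℝ).smulRight Y) := by
      rw [zero_add]; exact hY
    have h6 := HasMFDerivAt.comp (0 : ℝ) h5 h4
    unfold HasVelocity
    rw [h3]
    refine h6.congr_mfderiv ?_
    ext
    change ((1 : ℝ) • (1 : ℝ)) • Y = (1 : ℝ) • Y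
    simp
  rw [hX.unique h2]
  exact hY

end

/-! ### Smoothness of bending on the moduli space -/

section
variable {n : ℕ} {S S' : Finset (Fin n)} {ℓ : Fin n → Set.Ioi (0 : ℝ)} {x : Fin n → LieSU2}

/-- Bending is smooth. -/
theorem contMDiff_modBend {U : TopologicalSpace.Opens (RegularModuli ℓ)}
    (hU : ∀ p ∈ U, modLen S p ≠ 0) : ContMDiff (𝓘(ℝ, ℝ).prod 𝓘(ℝ, ModelSpace n))
      𝓘(ℝ, ModelSpace n) ∞ (fun q : ℝ × U => modBend S q.1 q.2.1) := by
  rintro ⟨t, p, hp⟩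
  have h := hU p hp
  have hS := modLen_ne_zero_iff.1 h
  have hreg := bend_mem_reg (basePoint_mem p) hS t
  -- Locally the map is a composition of smooth maps: lift by the section at `p`, bend in the
  -- ambient space, and return by an extension of `proj` around the bent polygon.
  obtain ⟨Q, hQ, hQp⟩ := exists_localProj hreg
  have h1 : ContMDiffAt (𝓘(ℝ, ℝ).prod 𝓘(ℝ, ModelSpace n)) 𝓘(ℝ, Fin n → LieSU2) ∞
      (fun q : ℝ × U => localLift p q.2.1) (t, ⟨p, hp⟩) :=
    ContMDiffAt.comp (t, (⟨p, hp⟩ : U)) (g := fun q : U => localLift p q.1)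
      (contMDiffAt_subtype_iff.2 (contMDiffAt_localLift p)) contMDiffAt_snd
  have h2 : ContMDiffAt (𝓘(ℝ, ℝ).prod 𝓘(ℝ, ModelSpace n)) 𝓘(ℝ, ℝ × (Fin n → LieSU2)) ∞
      (fun q : ℝ × U => (q.1, localLift p q.2.1)) (t, ⟨p, hp⟩) :=
    contMDiffAt_fst.prodMk_space h1
  have h3 : ContMDiffAt (𝓘(ℝ, ℝ).prod 𝓘(ℝ, ModelSpace n)) 𝓘(ℝ, Fin n → LieSU2) ∞
      (fun q : ℝ × U => bend S q.1 (localLift p q.2.1)) (t, ⟨p, hp⟩) := by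
    have hb : ContMDiffAt 𝓘(ℝ, ℝ × (Fin n → LieSU2)) 𝓘(ℝ, Fin n → LieSU2) ∞
        (fun q : ℝ × (Fin n → LieSU2) => bend S q.1 q.2) (t, basePoint p) :=
      (contDiffAt_bend hS t).contMDiffAt
    exact ContMDiffAt.comp_of_eq (x := (t, (⟨p, hp⟩ : U)))
      (g := fun q : ℝ × (Fin n → LieSU2) => bend S q.1 q.2)
      (f := fun q : ℝ × U => (q.1, localLift p q.2.1)) hb h2 rfl
  have h4 : ContMDiffAt (𝓘(ℝ, ℝ).prod 𝓘(ℝ, ModelSpace n)) 𝓘(ℝ, ModelSpace n) ∞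
      (fun q : ℝ × U => Q (bend S q.1 (localLift p q.2.1))) (t, ⟨p, hp⟩) :=
    ContMDiffAt.comp_of_eq (x := (t, (⟨p, hp⟩ : U))) (g := Q)
      (f := fun q : ℝ × U => bend S q.1 (localLift p q.2.1)) hQ h3 rfl
  refine h4.congr_of_eventuallyEq ?_
  have hval : Filter.Tendsto (fun q : ℝ × U => q.2.1) (𝓝 (t, ⟨p, hp⟩)) (𝓝 p) :=
    (continuous_subtype_val.comp continuous_snd).tendsto _
  filter_upwards [h3.continuousAt.eventually hQp, hval.eventually (eventually_localLift p)]
    with q hq ⟨hq1, hq2⟩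
  have h5 : partSum S (localLift p q.2.1) ≠ 0 := by
    rw [← modLen_proj_ne_zero_iff hq1, hq2]
    exact hU _ q.2.2
  rw [hq (bend_mem_reg hq1 h5 q.1), ← modBend_proj hq1 h5, hq2]

end

section
/-! ### Sides of the edges of a tree -/

section Graph

variable {V : Type*} {G : SimpleGraph V}

/-- The vertices connected to `q` by a walk avoiding `p`. -/
def farSide (G : SimpleGraph V) (p q : V) : Set V := {u | ∃ w : G.Walk u q, p ∉ w.support}

theorem self_notMem_farSide (p q : V) : p ∉ farSide G p q := by
  rintro ⟨w, hw⟩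
  exact hw w.start_mem_support

theorem end_mem_farSide {p q : V} (h : p ≠ q) : q ∈ farSide G p q :=
  ⟨SimpleGraph.Walk.nil, by simpa using h⟩

theorem mem_farSide_of_walk {p q u u' : V} (w : G.Walk u u') (hw : p ∉ w.support)
    (h : u' ∈ farSide G p q) : u ∈ farSide G p q := by
  obtain ⟨w', hw'⟩ := h
  refine ⟨w.append w', fun h' => ?_⟩
  rcases (SimpleGraph.Walk.mem_support_append_iff _ _).1 h' with h1 | h1
  · exact hw h1
  · exact hw' h1

theorem mem_farSide_of_adj {p q u u' : V} (h : G.Adj u u') (hu : p ≠ u)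
    (h' : u' ∈ farSide G p q) : u ∈ farSide G p q := by
  refine mem_farSide_of_walk (SimpleGraph.Walk.cons h SimpleGraph.Walk.nil) ?_ h'
  rintro hp
  simp only [SimpleGraph.Walk.support_cons, SimpleGraph.Walk.support_nil, List.mem_cons,
    List.not_mem_nil, or_false] at hp
  rcases hp with rfl | rfl
  · exact hu rfl
  · exact self_notMem_farSide _ _ h'

theorem exists_path_of_mem_farSide {p q u : V} (h : u ∈ farSide G p q) :
    ∃ w : G.Walk u q, w.IsPath ∧ p ∉ w.support := by
  classical
  obtain ⟨w, hw⟩ := h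
  exact ⟨w.bypass, w.bypass_isPath, fun h => hw (w.support_bypass_subset_support h)⟩

/-- Otherwise a path from `u` to `p` avoiding `q`, extended by the edge, would be a second path from
`u` to `q`, different from the one that avoids `p`. -/
theorem farSide_disjoint (hG : G.IsTree) {p q u : V} (h : G.Adj p q) (hu : u ∈ farSide G p q) :
    u ∉ farSide G q p := by
  intro hu'
  obtain ⟨w₁, hw₁, hp⟩ := exists_path_of_mem_farSide hu
  obtain ⟨w₂, hw₂, hq⟩ := exists_path_of_mem_farSide hu'
  have h1 : (w₂.concat h).IsPath := hw₂.concat hq h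
  have h2 := (hG.existsUnique_path u q).unique hw₁ h1
  apply hp
  rw [h2, SimpleGraph.Walk.support_concat]
  simp

theorem mem_farSide_or (hG : G.IsTree) {p q : V} (h : p ≠ q) (u : V) :
    u ∈ farSide G p q ∨ u ∈ farSide G q p := by
  classical
  obtain ⟨w, hw, -⟩ := hG.existsUnique_path u p
  -- If the path from `u` to `p` meets `q`, its part up to `q` avoids `p`; if not, it avoids `q`
  -- itself.
  by_cases hq : q ∈ w.support
  · exact Or.inl ⟨w.takeUntil q hq, SimpleGraph.Walk.endpoint_notMem_support_takeUntil hw hq h⟩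
  · exact Or.inr ⟨w, hq⟩

theorem farSide_swap (hG : G.IsTree) {p q : V} (h : G.Adj p q) :
    farSide G q p = (farSide G p q)ᶜ := by
  ext u
  exact ⟨farSide_disjoint hG h.symm, fun hu => (mem_farSide_or hG h.ne u).resolve_left hu⟩

/-- Two vertices of the first side are joined through `q` by a walk that stays in this side, hence
avoids `p'`. So as soon as one vertex belongs to the second side, all do. -/
theorem farSide_subset_or_disjoint {p q p' q' : V} (h : p' ∉ farSide G p q) :
    farSide G p q ⊆ farSide G p' q' ∨ Disjoint (farSide G p q) (farSide G p' q') := by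
  classical
  by_cases hd : Disjoint (farSide G p q) (farSide G p' q')
  · exact Or.inr hd
  · obtain ⟨u', hu', hu''⟩ := Set.not_disjoint_iff.1 hd
    refine Or.inl fun u hu => ?_
    obtain ⟨w, hw⟩ := hu
    obtain ⟨w', hw'⟩ := hu'
    refine mem_farSide_of_walk (w.append w'.reverse) (fun hp => h ?_) hu''
    rcases (SimpleGraph.Walk.mem_support_append_iff _ _).1 hp with h1 | h1
    · exact ⟨w.dropUntil p' h1, fun h2 => hw (w.support_dropUntil_subset_support h1 h2)⟩
    · rw [SimpleGraph.Walk.support_reverse, List.mem_reverse] at h1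
      exact ⟨w'.dropUntil p' h1, fun h2 => hw' (w'.support_dropUntil_subset_support h1 h2)⟩

theorem exists_adj_mem_farSide (hG : G.IsTree) {v u : V} (h : u ≠ v) :
    ∃ w, G.Adj v w ∧ u ∈ farSide G v w := by
  obtain ⟨w, hw, -⟩ := hG.existsUnique_path v u
  cases w with
  | nil => exact absurd rfl h
  | cons hadj w' =>
    rw [SimpleGraph.Walk.cons_isPath_iff] at hw
    exact ⟨_, hadj, w'.reverse, by simpa using hw.2⟩

/-- Distinct branches at `v` are disjoint: a common vertex would connect `w'` to `w` without `v`,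
putting `w'` on both sides of the edge `vw`. -/
theorem eq_of_mem_farSide (hG : G.IsTree) {v w w' u : V} (h : G.Adj v w) (h' : G.Adj v w')
    (hu : u ∈ farSide G v w) (hu' : u ∈ farSide G v w') : w = w' := by
  by_contra hne
  obtain ⟨W, hW⟩ := hu'
  have h1 : w' ∈ farSide G v w := by
    refine mem_farSide_of_walk W.reverse ?_ hu
    simpa using hW
  have h2 : w' ∈ farSide G w v := mem_farSide_of_adj h'.symm hne (end_mem_farSide h.ne')
  exact farSide_disjoint hG h h1 h2

end Graph

/-! ### Partial sums attached to a graph -/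

variable {n : ℕ} {V : Type*} {x : Fin n → LieSU2} {ℓ : Fin n → Set.Ioi (0 : ℝ)}

open Classical in
/-- The half-edges on the side of `q` of the edge joining `p` and `q`. -/
def sideSet (Γ : AdmissibleGraph V n) (p q : V) : Finset (Fin n) :=
  Finset.univ.filter fun i => Γ.half i ∈ farSide Γ.graph p q

variable {Γ : AdmissibleGraph V n}

theorem mem_sideSet {p q : V} {i : Fin n} :
    i ∈ sideSet Γ p q ↔ Γ.half i ∈ farSide Γ.graph p q := by
  simp [sideSet]

theorem initialSet_eq (o : Γ.Orientation) (a : Γ.IntEdge) :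
    initialSet o a = sideSet Γ (o.dart a).snd (o.dart a).fst := by
  classical
  ext i
  rw [mem_sideSet]
  refine (Finset.mem_filter_univ i).trans ?_
  exact ⟨fun ⟨w, _, hw⟩ => ⟨w, hw⟩, exists_path_of_mem_farSide⟩

theorem sideSet_swap {p q : V} (h : Γ.graph.Adj p q) : sideSet Γ q p = (sideSet Γ p q)ᶜ := by
  ext i
  rw [mem_sideSet, Finset.mem_compl, mem_sideSet, farSide_swap Γ.isTree h]
  rfl

theorem sideSet_subset_or_disjoint {p q p' q' : V} (h : p' ∉ farSide Γ.graph p q) :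
    sideSet Γ p q ⊆ sideSet Γ p' q' ∨ Disjoint (sideSet Γ p q) (sideSet Γ p' q') := by
  rcases farSide_subset_or_disjoint (q' := q') h with h1 | h1
  · exact Or.inl fun i hi => mem_sideSet.2 (h1 (mem_sideSet.1 hi))
  · exact Or.inr (Finset.disjoint_left.2 fun i hi hi' =>
      Set.disjoint_left.1 h1 (mem_sideSet.1 hi) (mem_sideSet.1 hi'))

/-- The vertex `p'` lies on exactly one side of the edge `pq`. The opposite side is contained in, or
disjoint from, the side defined by `p'` and `q'`; the four resulting cases are those of `Laminar`.
-/
theorem laminar_sideSet {p q p' q' : V} (h : Γ.graph.Adj p q) :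
    Laminar (sideSet Γ p q) (sideSet Γ p' q') := by
  by_cases h1 : p' ∈ farSide Γ.graph p q
  · rcases sideSet_subset_or_disjoint (q' := q') (farSide_disjoint Γ.isTree h h1) with h2 | h2
    · rw [sideSet_swap h] at h2
      exact Or.inr (Or.inr (Or.inr h2))
    · rw [sideSet_swap h] at h2
      refine Or.inr (Or.inl fun i hi => ?_)
      by_contra hi'
      exact Finset.disjoint_left.1 h2 (Finset.mem_compl.2 hi') hi
  · rcases sideSet_subset_or_disjoint (q' := q') h1 with h2 | h2
    · exact Or.inl h2
    · exact Or.inr (Or.inr (Or.inl h2))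

/-! ### The polygons attached to the vertices -/

/-- The edges at a vertex. -/
abbrev LocEdge (Γ : AdmissibleGraph V n) (v : V) : Type _ :=
  {w // Γ.graph.Adj v w} ⊕ {i // Γ.half i = v}

/-- The half-edges on the far side of an edge at a vertex. -/
def locSet {v : V} (e : LocEdge Γ v) : Finset (Fin n) :=
  Sum.elim (fun w => sideSet Γ v w.1) (fun i => {i.1}) e

/-- The sides of the polygons attached to the vertex `v`. -/
def tri (x : Fin n → LieSU2) {v : V} (e : LocEdge Γ v) : LieSU2 := partSum (locSet e) x

/-- Each half-edge other than those at `v` lies in exactly one branch of the tree at `v`, so the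
sets `locSet e` partition the half-edges. -/
theorem existsUnique_mem_locSet (v : V) (i : Fin n) : ∃! e : LocEdge Γ v, i ∈ locSet e := by
  by_cases h : Γ.half i = v
  · refine ⟨Sum.inr ⟨i, h⟩, Finset.mem_singleton_self i, ?_⟩
    rintro (⟨w, hw⟩ | ⟨j, hj⟩) he
    · have h1 : Γ.half i ∈ farSide Γ.graph v w := mem_sideSet.1 he
      rw [h] at h1
      exact absurd h1 (self_notMem_farSide _ _)
    · have h1 : i = j := Finset.mem_singleton.1 he
      subst h1
      rfl
  · obtain ⟨w, hw, hi⟩ := exists_adj_mem_farSide Γ.isTree h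
    refine ⟨Sum.inl ⟨w, hw⟩, mem_sideSet.2 hi, ?_⟩
    rintro (⟨w', hw'⟩ | ⟨j, hj⟩) he
    · have h1 := eq_of_mem_farSide Γ.isTree hw hw' hi (mem_sideSet.1 he)
      subst h1
      rfl
    · have h1 : i = j := Finset.mem_singleton.1 he
      exact absurd (h1 ▸ hj) h

/-- Grouping the closing condition of the polygon according to the edge at `v` beyond which each
half-edge lies makes the polygon at `v` close up. -/
theorem sum_tri [Finite V] (hx : x ∈ polygonSet ℓ) (v : V) [Fintype (LocEdge Γ v)] :
    ∑ e : LocEdge Γ v, tri x e = 0 := by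
  classical
  choose φ hφ hφ' using fun i => existsUnique_mem_locSet (Γ := Γ) v i
  have h : ∀ e : LocEdge Γ v, locSet e = Finset.univ.filter fun i => φ i = e := by
    intro e
    ext i
    rw [Finset.mem_filter]
    exact ⟨fun h => ⟨Finset.mem_univ _, (hφ' i e h).symm⟩, fun h => h.2 ▸ hφ i⟩
  rw [← hx.2, ← Finset.sum_fiberwise (s := Finset.univ) (g := φ)]
  exact Finset.sum_congr rfl fun e _ => by rw [tri, h, partSum]

theorem card_locEdge [Finite V] (v : V) : Nat.card (LocEdge Γ v) = 3 := by
  have h := Γ.trivalent v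
  rw [Nat.card_sum]
  exact h

/-- The three edges at a vertex, one of them prescribed. -/
theorem exists_three [Finite V] {v : V} (e : LocEdge Γ v) : ∃ e₁ e₂ : LocEdge Γ v,
    e ≠ e₁ ∧ e ≠ e₂ ∧ e₁ ≠ e₂ ∧ (∀ e', e' = e ∨ e' = e₁ ∨ e' = e₂) ∧
      ∀ (ℓ : Fin n → Set.Ioi (0 : ℝ)), ∀ x ∈ polygonSet ℓ, tri x e + tri x e₁ + tri x e₂ = 0 := by
  classical
  have : Fintype (LocEdge Γ v) := Fintype.ofFinite _
  have hc : Fintype.card (LocEdge Γ v) = 3 := by rw [← Nat.card_eq_fintype_card, card_locEdge]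
  have h1 : (Finset.univ.erase e).card = 2 := by
    rw [Finset.card_erase_of_mem (Finset.mem_univ e), Finset.card_univ, hc]
  obtain ⟨e₁, e₂, h12, h2⟩ := Finset.card_eq_two.1 h1
  have he1 : e ≠ e₁ := by
    have : e₁ ∈ Finset.univ.erase e := by rw [h2]; simp
    exact (Finset.ne_of_mem_erase this).symm
  have he2 : e ≠ e₂ := by
    have : e₂ ∈ Finset.univ.erase e := by rw [h2]; simp
    exact (Finset.ne_of_mem_erase this).symm
  refine ⟨e₁, e₂, he1, he2, h12, fun e' => ?_, fun ℓ x hx => ?_⟩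
  · by_cases h : e' = e
    · exact Or.inl h
    · have : e' ∈ Finset.univ.erase e := Finset.mem_erase.2 ⟨h, Finset.mem_univ _⟩
      rw [h2] at this
      simpa using Or.inr (b := e' = e₁ ∨ e' = e₂) (by simpa using this)
  · rw [← sum_tri (Γ := Γ) hx v, ← Finset.add_sum_erase _ _ (Finset.mem_univ e), h2, Finset.sum_pair h12,
      add_assoc]

theorem tri_smul (g : SU2) (x : Fin n → LieSU2) {v : V} (e : LocEdge Γ v) :
    tri (g • x) e = g • tri x e := partSum_smul g _ x

/-- Bending leaves the polygons at the vertices of the other side unchanged. -/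
theorem tri_bend {p q u : V} (hu : u ∉ farSide Γ.graph p q) (h : partSum (sideSet Γ p q) x ≠ 0)
    (t : ℝ) (e : LocEdge Γ u) : tri (bend (sideSet Γ p q) t x) e = tri x e := by
  rcases e with ⟨w, hw⟩ | ⟨i, hi⟩
  · change partSum (sideSet Γ u w) _ = partSum (sideSet Γ u w) _
    rcases sideSet_subset_or_disjoint (q' := w) hu with h1 | h1
    · exact partSum_bend_of_superset h1 h t
    · exact partSum_bend_of_disjoint h1 t x
  · refine partSum_bend_of_disjoint ?_ t x
    change Disjoint _ {i}
    rw [Finset.disjoint_singleton_right, mem_sideSet, hi]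
    exact hu

/-- Bending along an edge rotates the polygon at its endpoint. -/
theorem tri_bend_end {p q : V} (h : Γ.graph.Adj p q) (t : ℝ) (e : LocEdge Γ q)
    (he : e ≠ Sum.inl ⟨p, h.symm⟩) :
    tri (bend (sideSet Γ p q) t x) e = rot (axis (sideSet Γ p q) x) t (tri x e) := by
  refine partSum_bend_of_subset (fun i hi => ?_) t x
  by_contra hi'
  have h1 : i ∈ locSet (Sum.inl ⟨p, h.symm⟩ : LocEdge Γ q) := by
    change i ∈ sideSet Γ q p
    rw [sideSet_swap h]
    exact Finset.mem_compl.2 hi'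
  exact he ((existsUnique_mem_locSet q i).unique hi h1)

/-- The polygons at the two ends of an edge share a side, with opposite signs. -/
theorem tri_swap {p q : V} (h : Γ.graph.Adj p q) (hx : x ∈ polygonSet ℓ) :
    tri x (Sum.inl ⟨p, h.symm⟩ : LocEdge Γ q) = -partSum (sideSet Γ p q) x := by
  rw [← partSum_compl hx, ← sideSet_swap h]
  rfl

/-- The internal edge joining two adjacent vertices. -/
def mkEdge {v w : V} (h : Γ.graph.Adj v w) : Γ.IntEdge :=
  ⟨s(v, w), (SimpleGraph.mem_edgeSet _).2 h⟩

/-- The edge of the graph given by an edge at a vertex. -/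
def toEdge {v : V} (e : LocEdge Γ v) : Γ.Edge :=
  Sum.map (fun w => mkEdge w.2) Subtype.val e

theorem toEdge_injective (v : V) : Function.Injective (toEdge (Γ := Γ) (v := v)) := by
  refine Function.Injective.sumMap ?_ Subtype.val_injective
  intro w w' h
  have h1 := congrArg Subtype.val h
  simp only at h1
  exact Subtype.ext (Sym2.congr_right.1 h1)

theorem incident_toEdge {v : V} (e : LocEdge Γ v) : Γ.Incident (toEdge e) v := by
  rcases e with ⟨w, hw⟩ | ⟨i, hi⟩
  · exact Sym2.mem_mk_left v w
  · exact hi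

theorem lengthMap_toModuli (o : Γ.Orientation) (hx : x ∈ polygonSet ℓ) (a : Γ.IntEdge) :
    lengthMap o ℓ (toModuli ℓ ⟨x, hx⟩) a = ‖partSum (initialSet o a) x‖ := rfl

theorem dart_cases (o : Γ.Orientation) {v w : V} (h : Γ.graph.Adj v w) :
    initialSet o (mkEdge h) = sideSet Γ v w ∨
      initialSet o (mkEdge h) = (sideSet Γ v w)ᶜ := by
  have h1 := o.edge_dart (mkEdge h)
  replace h1 := SimpleGraph.dart_edge_eq_mk'_iff'.1 h1
  rw [initialSet_eq]
  rcases h1 with ⟨h2, h3⟩ | ⟨h2, h3⟩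
  · rw [h2, h3, sideSet_swap h]
    exact Or.inr rfl
  · rw [h2, h3]
    exact Or.inl rfl

theorem norm_tri (o : Γ.Orientation) (hx : x ∈ polygonSet ℓ) {v : V} (e : LocEdge Γ v) :
    ‖tri x e‖ = Sum.elim (lengthMap o ℓ (toModuli ℓ ⟨x, hx⟩)) (fun i => (ℓ i : ℝ)) (toEdge e) := by
  rcases e with ⟨w, hw⟩ | ⟨i, hi⟩
  · change ‖partSum (sideSet Γ v w) x‖ = lengthMap o ℓ (toModuli ℓ ⟨x, hx⟩) (mkEdge hw)
    rw [lengthMap_toModuli]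
    rcases dart_cases o hw with h | h
    · rw [h]
    · rw [h, partSum_compl hx, norm_neg]
  · change ‖partSum {i} x‖ = ℓ i
    rw [partSum, Finset.sum_singleton, hx.1]

theorem tri_inr (x : Fin n → LieSU2) (i : Fin n) :
    tri x (Sum.inr ⟨i, rfl⟩ : LocEdge Γ (Γ.half i)) = x i := Finset.sum_singleton _ _

end

section
/-! ### Interior points of the polyhedron -/

section Interior

/-- If `φ` vanished at `d`, moving along the coordinate `f` in one of the two directions would make
it negative while staying in `s`. -/
theorem pos_of_mem_interior {ι : Type*} [Finite ι] [DecidableEq ι] {s : Set (ι → ℝ)} {d : ι → ℝ}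
    (hd : d ∈ interior s) {φ : (ι → ℝ) → ℝ} (hφ : ∀ d' ∈ s, 0 ≤ φ d') {f : ι} {κ : ℝ}
    (hκ : κ ≠ 0) (h : ∀ r : ℝ, φ (d + r • Pi.single f 1) = φ d + r * κ) : 0 < φ d := by
  have : Fintype ι := Fintype.ofFinite ι
  have hc : Continuous fun r : ℝ => d + r • (Pi.single f 1 : ι → ℝ) := by fun_prop
  have h0 : ∀ᶠ r : ℝ in 𝓝 0, d + r • (Pi.single f 1 : ι → ℝ) ∈ s := by
    refine hc.continuousAt.eventually_mem ?_
    simpa using mem_interior_iff_mem_nhds.1 hd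
  obtain ⟨ε, hε, h1⟩ := Metric.eventually_nhds_iff.1 h0
  have h2 : ∀ r : ℝ, |r| < ε → 0 ≤ φ d + r * κ := by
    intro r hr
    rw [← h]
    refine hφ _ (h1 ?_)
    rwa [Real.dist_eq, sub_zero]
  have h3 : |ε / 2| < ε := by
    rw [abs_of_pos (half_pos hε)]
    linarith
  have h4 := h2 (ε / 2) h3
  have h5 := h2 (-(ε / 2)) (by rwa [abs_neg])
  rcases lt_or_gt_of_ne hκ with h6 | h6
  · have := mul_neg_of_pos_of_neg (half_pos hε) h6
    linarith
  · have := mul_pos (half_pos hε) h6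
    linarith

end Interior

variable {n : ℕ} {V : Type*} {x y : Fin n → LieSU2} {ℓ : Fin n → Set.Ioi (0 : ℝ)}
  {Γ : AdmissibleGraph V n}

/-- A vertex without neighbours would be the whole tree and carry all the half-edges, so that `n =
3`. -/
theorem exists_adj (hn : 4 ≤ n) (Γ : AdmissibleGraph V n) (v : V) : ∃ w, Γ.graph.Adj v w := by
  by_contra! h
  have h1 : ∀ u, u = v := by
    intro u
    by_contra hu
    obtain ⟨w, hw, -⟩ := exists_adj_mem_farSide Γ.isTree hu
    exact h w hw
  have h2 := Γ.trivalent v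
  have h3 : Γ.graph.neighborSet v = ∅ := Set.eq_empty_of_forall_notMem fun w hw => h w hw
  have h4 : {i | Γ.half i = v} = Set.univ := Set.eq_univ_of_forall fun i => h1 _
  rw [h3, h4, Set.ncard_empty, Set.ncard_univ, Nat.card_eq_fintype_card, Fintype.card_fin] at h2
  omega

theorem eq_of_locEdge [Finite V] {v : V} {e₁ e₂ e₃ : LocEdge Γ v} (h12 : e₁ ≠ e₂) (h23 : e₂ ≠ e₃)
    (h13 : e₁ ≠ e₃) (e : LocEdge Γ v) : e = e₁ ∨ e = e₂ ∨ e = e₃ := by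
  classical
  have : Fintype (LocEdge Γ v) := Fintype.ofFinite _
  have hc : Fintype.card (LocEdge Γ v) = 3 := by rw [← Nat.card_eq_fintype_card, card_locEdge]
  have h : ({e₁, e₂, e₃} : Finset (LocEdge Γ v)) = Finset.univ := by
    rw [← Finset.card_eq_iff_eq_univ, hc]
    exact Finset.card_eq_three.2 ⟨e₁, e₂, e₃, h12, h13, h23, rfl⟩
  have h1 : e ∈ ({e₁, e₂, e₃} : Finset (LocEdge Γ v)) := h ▸ Finset.mem_univ e
  simpa using h1

open Classical in
theorem elim_add_single (d : Γ.IntEdge → ℝ) (c : Fin n → ℝ) (r : ℝ) (f : Γ.IntEdge) (e : Γ.Edge) :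
    Sum.elim (d + r • Pi.single f 1) c e = Sum.elim d c e + r * if e = Sum.inl f then 1 else 0 := by
  rcases e with a | i
  · by_cases h : a = f
    · subst h
      simp
    · simp [h]
  · simp

/-- The points of the moduli space over the interior of the polyhedron, as polygons. -/
def IsRegular (o : Γ.Orientation) (ℓ : Fin n → Set.Ioi (0 : ℝ)) (x : Fin n → LieSU2) : Prop :=
  ∃ hx : x ∈ polygonSet ℓ, toModuli ℓ ⟨x, hx⟩ ∈ regModuli o ℓ

variable {o : Γ.Orientation}

/-- At least one of the three edges at `v` is internal, and its length is a free coordinate of the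
polyhedron. The defect of the triangle inequality has slope `±1` in this coordinate, so it cannot
vanish at an interior point. -/
theorem norm_tri_lt [Finite V] (hn : 4 ≤ n) (hx : IsRegular o ℓ x) {v : V}
    {e₁ e₂ e₃ : LocEdge Γ v} (h12 : e₁ ≠ e₂) (h23 : e₂ ≠ e₃) (h13 : e₁ ≠ e₃) :
    ‖tri x e₃‖ < ‖tri x e₁‖ + ‖tri x e₂‖ := by
  classical
  obtain ⟨hx, hreg⟩ := hx
  obtain ⟨w, hw⟩ := exists_adj hn Γ v
  have hinj := toEdge_injective (Γ := Γ) v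
  have hpos := pos_of_mem_interior (f := mkEdge hw) (κ :=
      (if toEdge e₁ = Sum.inl (mkEdge hw) then 1 else 0) +
      (if toEdge e₂ = Sum.inl (mkEdge hw) then 1 else 0) -
      (if toEdge e₃ = Sum.inl (mkEdge hw) then 1 else 0)) (φ := fun d =>
    Sum.elim d (fun i => (ℓ i : ℝ)) (toEdge e₁) + Sum.elim d (fun i => (ℓ i : ℝ)) (toEdge e₂) -
      Sum.elim d (fun i => (ℓ i : ℝ)) (toEdge e₃)) hreg ?_ ?_ ?_
  · rw [norm_tri o hx, norm_tri o hx, norm_tri o hx]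
    linarith
  · intro d hd
    have := (hd.2 v (toEdge e₁) (toEdge e₂) (toEdge e₃) (hinj.ne h12) (hinj.ne h23) (hinj.ne h13)
      (incident_toEdge e₁) (incident_toEdge e₂) (incident_toEdge e₃)).2
    linarith
  · have h1 : (Sum.inl (mkEdge hw) : Γ.Edge) = toEdge (Sum.inl ⟨w, hw⟩ : LocEdge Γ v) := rfl
    simp only [h1, hinj.eq_iff]
    rcases eq_of_locEdge h12 h23 h13 (Sum.inl ⟨w, hw⟩ : LocEdge Γ v) with h | h | h
    · rw [h, if_pos rfl, if_neg h12.symm, if_neg h13.symm]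
      norm_num
    · rw [h, if_neg h12, if_pos rfl, if_neg h23.symm]
      norm_num
    · rw [h, if_neg h13, if_neg h23, if_pos rfl]
      norm_num
  · intro r
    simp only [elim_add_single]
    ring

theorem tri_ne_zero [Finite V] (hn : 4 ≤ n) (hx : IsRegular o ℓ x) {v : V} (e : LocEdge Γ v) :
    tri x e ≠ 0 := by
  obtain ⟨e₁, e₂, h1, h2, h12, -⟩ := exists_three e
  have h3 := norm_tri_lt hn hx h1 h12 h2
  have h4 := norm_tri_lt hn hx h2 h12.symm h1
  rw [← norm_pos_iff]
  linarith

/-- If one side were `c` times another, the lengths would be proportional to `1`, `|c|`, `|1 + c|`,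
and one of these numbers is always the sum of the other two. -/
theorem tri_notMem_span [Finite V] (hn : 4 ≤ n) (hx : IsRegular o ℓ x) {v : V}
    {e e' : LocEdge Γ v} (he : e ≠ e') : tri x e' ∉ Submodule.span ℝ {tri x e} := by
  intro hmem
  obtain ⟨c, hc⟩ := Submodule.mem_span_singleton.1 hmem
  obtain ⟨e₁, e₂, h1, h2, h12, h3, h4⟩ := exists_three e
  obtain ⟨e'', h5, h6, h7⟩ : ∃ e'', e ≠ e'' ∧ e' ≠ e'' ∧ tri x e + tri x e' + tri x e'' = 0 := by
    have h8 := h4 ℓ x hx.1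
    rcases h3 e' with h | h | h
    · exact absurd h.symm he
    · subst h
      exact ⟨e₂, h2, h12, h8⟩
    · subst h
      exact ⟨e₁, h1, h12.symm, by rw [← h8]; abel⟩
  have h8 : tri x e'' = -(1 + c) • tri x e := by
    rw [neg_smul, add_smul, one_smul, hc]
    exact (neg_eq_of_add_eq_zero_right h7).symm
  have hN : 0 < ‖tri x e‖ := norm_pos_iff.2 (tri_ne_zero hn hx e)
  have n1 := norm_tri_lt hn hx he h6 h5
  have n2 := norm_tri_lt hn hx h5 h6.symm he
  have n3 := norm_tri_lt hn hx h6 h5.symm he.symm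
  rw [h8, ← hc, norm_smul, norm_smul, Real.norm_eq_abs, Real.norm_eq_abs, abs_neg] at n1 n2 n3
  have m1 : |1 + c| < 1 + |c| := lt_of_mul_lt_mul_right (by linarith) hN.le
  have m2 : |c| < 1 + |1 + c| := lt_of_mul_lt_mul_right (by linarith) hN.le
  have m3 : 1 < |c| + |1 + c| := lt_of_mul_lt_mul_right (by linarith) hN.le
  rcases le_total 0 c with h | h
  · rw [abs_of_nonneg h, abs_of_nonneg (by linarith)] at m1
    linarith
  · rw [abs_of_nonpos h] at m2 m3
    rcases le_total 0 (1 + c) with h' | h'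
    · rw [abs_of_nonneg h'] at m3
      linarith
    · rw [abs_of_nonpos h'] at m2
      linarith

theorem lengthMap_ne_zero [Finite V] (hn : 4 ≤ n) (hx : IsRegular o ℓ x) (a : Γ.IntEdge) :
    partSum (initialSet o a) x ≠ 0 := by
  rw [initialSet_eq]
  exact tri_ne_zero hn hx (Sum.inl ⟨_, (o.dart a).adj.symm⟩ : LocEdge Γ (o.dart a).snd)

theorem IsRegular.not_isCollinear [Finite V] (hn : 4 ≤ n) (hx : IsRegular o ℓ x) :
    ¬ IsCollinear x := by
  rintro ⟨u, hu⟩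
  have h : ∀ S, partSum S x ∈ Submodule.span ℝ {u} := fun S =>
    Submodule.sum_mem _ fun i _ => hu i
  obtain ⟨v⟩ := Γ.isTree.connected.nonempty
  obtain ⟨w, hw⟩ := exists_adj hn Γ v
  obtain ⟨e₁, -, h1, -⟩ := exists_three (Sum.inl ⟨w, hw⟩ : LocEdge Γ v)
  refine tri_notMem_span hn hx h1 ?_
  obtain ⟨a, ha⟩ := Submodule.mem_span_singleton.1 (h (locSet (Sum.inl ⟨w, hw⟩ : LocEdge Γ v)))
  obtain ⟨b, hb⟩ := Submodule.mem_span_singleton.1 (h (locSet e₁))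
  have h0 := tri_ne_zero hn hx (Sum.inl ⟨w, hw⟩ : LocEdge Γ v)
  rw [tri, ← ha] at h0
  have ha0 : a ≠ 0 := fun h => h0 (by rw [h, zero_smul])
  rw [tri, tri, ← ha, ← hb]
  refine Submodule.mem_span_singleton.2 ⟨b / a, ?_⟩
  rw [smul_smul, div_mul_cancel₀ _ ha0]

end

section
/-! ### The torus action -/

variable {n : ℕ} {V : Type*} [Finite V] {x y : Fin n → LieSU2} {ℓ : Fin n → Set.Ioi (0 : ℝ)}
  {Γ : AdmissibleGraph V n}

theorem lengthMap_eq_modLen {V : Type*} {Γ : AdmissibleGraph V n} (o : Γ.Orientation)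
    (p : RegularModuli ℓ) (a : Γ.IntEdge) :
    lengthMap o ℓ p.1 a = modLen (initialSet o a) p := by
  obtain ⟨⟨x, hx⟩, rfl⟩ := proj_surjective ℓ p
  rw [modLen_proj]
  rfl

theorem laminar_initialSet {V : Type*} {Γ : AdmissibleGraph V n} (o : Γ.Orientation)
    (a b : Γ.IntEdge) : Laminar (initialSet o a) (initialSet o b) := by
  rw [initialSet_eq, initialSet_eq]
  exact laminar_sideSet (o.dart a).adj.symm

theorem modLen_ne_zero {o : Γ.Orientation} (p : starModuli o ℓ) (a : Γ.IntEdge) :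
    modLen (initialSet o a) p.1 ≠ 0 := lengthMap_eq_modLen o p.1 a ▸ p.2 a

/-- The Hamiltonian flow of half the length function of an internal edge. -/
def flow (o : Γ.Orientation) (ℓ : Fin n → Set.Ioi (0 : ℝ)) (a : Γ.IntEdge) (t : ℝ)
    (p : starModuli o ℓ) : starModuli o ℓ :=
  ⟨modBend (initialSet o a) t p.1, fun b => by
    rw [lengthMap_eq_modLen, modLen_modBend (modLen_ne_zero p a) (laminar_initialSet o a b)]
    exact modLen_ne_zero p b⟩

variable (o : Γ.Orientation)

theorem lengthMap_flow (a : Γ.IntEdge) (t : ℝ) (p : starModuli o ℓ) :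
    lengthMap o ℓ (starVal (flow o ℓ a t p)) = lengthMap o ℓ (starVal p) := by
  funext b
  change lengthMap o ℓ (modBend (initialSet o a) t p.1).1 b = lengthMap o ℓ p.1.1 b
  rw [lengthMap_eq_modLen, lengthMap_eq_modLen,
    modLen_modBend (modLen_ne_zero p a) (laminar_initialSet o a b)]

theorem flow_zero (a : Γ.IntEdge) (p : starModuli o ℓ) : flow o ℓ a 0 p = p :=
  Subtype.ext (modBend_zero _ _)

theorem flow_flow (a : Γ.IntEdge) (s t : ℝ) (p : starModuli o ℓ) :
    flow o ℓ a s (flow o ℓ a t p) = flow o ℓ a (s + t) p :=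
  Subtype.ext (modBend_modBend (modLen_ne_zero p a) s t)

theorem flow_add_two_pi (a : Γ.IntEdge) (t : ℝ) (p : starModuli o ℓ) :
    flow o ℓ a (t + 2 * Real.pi) p = flow o ℓ a t p :=
  Subtype.ext (modBend_add_two_pi _ t _)

theorem flow_comm (a b : Γ.IntEdge) (s t : ℝ) (p : starModuli o ℓ) :
    flow o ℓ a s (flow o ℓ b t p) = flow o ℓ b t (flow o ℓ a s p) :=
  Subtype.ext (modBend_comm (modLen_ne_zero p a) (modLen_ne_zero p b) (laminar_initialSet o a b) s t)

theorem contMDiff_flow (a : Γ.IntEdge) : ContMDiff (𝓘(ℝ, ℝ).prod 𝓘(ℝ, ModelSpace n))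
    𝓘(ℝ, ModelSpace n) ∞ (fun q : ℝ × starModuli o ℓ => flow o ℓ a q.1 q.2) :=
  (ContMDiff.subtypeVal_comp_iff (starModuli o ℓ) _).1
    (contMDiff_modBend fun p hp => modLen_ne_zero ⟨p, hp⟩ a)

theorem isHamiltonianFlow_flow (a : Γ.IntEdge) : IsHamiltonianFlow (starModuli o ℓ)
    (fun p => (1 / 2) * lengthMap o ℓ p.1 a) (flow o ℓ a) := by
  classical
  have h1 : ∀ p : starModuli o ℓ,
      ∃ X, HasVelocity (fun t => modBend (initialSet o a) t p.1) 0 X :=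
    fun p => exists_velocity_modBend (modLen_ne_zero p a)
  choose Y hY using h1
  -- The field must be defined everywhere; its value zero outside `starModuli o ℓ` is irrelevant,
  -- since the curves stay inside.
  obtain ⟨X, hX⟩ : ∃ X : RegularModuli ℓ → ModelSpace n, ∀ p : starModuli o ℓ, X p.1 = Y p :=
    ⟨fun p => if h : p ∈ starModuli o ℓ then Y ⟨p, h⟩ else 0, fun p => dif_pos p.2⟩
  have hf : (fun p : RegularModuli ℓ => (1 / 2) * lengthMap o ℓ p.1 a) =
      fun p => (1 / 2) * modLen (initialSet o a) p := by
    funext p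
    rw [lengthMap_eq_modLen]
  refine ⟨flow_zero o a, X, fun p hp => ?_, fun p s => ?_⟩
  · rw [hf]
    refine isHamiltonianVector_modBend (modLen_ne_zero ⟨p, hp⟩ a) ?_
    rw [hX ⟨p, hp⟩]
    exact hY ⟨p, hp⟩
  · have h2 := hasVelocity_modBend (modLen_ne_zero p a) s (hY (flow o ℓ a s p))
    rw [← hX] at h2
    exact h2

/-- Non-degeneracy of the reduced form identifies the given Hamiltonian field with the bending
velocities, and a curve with these velocities is a bending. -/
theorem eq_flow (a : Γ.IntEdge) {Ψ : ℝ → starModuli o ℓ → starModuli o ℓ}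
    (hΨ : IsHamiltonianFlow (starModuli o ℓ) (fun p => (1 / 2) * lengthMap o ℓ p.1 a) Ψ) :
    Ψ = flow o ℓ a := by
  obtain ⟨h0, X, hX, hΨ⟩ := hΨ
  have hf : (fun p : RegularModuli ℓ => (1 / 2) * lengthMap o ℓ p.1 a) =
      fun p => (1 / 2) * modLen (initialSet o a) p := by
    funext p
    rw [lengthMap_eq_modLen]
  rw [hf] at hX
  funext t p
  refine Subtype.ext ?_
  have h1 := eq_modBend_of_velocity (S := initialSet o a) (γ := fun t => (Ψ t p).1)
    (fun s => modLen_ne_zero (Ψ s p) a) (fun s => ?_) t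
  · rw [h1, h0]
    rfl
  · obtain ⟨Y, hY⟩ := exists_velocity_modBend (modLen_ne_zero (Ψ s p) a)
    refine ⟨X (Ψ s p).1, hΨ p s, ?_⟩
    have h2 : (X (Ψ s p).1 : ModelSpace n) = Y := by
      refine eq_of_reducedForm_eq (p := (Ψ s p).1) fun v => ?_
      have h3 := (hX (Ψ s p).1 (Ψ s p).2).2 v
      have h4 := (isHamiltonianVector_modBend (modLen_ne_zero (Ψ s p) a) hY).2 v
      exact add_left_cancel (h3.trans h4.symm)
    rw [h2]
    exact hY

/-- The flow of half a length function, as an action of the circle. -/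
def circleHom (ℓ : Fin n → Set.Ioi (0 : ℝ)) (a : Γ.IntEdge) :
    AddCircle (2 * Real.pi) →+ Additive (Function.End (starModuli o ℓ)) :=
  QuotientAddGroup.lift _
    { toFun := fun t => Additive.ofMul (flow o ℓ a t : Function.End (starModuli o ℓ))
      map_zero' := funext fun p => flow_zero o a p
      map_add' := fun s t => funext fun p => (flow_flow o a s t p).symm }
    -- The action of the line factors through the circle because its generator `2π` acts trivially.
    (AddSubgroup.zmultiples_le.2 (funext fun p => by
      have h := flow_add_two_pi o a 0 p
      rw [zero_add, flow_zero] at h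
      exact h))

theorem addCommute_circleHom : Pairwise fun a b => ∀ s t : AddCircle (2 * Real.pi),
    AddCommute (circleHom o ℓ a s) (circleHom o ℓ b t) := by
  intro a b _ s t
  obtain ⟨s, rfl⟩ := QuotientAddGroup.mk_surjective s
  obtain ⟨t, rfl⟩ := QuotientAddGroup.mk_surjective t
  exact funext fun p => flow_comm o a b s t p

/-- The action of the torus defined by the flows. -/
def torusHom (ℓ : Fin n → Set.Ioi (0 : ℝ)) :
    Γ.Torus →+ Additive (Function.End (starModuli o ℓ)) :=
  AddMonoidHom.noncommPiCoprod (circleHom o ℓ) (addCommute_circleHom o)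

/-- The action of the torus defined by the flows. -/
def torusAct (T : Γ.Torus) (p : starModuli o ℓ) : starModuli o ℓ :=
  (Additive.toMul (torusHom o ℓ T) : Function.End (starModuli o ℓ)) p

theorem torusAct_zero (p : starModuli o ℓ) : torusAct o (0 : Γ.Torus) p = p := by
  rw [torusAct, map_zero]
  rfl

theorem torusAct_add (S T : Γ.Torus) (p : starModuli o ℓ) :
    torusAct o (S + T) p = torusAct o S (torusAct o T p) := by
  rw [torusAct, map_add]
  rfl

theorem torusSingle_eq {V : Type*} {Γ : AdmissibleGraph V n} [DecidableEq Γ.IntEdge] (a : Γ.IntEdge) (t : ℝ) :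
    torusSingle a t = Pi.single a (t : AddCircle (2 * Real.pi)) := by
  funext b
  rw [torusSingle, Pi.single_apply]
  split_ifs <;> rfl

theorem torusAct_single (a : Γ.IntEdge) (t : ℝ) (p : starModuli o ℓ) :
    torusAct o (torusSingle a t) p = flow o ℓ a t p := by
  classical
  rw [torusAct, torusHom, torusSingle_eq, AddMonoidHom.noncommPiCoprod_single]
  rfl

open Classical in
/-- A property of the elements of the torus with coordinates in a finite set of edges follows
from the case of a single coordinate. -/
theorem torus_induction {V : Type*} {Γ : AdmissibleGraph V n} {P : Γ.Torus → Prop} (s : Finset Γ.IntEdge) (h0 : P 0)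
    (hadd : ∀ S T, P S → P T → P (S + T)) (h : ∀ a ∈ s, ∀ t, P (torusSingle a t)) (T : Γ.Torus) :
    P (∑ a ∈ s, Pi.single a (T a)) := by
  refine Finset.sum_induction _ P hadd h0 fun a ha => ?_
  obtain ⟨t, ht⟩ := QuotientAddGroup.mk_surjective (T a)
  rw [← ht, ← torusSingle_eq]
  exact h a ha t

theorem lengthMap_torusAct (T : Γ.Torus) (p : starModuli o ℓ) :
    lengthMap o ℓ (starVal (torusAct o T p)) = lengthMap o ℓ (starVal p) := by
  classical
  rw [← Finset.univ_sum_single T]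
  refine torus_induction (P := fun T => ∀ p : starModuli o ℓ,
    lengthMap o ℓ (starVal (torusAct o T p)) = lengthMap o ℓ (starVal p)) Finset.univ
    (fun p => ?_) (fun S T hS hT p => ?_) (fun a _ t p => ?_) T p
  · rw [torusAct_zero]
  · rw [torusAct_add, hS, hT]
  · rw [torusAct_single, lengthMap_flow]

/-- Smoothness is expressed on the universal cover of the torus, where the action is a composition
of the smooth flows of the edges, added one at a time. -/
theorem contMDiff_torusAct : ContMDiff (𝓘(ℝ, Γ.IntEdge → ℝ).prod 𝓘(ℝ, ModelSpace n))
    𝓘(ℝ, ModelSpace n) ∞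
    (fun q : (Γ.IntEdge → ℝ) × starModuli o ℓ => torusAct o (torusMk q.1) q.2) := by
  classical
  have h : ∀ s : Finset Γ.IntEdge, ContMDiff (𝓘(ℝ, Γ.IntEdge → ℝ).prod 𝓘(ℝ, ModelSpace n))
      𝓘(ℝ, ModelSpace n) ∞ (fun q : (Γ.IntEdge → ℝ) × starModuli o ℓ =>
        torusAct o (∑ a ∈ s, torusSingle a (q.1 a)) q.2) := by
    intro s
    induction s using Finset.induction_on with
    | empty =>
      simp only [Finset.sum_empty, torusAct_zero]
      exact contMDiff_snd
    | insert a s ha ih =>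
      simp only [Finset.sum_insert ha, torusAct_add, torusAct_single]
      have h1 : ContMDiff (𝓘(ℝ, Γ.IntEdge → ℝ).prod 𝓘(ℝ, ModelSpace n)) 𝓘(ℝ, ℝ) ∞
          (fun q : (Γ.IntEdge → ℝ) × starModuli o ℓ => q.1 a) :=
        (contDiff_apply ℝ ℝ a).contMDiff.comp contMDiff_fst
      exact ContMDiff.comp (g := fun q : ℝ × starModuli o ℓ => flow o ℓ a q.1 q.2)
        (f := fun q : (Γ.IntEdge → ℝ) × starModuli o ℓ =>
          (q.1 a, torusAct o (∑ a ∈ s, torusSingle a (q.1 a)) q.2)) (contMDiff_flow o a)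
        (h1.prodMk ih)
  have h2 : ∀ t : Γ.IntEdge → ℝ, torusMk t = ∑ a, torusSingle a (t a) := by
    intro t
    simp only [torusSingle_eq]
    exact (Finset.univ_sum_single (torusMk t)).symm
  simp only [h2]
  exact h Finset.univ

end

section
/-! ### Freeness and transitivity on the fibres -/

variable {n : ℕ} {V : Type*} [Finite V] {x y : Fin n → LieSU2} {ℓ : Fin n → Set.Ioi (0 : ℝ)}
  {Γ : AdmissibleGraph V n} {o : Γ.Orientation}

/-- The tuple `x` represents the point `p`. -/
def IsLift (p : starModuli o ℓ) (x : Fin n → LieSU2) : Prop :=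
  ∃ hx : x ∈ regPolygonSet ℓ, proj ℓ ⟨x, hx⟩ = p.1

theorem exists_isLift (p : starModuli o ℓ) : ∃ x, IsLift p x := by
  obtain ⟨⟨x, hx⟩, h⟩ := proj_surjective ℓ p.1
  exact ⟨x, hx, h⟩

theorem IsLift.smul {p : starModuli o ℓ} (h : IsLift p x) (g : SU2) : IsLift p (g • x) := by
  obtain ⟨hx, h⟩ := h
  have hg : g • x ∈ regPolygonSet ℓ := by
    refine ⟨(g • (⟨x, hx.1⟩ : polygonSet ℓ)).2, fun hc => ?_⟩
    have := hc.smul g⁻¹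
    rw [inv_smul_smul] at this
    exact hx.2 this
  refine ⟨hg, ?_⟩
  rw [← h]
  exact proj_eq_iff.2 ⟨g, rfl⟩

theorem IsLift.exists_smul_eq {p : starModuli o ℓ} (hx : IsLift p x) (hy : IsLift p y) :
    ∃ g : SU2, g • x = y := by
  obtain ⟨hx, h⟩ := hx
  obtain ⟨hy, h'⟩ := hy
  obtain ⟨g, hg⟩ := proj_eq_iff.1 (h'.trans h.symm)
  exact ⟨g, hg⟩

theorem IsLift.isRegular {p : starModuli o ℓ} (hx : IsLift p x) (hp : starVal p ∈ regModuli o ℓ) :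
    IsRegular o ℓ x := by
  obtain ⟨hx, h⟩ := hx
  refine ⟨hx.1, ?_⟩
  rw [starVal, ← h] at hp
  exact hp

theorem IsLift.norm_tri {p : starModuli o ℓ} (hx : IsLift p x) {v : V} (e : LocEdge Γ v) :
    ‖tri x e‖ = Sum.elim (lengthMap o ℓ (starVal p)) (fun i => (ℓ i : ℝ)) (toEdge e) := by
  obtain ⟨hx, h⟩ := hx
  rw [PolygonSpace.norm_tri o hx.1, starVal, ← h]
  rfl

theorem IsLift.partSum_ne_zero {p : starModuli o ℓ} (hx : IsLift p x) {v w : V}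
    (h : Γ.graph.Adj v w) : partSum (sideSet Γ v w) x ≠ 0 := by
  have h1 := hx.norm_tri (Sum.inl ⟨w, h⟩ : LocEdge Γ v)
  exact norm_ne_zero_iff.1 (h1.trans_ne (p.2 (mkEdge h)))

/-- The side to be bent can be chosen freely, whatever the orientation `o`. This lets a prescribed
triangle be kept fixed. -/
theorem IsLift.flow {p : starModuli o ℓ} (hx : IsLift p x) {v w : V} (h : Γ.graph.Adj v w)
    (t : ℝ) : IsLift (flow o ℓ (mkEdge h) t p) (bend (sideSet Γ v w) t x) := by
  have h0 := hx.partSum_ne_zero h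
  obtain ⟨hx, hp⟩ := hx
  refine ⟨bend_mem_reg hx h0 t, ?_⟩
  change _ = modBend (initialSet o (mkEdge h)) t p.1
  rw [← hp, ← modBend_proj hx h0]
  rcases dart_cases o h with h1 | h1
  · rw [h1]
  · rw [h1, modBend_compl_proj hx h0]

theorem mkEdge_symm {V : Type*} {Γ : AdmissibleGraph V n} {v w : V} (h : Γ.graph.Adj v w) :
    mkEdge h.symm = mkEdge h := Subtype.ext Sym2.eq_swap

/-- Naming the endpoints so that the edge points away from `v` makes the bending of its far side
leave the triangle at `v` unmoved. -/
theorem exists_mkEdge {V : Type*} {Γ : AdmissibleGraph V n} (v : V) (a : Γ.IntEdge) :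
    ∃ p q, ∃ h : Γ.graph.Adj p q, a = mkEdge h ∧ v ∉ farSide Γ.graph p q := by
  obtain ⟨a, ha⟩ := a
  induction a using Sym2.ind with
  | h p q =>
    have h : Γ.graph.Adj p q := (SimpleGraph.mem_edgeSet _).1 ha
    by_cases hv : v ∈ farSide Γ.graph p q
    · exact ⟨q, p, h.symm, (mkEdge_symm h).symm, farSide_disjoint Γ.isTree h hv⟩
    · exact ⟨p, q, h, rfl, hv⟩

/-- The flow of an edge does not change the polygons at the two endpoints of another edge. -/
theorem exists_isLift_flow {p : starModuli o ℓ} (hx : IsLift p x) {v w : V}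
    (h : Γ.graph.Adj v w) {a : Γ.IntEdge} (ha : a ≠ mkEdge h) (t : ℝ) :
    ∃ x', IsLift (PolygonSpace.flow o ℓ a t p) x' ∧ (∀ e : LocEdge Γ v, tri x' e = tri x e) ∧
      ∀ e : LocEdge Γ w, tri x' e = tri x e := by
  obtain ⟨p', q', h', rfl, hv⟩ := exists_mkEdge v a
  have h0 := hx.partSum_ne_zero h'
  refine ⟨_, hx.flow h' t, tri_bend hv h0 t, tri_bend (fun hw => ?_) h0 t⟩
  -- Suppose that `w` were beyond the edge `p'q'`. If this edge starts at `v`, then `w = q'` and it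
  -- is the edge `vw`; if not, the neighbour `v` of `w` would be beyond it too.
  by_cases hpv : p' = v
  · subst hpv
    have h1 := eq_of_mem_farSide Γ.isTree h h' (end_mem_farSide h.ne) hw
    subst h1
    exact ha rfl
  · exact hv (mem_farSide_of_adj h hpv hw)

/-- The factors of the other edges can be lifted without moving the triangles at the ends of `a`;
the factor of `a` then changes only the dihedral angle between these triangles. If the class is
unchanged, so is the angle. -/
theorem torusAct_free (hn : 4 ≤ n) {p : starModuli o ℓ} (hp : starVal p ∈ regModuli o ℓ)
    {T : Γ.Torus} (hT : torusAct o T p = p) : T = 0 := by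
  classical
  obtain ⟨x, hx⟩ := exists_isLift p
  have hreg := hx.isRegular hp
  funext a
  obtain ⟨t, ht⟩ := QuotientAddGroup.mk_surjective (T a)
  -- Any vertex will do here: it is replaced at once by an endpoint of `a`.
  obtain ⟨v⟩ := Γ.isTree.connected.nonempty
  obtain ⟨v, w, h, rfl, -⟩ := exists_mkEdge v a
  obtain ⟨T', hT'⟩ : ∃ T', T' = ∑ b ∈ Finset.univ.erase (mkEdge h), Pi.single b (T b) := ⟨_, rfl⟩
  have h1 : T = torusSingle (mkEdge h) t + T' := by
    rw [torusSingle_eq, hT', ht,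
      Finset.add_sum_erase _ (fun b => Pi.single b (T b)) (Finset.mem_univ _),
      Finset.univ_sum_single]
  have h2 : ∀ p : starModuli o ℓ, ∀ x, IsLift p x → ∃ x', IsLift (torusAct o T' p) x' ∧
      (∀ e : LocEdge Γ v, tri x' e = tri x e) ∧ ∀ e : LocEdge Γ w, tri x' e = tri x e := by
    rw [hT']
    refine torus_induction (P := fun T => ∀ p : starModuli o ℓ, ∀ x, IsLift p x →
      ∃ x', IsLift (torusAct o T p) x' ∧
      (∀ e : LocEdge Γ v, tri x' e = tri x e) ∧ ∀ e : LocEdge Γ w, tri x' e = tri x e)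
      _ (fun p x hx => ?_) (fun S T hS hT p x hx => ?_) (fun b hb s p x hx => ?_) T
    · rw [torusAct_zero]
      exact ⟨x, hx, fun _ => rfl, fun _ => rfl⟩
    · obtain ⟨x', hx', h3, h4⟩ := hT p x hx
      obtain ⟨x'', hx'', h5, h6⟩ := hS _ x' hx'
      rw [torusAct_add]
      exact ⟨x'', hx'', fun e => (h5 e).trans (h3 e), fun e => (h6 e).trans (h4 e)⟩
    · rw [torusAct_single]
      exact exists_isLift_flow hx h (Finset.ne_of_mem_erase hb) s
  obtain ⟨x', hx', hv, hw⟩ := h2 p x hx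
  have h3 := hx'.flow h t
  have h0 := hx'.partSum_ne_zero h
  rw [← torusAct_single, ← torusAct_add, ← h1, hT] at h3
  obtain ⟨g, hg⟩ := hx.exists_smul_eq h3
  have h4 : ∀ e : LocEdge Γ v, g • tri x e = tri x e := by
    intro e
    rw [← tri_smul, hg, tri_bend (self_notMem_farSide v w) h0, hv]
  obtain ⟨e₁, -, he, -⟩ := exists_three (Sum.inl ⟨w, h⟩ : LocEdge Γ v)
  -- The global rotation `g` relating the two lifts fixes the non-degenerate triangle at `v`, so it
  -- acts trivially and the lifts coincide.
  have h5 := smul_eq_self_of_fixed (tri_ne_zero hn hreg _) (tri_notMem_span hn hreg he) (h4 _) (h4 _)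
  obtain ⟨e₂, -, he', -⟩ := exists_three (Sum.inl ⟨v, h.symm⟩ : LocEdge Γ w)
  -- At `w` the triangle is turned by `t` around the common side; a side off this axis is fixed,
  -- which forces `t = 0` in the circle.
  have h6 : rot (axis (sideSet Γ v w) x') t (tri x e₂) = tri x e₂ := by
    rw [← hw, ← tri_bend_end h t e₂ he'.symm, ← hg, tri_smul, h5, hw]
  have h7 : tri x e₂ ∉ Submodule.span ℝ {axis (sideSet Γ v w) x'} := by
    intro hmem
    refine tri_notMem_span hn hreg he' ?_
    obtain ⟨c, hc⟩ := Submodule.mem_span_singleton.1 hmem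
    refine Submodule.mem_span_singleton.2 ⟨-c * ‖partSum (sideSet Γ v w) x'‖⁻¹, ?_⟩
    rw [← hw (Sum.inl ⟨v, h.symm⟩), tri_swap h hx'.1.1, ← hc, axis, smul_neg, neg_mul, neg_smul,
      neg_neg, smul_smul]
  rw [Pi.zero_apply, ← ht]
  exact eq_zero_of_rot_eq (norm_axis h0) h7 h6

/-- The law of cosines: the side lengths of a triangle determine its Gram matrix. -/
theorem inner_tri_eq {V : Type*} {Γ : AdmissibleGraph V n} {v : V} {e e₁ e₂ : LocEdge Γ v} (hx : tri x e + tri x e₁ + tri x e₂ = 0)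
    (hy : tri y e + tri y e₁ + tri y e₂ = 0) (h : ∀ e : LocEdge Γ v, ‖tri x e‖ = ‖tri y e‖) :
    inner ℝ (tri x e) (tri x e₁) = inner ℝ (tri y e) (tri y e₁) := by
  have h1 := norm_add_sq_real (tri x e) (tri x e₁)
  have h2 := norm_add_sq_real (tri y e) (tri y e₁)
  rw [eq_neg_of_add_eq_zero_left hx, norm_neg, h, h, h] at h1
  rw [eq_neg_of_add_eq_zero_left hy, norm_neg] at h2
  linarith

theorem tri_eq_of_two {V : Type*} {Γ : AdmissibleGraph V n} {v : V} {e e₁ e₂ : LocEdge Γ v} (h3 : ∀ e', e' = e ∨ e' = e₁ ∨ e' = e₂)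
    (hx : tri x e + tri x e₁ + tri x e₂ = 0) (hy : tri y e + tri y e₁ + tri y e₂ = 0)
    (h : tri x e = tri y e) (h₁ : tri x e₁ = tri y e₁) (e' : LocEdge Γ v) : tri x e' = tri y e' := by
  rcases h3 e' with rfl | rfl | rfl
  · exact h
  · exact h₁
  · rw [← neg_eq_of_add_eq_zero_right hx, ← neg_eq_of_add_eq_zero_right hy, h, h₁]

/-- Equal lengths make the triangles at each vertex congruent. One triangle is aligned by a global
rotation, and the others are aligned successively across the edges by bending. -/
theorem exists_torusAct_eq (hn : 4 ≤ n) {p : starModuli o ℓ} (hp : starVal p ∈ regModuli o ℓ)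
    (hy : y ∈ polygonSet ℓ) (h : lengthMap o ℓ (toModuli ℓ ⟨y, hy⟩) = lengthMap o ℓ (starVal p)) :
    ∃ T : Γ.Torus, starVal (torusAct o T p) = toModuli ℓ ⟨y, hy⟩ := by
  have hyreg : IsRegular o ℓ y := ⟨hy, by rw [regModuli, Set.mem_preimage, h]; exact hp⟩
  have hnorm : ∀ T : Γ.Torus, ∀ x, IsLift (torusAct o T p) x → ∀ (v : V) (e : LocEdge Γ v),
      ‖tri x e‖ = ‖tri y e‖ := by
    intro T x hx v e
    rw [hx.norm_tri, PolygonSpace.norm_tri o hy, h, lengthMap_torusAct]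
  have hreg : ∀ T : Γ.Torus, ∀ x, IsLift (torusAct o T p) x → IsRegular o ℓ x :=
    fun T x hx => hx.isRegular (by
      rw [regModuli, Set.mem_preimage, lengthMap_torusAct]
      exact hp)
  obtain ⟨r⟩ := Γ.isTree.connected.nonempty
  -- `W` is a maximal set of vertices, connected to the root `r` inside itself, on which some lift
  -- of a point of the torus orbit has the same triangles as `y`.
  obtain ⟨W, hW⟩ := Set.Finite.exists_maximal (s := {W : Set V | r ∈ W ∧
    (∀ u ∈ W, ∃ c : Γ.graph.Walk u r, ∀ z ∈ c.support, z ∈ W) ∧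
    ∃ T x, IsLift (torusAct o T p) x ∧ ∀ v ∈ W, ∀ e : LocEdge Γ v, tri x e = tri y e})
    (Set.toFinite _) (by
      refine ⟨{r}, rfl, ?_, ?_⟩
      · rintro u rfl
        exact ⟨SimpleGraph.Walk.nil, fun z hz => by simpa using hz⟩
      · obtain ⟨x, hx⟩ := exists_isLift p
        rw [← torusAct_zero o p] at hx
        obtain ⟨w, hw⟩ := exists_adj hn Γ r
        obtain ⟨e₁, e₂, -, -, -, h3, h4⟩ := exists_three (Sum.inl ⟨w, hw⟩ : LocEdge Γ r)
        have hn := hnorm 0 x hx r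
        -- The root triangle is aligned by the freedom in the choice of the lift, with the trivial
        -- torus element.
        obtain ⟨g, hg, hg'⟩ := exists_smul_eq_of_gram (tri_ne_zero ‹_› (hreg 0 x hx) _)
          (u' := tri y (Sum.inl ⟨w, hw⟩ : LocEdge Γ r)) (v := tri x e₁) (v' := tri y e₁)
          (hn _) (hn _) (inner_tri_eq (h4 ℓ x hx.1.1) (h4 ℓ y hy) hn)
        refine ⟨0, g • x, hx.smul g, ?_⟩
        rintro v rfl
        refine tri_eq_of_two h3 (h4 ℓ _ (hx.smul g).1.1) (h4 ℓ y hy) ?_ ?_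
        · rw [tri_smul, hg]
        · rw [tri_smul, hg'])
  obtain ⟨⟨hr, hwalk, T, x, hx, htri⟩, hmax⟩ := hW
  have huniv : ∀ u, u ∈ W := by
    by_contra! hu
    obtain ⟨u, hu⟩ := hu
    obtain ⟨c⟩ := Γ.isTree.connected.preconnected r u
    obtain ⟨⟨⟨v, w⟩, hvw⟩, -, hv, hw⟩ := c.exists_boundary_dart W hr hu
    change v ∈ W at hv
    change w ∉ W at hw
    change Γ.graph.Adj v w at hvw
    -- Every vertex of `W` is joined to `v` inside `W`, hence without passing through `w`; so
    -- bending the far side of `vw` preserves what has been aligned.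
    have hfar : ∀ z ∈ W, z ∉ farSide Γ.graph v w := by
      intro z hz
      refine farSide_disjoint Γ.isTree hvw.symm ?_
      obtain ⟨c, hc⟩ := hwalk z hz
      obtain ⟨c', hc'⟩ := hwalk v hv
      refine ⟨c.append c'.reverse, fun hmem => hw ?_⟩
      rcases (SimpleGraph.Walk.mem_support_append_iff _ _).1 hmem with h1 | h1
      · exact hc w h1
      · rw [SimpleGraph.Walk.support_reverse, List.mem_reverse] at h1
        exact hc' w h1
    have h0 := hx.partSum_ne_zero hvw
    have hswap := tri_swap hvw hx.1.1
    have hX : tri x (Sum.inl ⟨v, hvw.symm⟩ : LocEdge Γ w) =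
        tri y (Sum.inl ⟨v, hvw.symm⟩ : LocEdge Γ w) := by
      rw [hswap, tri_swap hvw hy]
      exact congrArg Neg.neg (htri v hv (Sum.inl ⟨w, hvw⟩))
    obtain ⟨e₁, e₂, he, -, -, h3, h4⟩ := exists_three (Sum.inl ⟨v, hvw.symm⟩ : LocEdge Γ w)
    have hin := inner_tri_eq (h4 ℓ x hx.1.1) (h4 ℓ y hy) (hnorm T x hx w)
    rw [← hX, hswap, inner_neg_left, inner_neg_left, neg_inj] at hin
    -- The triangles of `x` and `y` at `w` already share the side along `vw`, so a rotation around
    -- this side carries one to the other; its angle is the torus coordinate to be added.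
    obtain ⟨t, ht⟩ := exists_rot_eq (norm_axis h0) (hnorm T x hx w e₁)
      (by rw [axis, real_inner_smul_left, real_inner_smul_left, hin])
    have hx' := hx.flow hvw t
    rw [← torusAct_single, ← torusAct_add] at hx'
    have hsub : insert w W ⊆ W := by
      refine hmax ⟨Set.mem_insert_of_mem _ hr, ?_, _, _, hx', ?_⟩ (Set.subset_insert _ _)
      · rintro z (rfl | hz)
        · obtain ⟨c, hc⟩ := hwalk v hv
          refine ⟨SimpleGraph.Walk.cons hvw.symm c, fun z' hz' => ?_⟩
          rw [SimpleGraph.Walk.support_cons, List.mem_cons] at hz'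
          exact hz'.imp id (hc z')
        · obtain ⟨c, hc⟩ := hwalk z hz
          exact ⟨c, fun z' hz' => Set.mem_insert_of_mem _ (hc z' hz')⟩
      · rintro z (rfl | hz)
        · refine tri_eq_of_two h3 (h4 ℓ _ hx'.1.1) (h4 ℓ y hy) ?_ ?_
          · rw [tri_swap hvw hx'.1.1, partSum_bend_self h0, ← hswap, hX]
          · rw [tri_bend_end hvw t e₁ he.symm, ht]
        · intro e
          rw [tri_bend (hfar z hz) h0, htri z hz]
    exact hw (hsub (Set.mem_insert _ _))
  -- Each side of the polygon is also a side of the triangle at the endpoint of its half-edge.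
  have hxy : x = y := by
    funext i
    rw [← tri_inr (Γ := Γ) x, htri _ (huniv _), tri_inr]
  subst hxy
  obtain ⟨hx, h1⟩ := hx
  refine ⟨T, ?_⟩
  rw [starVal, ← h1]
  rfl

end

end PolygonSpace

end

/-! ### The torus action of the bending flows -/

theorem mainTheorem10 {V : Type*} [Finite V] {n : ℕ} (hn : 4 ≤ n)
    (Γ : AdmissibleGraph V n) (o : Γ.Orientation) (ℓ : Fin n → Set.Ioi (0 : ℝ))
    (hℓ : ∀ j, (ℓ j : ℝ) < (1 / 2) * ∑ i, (ℓ i : ℝ)) :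
    ∃ Φ : Γ.IntEdge → ℝ → starModuli o ℓ → starModuli o ℓ,
      (∀ a, IsHamiltonianFlow (starModuli o ℓ) (fun p => (1 / 2) * lengthMap o ℓ p.1 a) (Φ a) ∧
        ∀ Ψ, IsHamiltonianFlow (starModuli o ℓ) (fun p => (1 / 2) * lengthMap o ℓ p.1 a) Ψ →
          Ψ = Φ a) ∧
      (∀ a b s t p, Φ a s (Φ b t p) = Φ b t (Φ a s p)) ∧
      (∀ a t p, Φ a (t + 2 * Real.pi) p = Φ a t p) ∧
      ∃ _ : AddAction Γ.Torus (starModuli o ℓ),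
        (∀ a t (p : starModuli o ℓ), torusSingle a t +ᵥ p = Φ a t p) ∧
        ContMDiff (𝓘(ℝ, Γ.IntEdge → ℝ).prod 𝓘(ℝ, ModelSpace n)) 𝓘(ℝ, ModelSpace n) ∞
          (fun q : (Γ.IntEdge → ℝ) × starModuli o ℓ => torusMk q.1 +ᵥ q.2) ∧
        (∀ q ∈ regModuli o ℓ, ∃ p : starModuli o ℓ, starVal p = q) ∧
        (∀ p : starModuli o ℓ, starVal p ∈ regModuli o ℓ → ∀ T : Γ.Torus, T +ᵥ p = p → T = 0) ∧
        (∀ p : starModuli o ℓ, starVal p ∈ regModuli o ℓ →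
          {q : Moduli ℓ | lengthMap o ℓ q = lengthMap o ℓ (starVal p)} =
            starVal '' AddAction.orbit Γ.Torus p) := by
  -- Non-degenerate triangles exclude both collinear polygons and vanishing diagonals.
  have hstar : ∀ q ∈ regModuli o ℓ, ∃ p : starModuli o ℓ, starVal p = q := by
    intro q hq
    obtain ⟨⟨x, hx⟩, rfl⟩ := Quotient.exists_rep q
    have hreg : IsRegular o ℓ x := ⟨hx, hq⟩
    exact ⟨⟨proj ℓ ⟨x, hx, hreg.not_isCollinear hn⟩, fun a =>
      norm_ne_zero_iff.2 (lengthMap_ne_zero hn hreg a)⟩, rfl⟩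
  refine ⟨flow o ℓ, fun a => ⟨isHamiltonianFlow_flow o a, fun Ψ hΨ => eq_flow o a hΨ⟩,
    flow_comm o, flow_add_two_pi o,
    { vadd := torusAct o, zero_vadd := torusAct_zero o, add_vadd := torusAct_add o },
    torusAct_single o, contMDiff_torusAct o, hstar, fun p hp T hT => torusAct_free hn hp hT,
    fun p hp => ?_⟩
  ext q
  constructor
  · intro hq
    obtain ⟨⟨y, hy⟩, rfl⟩ := Quotient.exists_rep q
    obtain ⟨T, hT⟩ := exists_torusAct_eq hn hp hy hq
    exact ⟨_, ⟨T, rfl⟩, hT⟩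
  · rintro ⟨_, ⟨T, rfl⟩, rfl⟩
    exact lengthMap_torusAct o T p
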